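/- **Setting.** For a finite set $P$, a *based cactus* with lobes labelled by $P$ is a partition of the circle $S^1=\mathbb R/\mathbb Z$ into closed $1$-manifolds $(I_B)_{B\in P}$ of equal measure, with pairwise disjoint interiors, such that there are no cyclically ordered points $z_1,z_2,z_3,z_4$ with $z_1,z_3\in I_B$, $z_2,z_4\in I_C$, $B\ne C$. The set $\mathcal C_P$ of based cacti has the metric $d(x,y)=\sum_B\mu(I_B(x)\setminus \mathring I_B(y))$; $S^1$ acts by moving the base point, and $\mathcal C_P/S^1$ is the space of *unbased cacti*. Fix continuous sections $\sigma_P$ of $p:\mathcal C_P\to\mathcal C_P/S^1$. Based cacti are composed by inserting a cactus, reparametrized at constant speed, into a lobe so that its base point goes to the local base point of the lobe. A *nested tree* with $n$ leaves is a collection $\mathcal S$ of subsets (vertices) of $\{1,\dots,n\}$ of cardinality at least $2$, containing the root $R=\{1,\dots,n\}$, any two of which are disjoint or nested. The edges into $S\in\mathcal S$ are the maximal vertices strictly inside $S$ (internal edges) and the elements of $S$ contained in none of these (open edges); $\mathcal C_{|S|}$ denotes cacti with lobes labelled by the edges into $S$. Given $x_S\in\mathcal C_{|S|}/S^1$ for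 $S\in\mathcal S$ and $\alpha_S\in S^1$ for $S\ne R$, let $\gamma_{\mathcal S}^\sigma(x_R,(\alpha_S,x_S)_{S\neq R})$ be obtained recursively by inserting into the lobes of $\sigma(x_R)$ that correspond to internal edges $(S_i,R)$ the cacti of the subtrees with roots $S_i$, rotated by $\alpha_{S_i}$. The space of nested cacti $N_n^\sigma(\mathcal C/S^1)$ is the quotient of $\bigsqcup_{\mathcal S} \mathcal C_{|R|}/S^1\times\prod_{S\in\mathcal S\setminus\{R\}}(D_2\times \mathcal C_{|S|}/S^1)$, where the points of the closed unit disc $D_2$ are written in polar coordinates $(t_S,\alpha_S)$, by the equivalence relation generated as follows. If $t_{S_0}=1$ and $\mathcal T\subseteq\mathcal S$ is the maximal subtree containing $S_0$ such that $t_S\ne0$ for all $S\in\mathcal T$ other than the root $U$ of $\mathcal T$, then a point over $\mathcal S$ is identified with a point over $\mathcal S\setminus\{S_0\}$ whenever they have equal radial parameters at all vertices other than $S_0$, equal cacti and equal disc coordinates at the vertices outside $\mathcal T$, and $p\circ\gamma^\sigma_{\mathcal T}$ of the first equals $p\circ\gamma^\sigma_{\mathcal T\setminus\{S_0\}}$ of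 the second. A *cell* $\tau=(\mathcal S,(C_S)_{S\in\mathcal S})$ consists of a nested tree $\mathrm{tree}(\tau)=\mathcal S$ and a cell $C_S$ of $\mathcal C_{|S|}/S^1$ for each vertex; $C_S$ is the product of simplices of all unbased cacti with a given cyclic word of lobes. The open cell consists of the nested cacti over $\mathcal S$ with $x_S\in C_S$ and $t_S<1$, and the closed cell is the image of $\overline C_R\times\prod_{S\ne R}(D_2\times\overline C_S)$. The barycenter $B\tau$ has $t_S=0$ for all $S\neq R$ and $x_S$ the barycenter of $C_S$. For a strictly increasing chain of cells $\tau_0\subset\dots\subset\tau_k$ (each in the boundary of the next) let $(\tau_0)=\{B\tau_0\}$ and let $(\tau_0,\dots,\tau_k)$ be the cone on $(\tau_0,\dots,\tau_{k-1})$ with vertex $B\tau_k$, formed by straight segments in the coordinates of $\overline\tau_k$. The *dual cell* $\tau^*$ is the union of all simplices $(\tau_0,\dots,\tau_k)$ with $\tau_0=\tau$, $k\ge 0$; the *open dual cell* is the union of the interiors of these simplices. For a nested tree $\mathcal S$ the closed stratum $\overline{N_n(\mathcal S)}\subseteq N_n^\sigma(\mathcal C/S^1)$ consists of the nested cacti that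 can be represented over some nested tree $\mathcal T\supseteq\mathcal S$ with $t_S=0$ for all $S\in\mathcal S\setminus\{R\}$. **Proposition.** For each nested tree $\mathcal S$ with $n$ leaves, $$\overline{N_n(\mathcal S)}=\bigcup_{\tau\text{ cell},\ \mathrm{tree}(\tau)\supseteq\mathcal S}\tau^*.$$ Moreover $\overline{N_n(\mathcal S)}$ is a subcomplex of the dual cell decomposition: it is closed, it is a union of open dual cells, and with each open dual cell it contains the corresponding closed dual cell. It is the closure in $N_n^\sigma(\mathcal C/S^1)$ of the stratum of all nested cacti that can be represented over some $\mathcal T\supseteq\mathcal S$ so that the vertices $S\in\mathcal T\setminus\{R\}$ with $t_S=0$ are exactly those of $\mathcal S\setminus\{R\}$. -/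

import Mathlib

open Set MeasureTheory

noncomputable section

namespace NestedCacti

/-! ### Cacti -/

/-- The circle `ℝ / ℤ`, of total length one, with base point `0`. -/
abbrev Circ : Type := AddCircle (1 : ℝ)

/-- Compact one-dimensional submanifolds with boundary of the circle: finite unions of closed arcs
of positive length (the whole circle included). -/
def IsArcUnion (I : Set Circ) : Prop :=
  ∃ F : Finset (ℝ × ℝ), (∀ a ∈ F, a.1 < a.2) ∧
    I = ⋃ a ∈ F, (fun u : ℝ => (u : Circ)) '' Icc a.1 a.2

/-- Based cacti with lobes labelled by the finite set `P`: partitions of the circle into closed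
one-manifolds of equal measure, with pairwise disjoint interiors, no two of which cross. -/
structure Cactus {A : Type} (P : Finset A) where
  lobe : P → Set Circ
  isArcUnion : ∀ B, IsArcUnion (lobe B)
  cover : ⋃ B, lobe B = univ
  measure_eq : ∀ B C, volume (lobe B) = volume (lobe C)
  disjoint_interior : ∀ B C, B ≠ C → Disjoint (interior (lobe B)) (interior (lobe C))
  /-- There are no cyclically ordered points of the circle belonging alternately to two lobes. -/
  noncrossing : ∀ B C, B ≠ C → ¬ ∃ u₁ u₂ u₃ u₄ : ℝ,
    u₁ < u₂ ∧ u₂ < u₃ ∧ u₃ < u₄ ∧ u₄ < u₁ + 1 ∧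
    (u₁ : Circ) ∈ lobe B ∧ (u₂ : Circ) ∈ lobe C ∧ (u₃ : Circ) ∈ lobe B ∧ (u₄ : Circ) ∈ lobe C

namespace Cactus

variable {A : Type} {P : Finset A}

/-- The distance `∑ μ (I_B(x) - interior I_B(y))` between two cacti. -/
def cdist (x y : Cactus P) : ℝ :=
  ∑ B, (volume (x.lobe B \ interior (y.lobe B))).toReal

/-- The topology of the distance `cdist`: it is generated by the open balls. -/
instance : TopologicalSpace (Cactus P) :=
  TopologicalSpace.generateFrom {U | ∃ (x : Cactus P) (r : ℝ), U = {y | cdist x y < r}}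

/-- Two based cacti differ by a rotation: `y` is `x` with its base point moved to `a`. -/
instance rotSetoid (P : Finset A) : Setoid (Cactus P) where
  r x y := ∃ a : Circ, ∀ B, y.lobe B = {u | u + a ∈ x.lobe B}
  iseqv :=
    { refl := fun x => ⟨0, fun B => by simp⟩
      symm := by
        rintro x y ⟨a, h⟩
        exact ⟨-a, fun B => by simp [h]⟩
      trans := by
        rintro x y z ⟨a, h⟩ ⟨b, h'⟩
        exact ⟨b + a, fun B => by simp [h, h', add_assoc]⟩ }

/-- The cactus map. The source is rescaled to have period one, and the map is extended to the real
line by `c (t + 1) = c t + (1, …, 1)`. The coordinate `B` increases with slope `card P` while the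
point runs through the lobe `B`, and is constant otherwise. -/
def cactusMap (x : Cactus P) (t : ℝ) (B : P) : ℝ :=
  P.card * ∫ u in (0 : ℝ)..t, (x.lobe B).indicator (fun _ => (1 : ℝ)) (u : Circ)

end Cactus

/-- The space of unbased cacti, with the quotient topology. -/
abbrev UnbasedCactus {A : Type} (P : Finset A) : Type := Quotient (Cactus.rotSetoid P)

/-- A choice of continuous sections of the projections from based to unbased cacti, for all finite
sets of labels which are subsets of `{1, …, n}`. -/
structure Sections (n : ℕ) where
  sec : ∀ P : Finset (Finset (Fin n)), UnbasedCactus P → Cactus P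
  continuous_sec : ∀ P, Continuous (sec P)
  mk_sec : ∀ P (x : UnbasedCactus P), (⟦sec P x⟧ : UnbasedCactus P) = x

/-! ### Composition of cacti, in terms of cactus maps -/

/-- Rotation of (the cactus described by) a cactus map. -/
def rotMap {A : Type} (a : ℝ) (c : ℝ → A → ℝ) : ℝ → A → ℝ :=
  fun t B => c (t + a) B - c a B

/-- The cactus map of the one-lobed cactus with lobe labelled by `B`; the coordinates of labels
which do not occur are zero. -/
def unitMap {A : Type} [DecidableEq A] (B : A) : ℝ → A → ℝ :=
  fun t C => if C = B then t else 0

/-- The operadic composition of cactus maps. The cactus with map `f B` has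
`m B = ∑ C, f B 1 C` lobes. With `α t = (∑ m B * c t B) / ∑ m B`, the composite `w` is determined by
`w (α t) C = f B (c t B) C`, for `C` the label of a lobe of the cactus inserted in the lobe `B`. -/
def composeMap {A : Type} [Fintype A] {P : Finset A} (c : ℝ → P → ℝ) (f : P → ℝ → A → ℝ) :
    ℝ → A → ℝ :=
  let m : P → ℝ := fun B => ∑ C, f B 1 C
  let α : ℝ → ℝ := fun t => (∑ B, m B * c t B) / ∑ B, m B
  fun u C => ∑ B, f B (c (Function.invFun α u) B) C

/-! ### Nested trees -/

/-- Nested trees with leaves labelled by `Fin n`. -/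
@[ext]
structure NestedTree (n : ℕ) where
  verts : Finset (Finset (Fin n))
  two_le_card : ∀ S ∈ verts, 2 ≤ S.card
  root_mem : Finset.univ ∈ verts
  laminar : ∀ S ∈ verts, ∀ S' ∈ verts, Disjoint S S' ∨ S ⊆ S' ∨ S' ⊆ S

namespace NestedTree

variable {n : ℕ}

/-- The edges going into the vertex `S`: an internal edge is recorded as the vertex it goes out of,
an open edge `i` as the singleton `{i}`. -/
def inEdges (T : NestedTree n) (S : Finset (Fin n)) : Finset (Finset (Fin n)) :=
  Finset.univ.filter fun B =>
    (B ∈ T.verts ∨ B.card = 1) ∧ B ⊂ S ∧ ∀ B' ∈ T.verts, B ⊂ B' → ¬ B' ⊂ S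

theorem ssubset_of_mem_inEdges {T : NestedTree n} {S B : Finset (Fin n)}
    (h : B ∈ T.inEdges S) : B ⊂ S := by
  simp only [inEdges, Finset.mem_filter] at h
  exact h.2.2.1

/-- The vertices different from the root. -/
abbrev NonRoot (T : NestedTree n) : Type := {S // S ∈ T.verts ∧ S ≠ Finset.univ}

end NestedTree

/-! ### The space of nested cacti -/

/-- The stratum `St(T)`: an unbased cactus for each vertex, and a point of the closed unit disc
for each vertex different from the root. The point `t * exp (2 * π * i * α)` of the disc has radial
parameter `t` and angular parameter `α`. -/
abbrev Stratum {n : ℕ} (T : NestedTree n) : Type :=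
  (∀ S : T.verts, UnbasedCactus (T.inEdges S)) × (T.NonRoot → Metric.closedBall (0 : ℂ) 1)

namespace Stratum

variable {n : ℕ} {T : NestedTree n}

/-- The disc coordinate of a vertex, extended by zero to the root and to all other sets. -/
def coord (p : Stratum T) (S : Finset (Fin n)) : ℂ :=
  if h : S ∈ T.verts ∧ S ≠ Finset.univ then (p.2 ⟨S, h⟩ : ℂ) else 0

/-- The maximal subtree with root `U` whose vertices other than `U` all have non-zero radial
parameter. -/
def subtree (p : Stratum T) (U : Finset (Fin n)) : Set (Finset (Fin n)) :=
  {S | S ∈ T.verts ∧ S ⊆ U ∧ ∀ W ∈ T.verts, S ⊆ W → W ⊂ U → p.coord W ≠ 0}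

/-- The cactus map of the based cactus obtained by composing the cacti which decorate the subtree
`p.subtree S`, using the sections and the angular parameters. The lobes of the composite are
labelled by the leaves of the subtree (edges of radial parameter zero and open edges). -/
def gamma (σ : Sections n) (p : Stratum T) (S : Finset (Fin n)) :
    ℝ → Finset (Fin n) → ℝ :=
  if hS : S ∈ T.verts then
    composeMap (σ.sec _ (p.1 ⟨S, hS⟩)).cactusMap
      (fun B => if p.coord B.1 = 0 then unitMap B.1
        else rotMap (Complex.arg (p.coord B.1) / (2 * Real.pi)) (gamma σ p B.1))
  else 0
termination_by S.card
decreasing_by exact Finset.card_lt_card (NestedTree.ssubset_of_mem_inEdges B.2)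

end Stratum

/-- The elementary identification in the disjoint union of the strata: a vertex `S₀` of radial
parameter one is removed, and the cacti decorating the maximal subtree containing `S₀` with
non-zero radial parameters (outside its root `U`) are replaced by cacti having the same composite
up to rotation. The unit radius of `S₀` says that the edge out of `S₀` may be contracted. -/
def Step {n : ℕ} (σ : Sections n) (p q : Σ T : NestedTree n, Stratum T) : Prop :=
  ∃ S₀ U : Finset (Fin n), S₀ ∈ p.1.verts ∧ S₀ ≠ Finset.univ ∧ ‖p.2.coord S₀‖ = 1 ∧
    q.1.verts = p.1.verts.erase S₀ ∧
    U ∈ p.1.verts ∧ p.2.coord U = 0 ∧ S₀ ∈ p.2.subtree U ∧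
    (∀ S (h : S ∈ p.1.verts) (h' : S ∈ q.1.verts), S ∉ p.2.subtree U →
      HEq (p.2.1 ⟨S, h⟩) (q.2.1 ⟨S, h'⟩) ∧ p.2.coord S = q.2.coord S) ∧
    (∀ S ∈ p.1.verts, S ≠ S₀ → ‖p.2.coord S‖ = ‖q.2.coord S‖) ∧
    ∃ a : ℝ, rotMap a (p.2.gamma σ U) = q.2.gamma σ U

/-- The space of nested cacti with `n` leaves: the quotient of the disjoint union of the strata by
the equivalence relation generated by the elementary identifications, with the quotient topology. -/
def Space {n : ℕ} (σ : Sections n) : Type := Quot (Step σ)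

instance {n : ℕ} (σ : Sections n) : TopologicalSpace (Space σ) :=
  inferInstanceAs (TopologicalSpace (Quot (Step σ)))

/-- The nested cactus with underlying tree `T` and decorations `p`. -/
def Space.mk {n : ℕ} (σ : Sections n) (T : NestedTree n) (p : Stratum T) : Space σ :=
  Quot.mk (Step σ) ⟨T, p⟩

/-- The closed stratum of `S`: some representative has a tree containing `S`, and radial parameter
zero at all vertices of `S` different from the root. -/
def closedStratum {n : ℕ} (σ : Sections n) (S : NestedTree n) : Set (Space σ) :=
  {q | ∃ (T : NestedTree n) (p : Stratum T), q = Space.mk σ T p ∧ S.verts ⊆ T.verts ∧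
    ∀ V ∈ S.verts, p.coord V = 0}

/-- The open stratum of `S`: some representative has a tree containing `S` such that the vertices
(different from the root) of radial parameter zero are exactly those of `S`. -/
def openStratum {n : ℕ} (σ : Sections n) (S : NestedTree n) : Set (Space σ) :=
  {q | ∃ (T : NestedTree n) (p : Stratum T), q = Space.mk σ T p ∧ S.verts ⊆ T.verts ∧
    ∀ V ∈ T.verts, p.coord V = 0 ↔ V ∈ S.verts}

/-! ### Cells -/

/-- A cell of the space of unbased cacti with lobes labelled by `P` is given by a cyclic word in
which all labels occur, cyclically adjacent letters are different, and there is no subsequence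
`i, j, i, j` with `i ≠ j`. (Cyclic permutations of a word describe the same cell.) -/
structure CyclicWord {A : Type} (P : Finset A) where
  len : ℕ
  letter : Fin len → A
  mem_iff : ∀ B, B ∈ P ↔ ∃ i, letter i = B
  adjacent_ne : ∀ i j : Fin len, (j : ℕ) = (i + 1) % len → letter i ≠ letter j
  noncrossing : ∀ i j k l : Fin len, i < j → j < k → k < l →
    letter i = letter k → letter j = letter l → letter i = letter j

namespace CyclicWord

variable {A : Type} [DecidableEq A] {P : Finset A}

/-- The product of closed simplices: one length for each letter, the lengths of the arcs of any
given lobe add up to one. -/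
def closedModel (X : CyclicWord P) : Set (Fin X.len → ℝ) :=
  {l | (∀ i, 0 ≤ l i) ∧ ∀ B ∈ P, ∑ i with X.letter i = B, l i = 1}

/-- The product of open simplices. -/
def openModel (X : CyclicWord P) : Set (Fin X.len → ℝ) :=
  {l | (∀ i, 0 < l i) ∧ ∀ B ∈ P, ∑ i with X.letter i = B, l i = 1}

/-- The product of the barycenters of the simplices. -/
def bary (X : CyclicWord P) : Fin X.len → ℝ :=
  fun i => 1 / ((Finset.univ.filter fun j => X.letter j = X.letter i).card : ℝ)

/-- The point of the circle at which the `k`-th arc starts (the circle has length one, and there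
are `P.card` lobes). -/
def start (X : CyclicWord P) (l : Fin X.len → ℝ) (k : ℕ) : ℝ :=
  (∑ i : Fin X.len, if (i : ℕ) < k then l i else 0) / P.card

/-- The unbased cactus `x` is obtained by placing arcs of lengths `l` around the circle in the
order given by the word, and collapsing the arcs of length zero. -/
def Realizes (X : CyclicWord P) (l : Fin X.len → ℝ) (x : UnbasedCactus P) : Prop :=
  ∃ y : Cactus P, ⟦y⟧ = x ∧ ∀ B : P, y.lobe B =
    ⋃ i ∈ {i : Fin X.len | X.letter i = B ∧ 0 < l i},
      (fun u : ℝ => (u : Circ)) '' Icc (X.start l i) (X.start l (i + 1))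

end CyclicWord

/-- A cell of the space of nested cacti: a nested tree, and a cell of unbased cacti for each
vertex. -/
structure Cell (n : ℕ) where
  tree : NestedTree n
  word : ∀ S : tree.verts, CyclicWord (tree.inEdges S)

namespace Cell

variable {n : ℕ}

/-- The vector space of the coordinates of a cell: arc lengths and disc coordinates. -/
abbrev Coords (τ : Cell n) : Type :=
  (∀ S : τ.tree.verts, Fin (τ.word S).len → ℝ) × (τ.tree.NonRoot → ℂ)

/-- The product of closed simplices and closed discs. -/
def closedModel (τ : Cell n) : Set τ.Coords :=
  {e | (∀ S, e.1 S ∈ (τ.word S).closedModel) ∧ ∀ S, ‖e.2 S‖ ≤ 1}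

/-- The product of open simplices and open discs. -/
def openModel (τ : Cell n) : Set τ.Coords :=
  {e | (∀ S, e.1 S ∈ (τ.word S).openModel) ∧ ∀ S, ‖e.2 S‖ < 1}

/-- The coordinates of the barycenter: barycentric arc lengths, radial parameters zero. -/
def bary (τ : Cell n) : τ.Coords := (fun S => (τ.word S).bary, 0)

variable (σ : Sections n)

/-- The characteristic map of the cell, as a relation: `q` is the nested cactus with coordinates
`e`. -/
def HasCoords (τ : Cell n) (e : τ.Coords) (q : Space σ) : Prop :=
  ∃ p : Stratum τ.tree, q = Space.mk σ τ.tree p ∧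
    (∀ S, (τ.word S).Realizes (e.1 S) (p.1 S)) ∧ ∀ S, (p.2 S : ℂ) = e.2 S

/-- The open cell. -/
def openCell (τ : Cell n) : Set (Space σ) := {q | ∃ e ∈ τ.openModel, τ.HasCoords σ e q}

/-- The closed cell, image of the characteristic map. -/
def closedCell (τ : Cell n) : Set (Space σ) := {q | ∃ e ∈ τ.closedModel, τ.HasCoords σ e q}

/-- `ρ` is a proper face of `τ`: it is contained in the boundary of `τ`. -/
def IsProperFace (ρ τ : Cell n) : Prop := ρ.openCell σ ⊆ τ.closedCell σ \ τ.openCell σ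

/-- The union of the points with parameter in `J` on the segments from the barycenter of `τ`
(parameter zero) to the points of `Z` (parameter one), where the segments are straight in the
coordinates of `τ`. For `J = [0, 1]` it is the cone on `Z` with vertex the barycenter. -/
def cone (τ : Cell n) (J : Set ℝ) (Z : Set (Space σ)) : Set (Space σ) :=
  {q | ∃ e ∈ τ.closedModel, (∃ z ∈ Z, τ.HasCoords σ e z) ∧
    ∃ s ∈ J, τ.HasCoords σ ((1 - s) • τ.bary + s • e) q}

/-- The simplex `(τ₀, …, τₖ)` (for `J = [0, 1]`) or its interior (for `J = (0, 1)`), for the list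
`τₖ, …, τ₀`. -/
def simplex (J : Set ℝ) : List (Cell n) → Set (Space σ)
  | [] => ∅
  | [τ] => {q | τ.HasCoords σ τ.bary q}
  | τ :: ρ :: c => τ.cone σ J (simplex J (ρ :: c))

/-- Chains `τ = τ₀ ⊂ τ₁ ⊂ ⋯ ⊂ τₖ` of cells, written in the order `τₖ, …, τ₀`. -/
def IsChainFrom (τ : Cell n) (c : List (Cell n)) : Prop :=
  c.IsChain (fun τ' ρ => IsProperFace σ ρ τ') ∧ c.getLast? = some τ

/-- The (closed) dual cell of `τ`: the union of the simplices `(τ₀, …, τₖ)` with `τ₀ = τ`. -/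
def dualCell (τ : Cell n) : Set (Space σ) :=
  ⋃ c ∈ {c | IsChainFrom σ τ c}, simplex σ (Icc 0 1) c

/-- The open dual cell of `τ`: the union of the interiors of the simplices `(τ₀, …, τₖ)` with
`τ₀ = τ`. -/
def openDualCell (τ : Cell n) : Set (Space σ) :=
  ⋃ c ∈ {c | IsChainFrom σ τ c}, simplex σ (Ioo 0 1) c

end Cell

/-- Subcomplexes of the dual cell decomposition: closed subsets which are unions of open dual
cells, and which contain with each open dual cell also the corresponding closed dual cell. -/
def IsDualSubcomplex {n : ℕ} (σ : Sections n) (Y : Set (Space σ)) : Prop :=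
  IsClosed Y ∧ (Y ⊆ ⋃ τ : Cell n, τ.openDualCell σ) ∧
    ∀ τ : Cell n, (τ.openDualCell σ ∩ Y).Nonempty →
      τ.openDualCell σ ⊆ Y ∧ τ.dualCell σ ⊆ Y

end NestedCacti

end

noncomputable section
namespace NestedCacti

/-! ### Cactus maps -/

section Maps

variable {A : Type}

/-! The statement is governed by the radial parameters. For a set `V` of leaves, let the radius of a
nested cactus at `V` be the norm of its disc coordinate if `V` is a vertex of the tree, and 1
otherwise. An elementary identification removes a vertex of radius one and preserves all other
radii, so the radius is a continuous function on the quotient. The closed stratum of `S` is the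
common zero set of the radii at the vertices of `S` (`mem_closedStratum_iff`), hence closed;
replacing superfluous zero coordinates by a small positive number shows that it is the closure of
the open stratum.

Now consider a simplex of the dual cell of `τ`. Barycenters have zero disc coordinates, and moving
along a cone multiplies disc coordinates by the cone parameter. So the radii at vertices of the tree
of `τ` vanish on the whole dual cell (`radius_eq_zero_of_mem_dualCell`), and where all cone
parameters are non-zero no further radius vanishes (`mem_tree_of_mem_openDualCell`). A point of the
open dual cell of `τ` therefore lies in the closed stratum of `S` exactly when the tree of `τ`
contains `S`, and then so does the entire dual cell. It remains to see that the open dual cells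
cover the space.

For this, a point of an open cell other than the barycenter is pushed radially to the boundary
(`exists_boundary`), and one recurses on a complexity of cells. The hard part is
`exists_isProperFace`: a boundary point lies in an open cell that is contained as a whole in the
boundary. It has two ingredients. First, contracting all edges of unit length gives a reduced
representative, and decorations of the same combinatorial type (`Sim`) over the contracted tree lift
back through these contractions with the type preserved (`Contracts.exists_sim`, `exists_reduced`);
closed cells are saturated for type, so the lift stays in the closed cell. Second, the complexity of
the open cell can be read off from the point: the tree consists of the sets of radius less than one,
the decorating cacti are determined by the nested cactus (`eq_of_mk_eq`), and the length of a word
is the number of points shared by two lobes. It drops strictly at the boundary.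

The geometry of cacti is carried out with families of monotone functions of degree one
(`IsCactusMap`), for which insertion is composition of functions and contraction of an edge amounts
to taking weighted sums. -/

theorem surjective_of_add_one {φ : ℝ → ℝ} (hc : Continuous φ) (h1 : ∀ t, φ (t + 1) = φ t + 1) :
    Function.Surjective φ := by
  have hn : ∀ n : ℕ, φ n = φ 0 + n := by
    intro n
    induction n with
    | zero => simp
    | succ k ih => push_cast; rw [h1, ih]; ring
  have hm : ∀ n : ℕ, φ (-n) = φ 0 - n := by
    intro n
    induction n with
    | zero => simp
    | succ k ih =>
      have := h1 (-((k : ℝ) + 1))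
      rw [show -((k : ℝ) + 1) + 1 = -k by ring, ih] at this
      push_cast; linarith
  intro y
  obtain ⟨n, hn'⟩ := exists_nat_ge (y - φ 0)
  obtain ⟨m, hm'⟩ := exists_nat_ge (φ 0 - y)
  exact mem_range_of_exists_le_of_exists_ge hc ⟨-m, by rw [hm]; linarith⟩ ⟨n, by rw [hn]; linarith⟩

/-- Families of monotone maps of degree one, indexed by `P`, such that locally at most one map is
not constant, and no two maps cross. The maps with index outside `P` are constant. -/
structure IsLoopFamily (P : Finset A) (b : ℝ → A → ℝ) : Prop where
  eq_of_notMem : ∀ B ∉ P, ∀ s t, b s B = b t B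
  mono : ∀ B, Monotone fun t => b t B
  cont : ∀ B, Continuous fun t => b t B
  add_one : ∀ B ∈ P, ∀ t, b (t + 1) B = b t B + 1
  right : ∀ t, ∃ B, ∃ t' > t, ∀ C ≠ B, b t' C = b t C
  left : ∀ t, ∃ B, ∃ t' < t, ∀ C ≠ B, b t' C = b t C
  noncrossing : ∀ B C, B ≠ C → ∀ t₁ t₂ t₃ t₄, b t₁ B < b t₂ B → b t₂ C < b t₃ C →
    b t₃ B < b t₄ B → b t₄ C < b (t₁ + 1) C → False

/-- The maps describing cacti with lobes labelled by `P`: normalized loop families. -/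
structure IsCactusMap (P : Finset A) (c : ℝ → A → ℝ) : Prop extends IsLoopFamily P c where
  zero : ∀ B, c 0 B = 0
  sum : ∀ t, ∑ B ∈ P, c t B = P.card * t

/-! ### Basic properties and reparametrization of loop families -/

namespace IsLoopFamily

variable {P : Finset A} {b : ℝ → A → ℝ}

theorem lt_of_lt (h : IsLoopFamily P b) {B : A} {s t : ℝ} (hl : b s B < b t B) : s < t :=
  lt_of_not_ge fun h' => absurd (h.mono B h') (not_le.2 hl)

theorem eq_of_mem_Icc (h : IsLoopFamily P b) {B : A} {s t u v : ℝ} (hl : b s B = b t B)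
    (hu : u ∈ Icc s t) (hv : v ∈ Icc s t) : b u B = b v B := by
  have h1 := h.mono B hu.1
  have h2 := h.mono B hu.2
  have h3 := h.mono B hv.1
  have h4 := h.mono B hv.2
  simp only at h1 h2 h3 h4
  linarith

theorem comp_param (h : IsLoopFamily P b) {θ : ℝ → ℝ} (hm : Monotone θ) (hc : Continuous θ)
    (h1 : ∀ t, θ (t + 1) = θ t + 1) : IsLoopFamily P fun t => b (θ t) where
  eq_of_notMem B hB s t := h.eq_of_notMem B hB _ _
  mono B s t hst := h.mono B (hm hst)
  cont B := (h.cont B).comp hc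
  add_one B hB t := by simp only [h1, h.add_one B hB]
  right t := by
    obtain ⟨B, t', ht', hB⟩ := h.right (θ t)
    have : ∀ᶠ s in nhds t, θ s < t' := hc.continuousAt.eventually_lt continuousAt_const ht'
    obtain ⟨s, hs, hs'⟩ := ((this.filter_mono nhdsWithin_le_nhds).and
      (self_mem_nhdsWithin : Ioi t ∈ nhdsWithin t (Ioi t))).exists
    -- By continuity, `θ` carries a short interval to the right of `t` into `[θ t, t')`, where only
    -- `B` moves.
    exact ⟨B, s, hs', fun C hC => h.eq_of_mem_Icc (hB C hC).symm ⟨hm hs'.le, hs.le⟩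
      ⟨le_rfl, ht'.le⟩⟩
  left t := by
    obtain ⟨B, t', ht', hB⟩ := h.left (θ t)
    have : ∀ᶠ s in nhds t, t' < θ s := continuousAt_const.eventually_lt hc.continuousAt ht'
    obtain ⟨s, hs, hs'⟩ := ((this.filter_mono nhdsWithin_le_nhds).and
      (self_mem_nhdsWithin : Iio t ∈ nhdsWithin t (Iio t))).exists
    exact ⟨B, s, hs', fun C hC => h.eq_of_mem_Icc (hB C hC) ⟨hs.le, hm (le_of_lt hs')⟩
      ⟨ht'.le, le_rfl⟩⟩
  noncrossing B C hBC t₁ t₂ t₃ t₄ a1 a2 a3 a4 :=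
    h.noncrossing B C hBC _ _ _ _ a1 a2 a3 (by rwa [← h1])

end IsLoopFamily

/-- The normalized parameter of a loop family. -/
def loopParam (P : Finset A) (b : ℝ → A → ℝ) (t : ℝ) : ℝ := (∑ B ∈ P, (b t B - b 0 B)) / P.card

namespace IsLoopFamily

variable {P : Finset A} {b : ℝ → A → ℝ}

theorem loopParam_mono (h : IsLoopFamily P b) : Monotone (loopParam P b) := by
  intro s t hst
  unfold loopParam
  gcongr with B
  exact h.mono B hst

theorem loopParam_continuous (h : IsLoopFamily P b) : Continuous (loopParam P b) := by
  unfold loopParam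
  have := h.cont
  fun_prop

theorem loopParam_add_one (h : IsLoopFamily P b) (hP : P.Nonempty) (t : ℝ) :
    loopParam P b (t + 1) = loopParam P b t + 1 := by
  have hp : (P.card : ℝ) ≠ 0 := by simpa using hP.ne_empty
  unfold loopParam
  rw [Finset.sum_congr rfl fun B hB => by rw [h.add_one B hB t, add_sub_right_comm],
    Finset.sum_add_distrib]
  simp
  field_simp

theorem loopParam_surjective (h : IsLoopFamily P b) (hP : P.Nonempty) :
    Function.Surjective (loopParam P b) :=
  surjective_of_add_one h.loopParam_continuous (h.loopParam_add_one hP)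

/-- The parameter is a sum of monotone functions; if the sum does not change between two times, no
summand does. Hence the family factors through its parameter. -/
theorem eq_of_loopParam_eq (h : IsLoopFamily P b) {s t : ℝ}
    (hst : loopParam P b s = loopParam P b t) (B : A) : b s B = b t B := by
  by_cases hB : B ∈ P
  swap
  · exact h.eq_of_notMem B hB s t
  have hp : (P.card : ℝ) ≠ 0 := by simpa using Finset.ne_empty_of_mem hB
  unfold loopParam at hst
  rw [div_left_inj' hp] at hst
  wlog hle : s ≤ t generalizing s t
  · exact (this hst.symm (le_of_not_ge hle)).symm
  have := (Finset.sum_eq_sum_iff_of_le fun C (_ : C ∈ P) =>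
    sub_le_sub_right (h.mono C hle) (b 0 C)).1 hst B hB
  simpa using this

end IsLoopFamily

/-- Each increment is bounded by the sum of all increments, so every coordinate is Lipschitz with
constant `P.card`. -/
theorem continuous_of_mono_of_sum {P : Finset A} {c : ℝ → A → ℝ}
    (mono : ∀ B, Monotone fun t => c t B) (sum : ∀ t, ∑ B ∈ P, c t B = P.card * t) (B : A)
    (hB : B ∈ P) : Continuous fun t => c t B := by
  have key : ∀ s t, s ≤ t → c t B - c s B ≤ P.card * (t - s) := by
    intro s t hst
    have : c t B - c s B ≤ ∑ C ∈ P, (c t C - c s C) :=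
      Finset.single_le_sum (f := fun C => c t C - c s C) (fun C _ => sub_nonneg.2 (mono C hst)) hB
    rw [Finset.sum_sub_distrib, sum, sum] at this
    linarith
  refine LipschitzWith.continuous (K := P.card) (LipschitzWith.of_dist_le_mul fun s t => ?_)
  simp only [Real.dist_eq, NNReal.coe_natCast]
  rcases le_total s t with hst | hst
  · rw [abs_sub_comm, abs_sub_comm s, abs_of_nonneg (sub_nonneg.2 (mono B hst)),
      abs_of_nonneg (sub_nonneg.2 hst)]
    exact key s t hst
  · rw [abs_of_nonneg (sub_nonneg.2 (mono B hst)), abs_of_nonneg (sub_nonneg.2 hst)]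
    exact key t s hst

/-- A loop family becomes a cactus map after reparametrization. -/
theorem IsLoopFamily.exists_isCactusMap {P : Finset A} {b : ℝ → A → ℝ} (h : IsLoopFamily P b)
    (hP : P.Nonempty) :
    ∃ c, IsCactusMap P c ∧ ∀ u B, c (loopParam P b u) B = b u B - b 0 B := by
  have hp : (P.card : ℝ) ≠ 0 := by simpa using hP.ne_empty
  set φ := loopParam P b with hφ
  have hsurj : Function.Surjective φ := h.loopParam_surjective hP
  -- Any right inverse will do: by `eq_of_loopParam_eq` the family is constant on the fibres of the
  -- parameter.
  obtain ⟨ψ, hψ⟩ := hsurj.hasRightInverse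
  let c : ℝ → A → ℝ := fun t B => b (ψ t) B - b 0 B
  have hc : ∀ u B, c (φ u) B = b u B - b 0 B := fun u B => by
    simp only [c]
    rw [h.eq_of_loopParam_eq (hψ (φ u)) B]
  have mono : ∀ B, Monotone fun t => c t B := by
    intro B s t hst
    obtain ⟨u, rfl⟩ := hsurj s
    obtain ⟨v, rfl⟩ := hsurj t
    simp only [hc]
    rcases le_total u v with huv | huv
    · exact sub_le_sub_right (h.mono B huv) _
    · rw [h.eq_of_loopParam_eq (le_antisymm hst (h.loopParam_mono huv)) B]
  have sum : ∀ t, ∑ B ∈ P, c t B = P.card * t := by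
    intro t
    obtain ⟨u, rfl⟩ := hsurj t
    rw [Finset.sum_congr rfl fun B _ => hc u B, hφ, loopParam, mul_div_cancel₀ _ hp]
  -- The right end of the fibre over `t`: moving to the right of it strictly increases `φ`, so that
  -- local constancy of `b` there gives local constancy of `c` on a genuine interval. The next claim
  -- is the mirror image.
  have hbdd : ∀ t, ∃ v, φ v = t ∧ ∀ u > v, t < φ u := by
    intro t
    have hcl : IsClosed {u | φ u = t} := isClosed_eq h.loopParam_continuous continuous_const
    obtain ⟨w, hw⟩ := hsurj t
    have hb : BddAbove {u | φ u = t} := ⟨w + 1, fun u hu => by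
      by_contra hlt
      have := h.loopParam_mono (not_le.1 hlt).le
      rw [h.loopParam_add_one hP] at this
      simp only [mem_ofPred_eq] at hu
      change φ w + 1 ≤ φ u at this
      linarith⟩
    have hmem := hcl.csSup_mem ⟨w, hw⟩ hb
    refine ⟨_, hmem, fun u hu => ?_⟩
    have h1 : φ (sSup {u | φ u = t}) ≤ φ u := h.loopParam_mono (le_of_lt hu)
    rw [show φ (sSup {u | φ u = t}) = t from hmem] at h1
    refine lt_of_le_of_ne h1 fun h2 => ?_
    exact absurd (le_csSup hb (show u ∈ {u | φ u = t} from h2.symm)) (not_le.2 hu)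
  have hbdd' : ∀ t, ∃ v, φ v = t ∧ ∀ u < v, φ u < t := by
    intro t
    have hcl : IsClosed {u | φ u = t} := isClosed_eq h.loopParam_continuous continuous_const
    obtain ⟨w, hw⟩ := hsurj t
    have hb : BddBelow {u | φ u = t} := ⟨w - 1, fun u hu => by
      by_contra hlt
      have := h.loopParam_mono (not_le.1 hlt).le
      have h2 := h.loopParam_add_one hP (w - 1)
      rw [sub_add_cancel] at h2
      simp only [mem_ofPred_eq] at hu
      change φ u ≤ φ (w - 1) at this
      change φ w = φ (w - 1) + 1 at h2
      linarith⟩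
    have hmem := hcl.csInf_mem ⟨w, hw⟩ hb
    refine ⟨_, hmem, fun u hu => ?_⟩
    have h1 : φ u ≤ φ (sInf {u | φ u = t}) := h.loopParam_mono (le_of_lt hu)
    rw [show φ (sInf {u | φ u = t}) = t from hmem] at h1
    refine lt_of_le_of_ne h1 fun h2 => ?_
    exact absurd (csInf_le hb (show u ∈ {u | φ u = t} from h2)) (not_le.2 hu)
  refine ⟨c, ⟨⟨fun B hB s t => ?_, mono, fun B => ?_, fun B hB t => ?_, fun t => ?_, fun t => ?_,
    fun B C hBC t₁ t₂ t₃ t₄ => ?_⟩, fun B => ?_, sum⟩, hc⟩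
  · simp only [c, h.eq_of_notMem B hB (ψ s) (ψ t)]
  · by_cases hB : B ∈ P
    · exact continuous_of_mono_of_sum mono sum B hB
    · simp only [c, h.eq_of_notMem B hB _ 0, sub_self]
      exact continuous_const
  · obtain ⟨u, rfl⟩ := hsurj t
    rw [hφ, ← h.loopParam_add_one hP, ← hφ, hc, hc, h.add_one B hB]
    ring
  · obtain ⟨v, rfl, hv⟩ := hbdd t
    obtain ⟨B, t', ht', hB⟩ := h.right v
    exact ⟨B, φ t', hv t' ht', fun C hC => by rw [hc, hc, hB C hC]⟩
  · obtain ⟨v, rfl, hv⟩ := hbdd' t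
    obtain ⟨B, t', ht', hB⟩ := h.left v
    exact ⟨B, φ t', hv t' ht', fun C hC => by rw [hc, hc, hB C hC]⟩
  · obtain ⟨u₁, rfl⟩ := hsurj t₁
    obtain ⟨u₂, rfl⟩ := hsurj t₂
    obtain ⟨u₃, rfl⟩ := hsurj t₃
    obtain ⟨u₄, rfl⟩ := hsurj t₄
    rw [hφ, ← h.loopParam_add_one hP, ← hφ]
    simp only [hc, sub_lt_sub_iff_right]
    exact h.noncrossing B C hBC u₁ u₂ u₃ u₄
  · have : φ 0 = 0 := by simp [hφ, loopParam]
    have h0 := hc 0 B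
    rwa [this, sub_self] at h0

/-! ### Cactus maps: periodicity, rotation, insertion -/

namespace IsCactusMap

variable {P : Finset A} {c : ℝ → A → ℝ}

theorem eq_zero (h : IsCactusMap P c) {B : A} (hB : B ∉ P) (t : ℝ) : c t B = 0 := by
  rw [h.eq_of_notMem B hB t 0, h.zero]

theorem add_intCast (h : IsCactusMap P c) (t : ℝ) (n : ℤ) (B : A) :
    c (t + n) B = c t B + n * c 1 B := by
  have h1 : ∀ t, c (t + 1) B = c t B + c 1 B := by
    intro t
    by_cases hB : B ∈ P
    · have := h.add_one B hB 0
      rw [zero_add, h.zero, zero_add] at this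
      rw [h.add_one B hB, this]
    · simp [h.eq_zero hB]
  induction n with
  | zero => simp
  | succ n ih =>
    push_cast at ih ⊢
    rw [← add_assoc, h1, ih]; ring
  | pred n ih =>
    push_cast at ih ⊢
    have := h1 (t + (-n - 1))
    rw [show t + (-(n : ℝ) - 1) + 1 = t + -n by ring, ih] at this
    linarith

theorem one_apply (h : IsCactusMap P c) {B : A} (hB : B ∈ P) : c 1 B = 1 := by
  have := h.add_one B hB 0
  rwa [zero_add, h.zero, zero_add] at this

/-- The coordinates add up to a non-zero multiple of time, so they determine it. -/
theorem eq_of_forall (h : IsCactusMap P c) (hP : P.Nonempty) {s t : ℝ} (hst : ∀ B ∈ P, c s B = c t B) :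
    s = t := by
  have hp : (P.card : ℝ) ≠ 0 := by simpa using hP.ne_empty
  have := h.sum s
  rw [Finset.sum_congr rfl hst, h.sum t] at this
  exact (mul_left_cancel₀ hp this).symm

theorem rotMap (h : IsCactusMap P c) (a : ℝ) : IsCactusMap P (rotMap a c) where
  toIsLoopFamily := by
    have h' := h.comp_param (θ := fun t => t + a) (fun s t hst => by simpa using hst)
      (by fun_prop) (fun t => by ring)
    refine ⟨fun B hB s t => ?_, fun B s t hst => ?_, fun B => ?_, fun B hB t => ?_, fun t => ?_,
      fun t => ?_, fun B C hBC t₁ t₂ t₃ t₄ => ?_⟩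
    · simpa [NestedCacti.rotMap] using h'.eq_of_notMem B hB s t
    · simpa [NestedCacti.rotMap] using h'.mono B hst
    · exact (h'.cont B).sub continuous_const
    · simp only [NestedCacti.rotMap, h'.add_one B hB t]; ring
    · simpa [NestedCacti.rotMap] using h'.right t
    · simpa [NestedCacti.rotMap] using h'.left t
    · simpa [NestedCacti.rotMap] using h'.noncrossing B C hBC t₁ t₂ t₃ t₄
  zero B := by simp [NestedCacti.rotMap]
  sum t := by
    simp only [NestedCacti.rotMap, Finset.sum_sub_distrib, h.sum]; ring

end IsCactusMap

theorem rotMap_rotMap (a b : ℝ) (c : ℝ → A → ℝ) : rotMap a (rotMap b c) = rotMap (a + b) c := by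
  funext t B
  simp only [rotMap, add_assoc]; ring

theorem rotMap_zero {P : Finset A} {c : ℝ → A → ℝ} (h : IsCactusMap P c) : rotMap 0 c = c := by
  funext t B
  simp [rotMap, h.zero]

theorem rotMap_add_intCast {P : Finset A} {c : ℝ → A → ℝ} (h : IsCactusMap P c) (a : ℝ) (n : ℤ) :
    rotMap (a + n) c = rotMap a c := by
  funext t B
  simp only [rotMap]
  rw [← add_assoc, h.add_intCast, h.add_intCast]; ring

theorem isCactusMap_unitMap [DecidableEq A] (B : A) : IsCactusMap {B} (unitMap B) where
  eq_of_notMem C hC s t := by simp [unitMap, Finset.mem_singleton.not.1 hC]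
  mono C s t hst := by simp only [unitMap]; split_ifs <;> simp [hst]
  cont C := by simp only [unitMap]; split_ifs <;> fun_prop
  add_one C hC t := by simp [unitMap, Finset.mem_singleton.1 hC]
  right t := ⟨B, t + 1, by simp, fun C hC => by simp [unitMap, hC]⟩
  left t := ⟨B, t - 1, by simp, fun C hC => by simp [unitMap, hC]⟩
  noncrossing C D hCD t₁ t₂ t₃ t₄ h1 h2 := by
    simp only [unitMap] at h1 h2
    split_ifs at h1 h2 with h h'
    · exact absurd (h.trans h'.symm) hCD
    all_goals simp at h1 h2
  zero C := by simp [unitMap]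
  sum t := by simp [unitMap]

/-- The family obtained by inserting loop families into the lobes of a loop family. -/
theorem IsLoopFamily.compose [DecidableEq A] {P : Finset A} {c : ℝ → A → ℝ}
    (hc : IsLoopFamily P c) {f : A → ℝ → A → ℝ} {Q : A → Finset A}
    (hf : ∀ B ∈ P, IsLoopFamily (Q B) (f B))
    (hQ : ∀ B ∈ P, ∀ B' ∈ P, B ≠ B' → Disjoint (Q B) (Q B')) :
    IsLoopFamily (P.biUnion Q) fun t C => ∑ B ∈ P, f B (c t B) C := by
  -- Only the summand of the lobe `B` whose inserted family contains `C` can move in the coordinate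
  -- `C`, since the label sets are disjoint.
  have hdiff : ∀ B ∈ P, ∀ C ∈ Q B, ∀ s t, (∑ B ∈ P, f B (c t B) C) - (∑ B ∈ P, f B (c s B) C) =
      f B (c t B) C - f B (c s B) C := by
    intro B hB C hC s t
    rw [← Finset.sum_sub_distrib]
    refine Finset.sum_eq_single_of_mem B hB fun B' hB' hne => ?_
    rw [(hf B' hB').eq_of_notMem C (fun h => Finset.disjoint_left.1 (hQ B hB B' hB' hne.symm) hC h)
      (c t B') (c s B'), sub_self]
  have mono : ∀ C, Monotone fun t => ∑ B ∈ P, f B (c t B) C := fun C s t hst =>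
    Finset.sum_le_sum fun B hB => (hf B hB).mono C (hc.mono B hst)
  refine ⟨fun C hC s t => ?_, mono, fun C => ?_, fun C hC t => ?_,
    fun t => ?_, fun t => ?_, fun C C' hCC t₁ t₂ t₃ t₄ h1 h2 h3 h4 => ?_⟩
  · refine Finset.sum_congr rfl fun B hB => (hf B hB).eq_of_notMem C (fun h => hC ?_) _ _
    exact Finset.mem_biUnion.2 ⟨B, hB, h⟩
  · exact continuous_finsetSum _ fun B hB => ((hf B hB).cont C).comp (hc.cont B)
  · obtain ⟨B, hB, hC⟩ := Finset.mem_biUnion.1 hC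
    have := hdiff B hB C hC t (t + 1)
    rw [hc.add_one B hB, (hf B hB).add_one C hC] at this
    linarith
  · obtain ⟨B, t', ht', hB⟩ := hc.right t
    by_cases hBP : B ∈ P
    -- Shortly after `t` only the lobe `B` advances, and within the family inserted there only `C`
    -- advances as long as `c s B` has not reached `s'`.
    · obtain ⟨C, s', hs', hC⟩ := (hf B hBP).right (c t B)
      have : ∀ᶠ s in nhds t, c s B < s' :=
        (hc.cont B).continuousAt.eventually_lt continuousAt_const hs'
      obtain ⟨s, hs, hs1, hs2⟩ := ((this.filter_mono nhdsWithin_le_nhds).and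
        (Ioo_mem_nhdsGT ht' : Ioo t t' ∈ nhdsWithin t (Ioi t))).exists
      refine ⟨C, s, hs1, fun C' hC' => Finset.sum_congr rfl fun B' hB' => ?_⟩
      by_cases hBB : B' = B
      · subst hBB
        exact (hf B' hB').eq_of_mem_Icc (hC C' hC').symm ⟨hc.mono _ hs1.le, hs.le⟩
          ⟨le_rfl, hs'.le⟩
      · rw [hc.eq_of_mem_Icc (hB B' hBB).symm ⟨hs1.le, hs2.le⟩ ⟨le_rfl, ht'.le⟩]
    · exact ⟨B, t', ht', fun C _ => Finset.sum_congr rfl fun B' hB' => by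
        rw [hB B' (fun h => hBP (h ▸ hB'))]⟩
  · obtain ⟨B, t', ht', hB⟩ := hc.left t
    by_cases hBP : B ∈ P
    · obtain ⟨C, s', hs', hC⟩ := (hf B hBP).left (c t B)
      have : ∀ᶠ s in nhds t, s' < c s B :=
        continuousAt_const.eventually_lt (hc.cont B).continuousAt hs'
      obtain ⟨s, hs, hs1, hs2⟩ := ((this.filter_mono nhdsWithin_le_nhds).and
        (Ioo_mem_nhdsLT ht' : Ioo t' t ∈ nhdsWithin t (Iio t))).exists
      refine ⟨C, s, hs2, fun C' hC' => Finset.sum_congr rfl fun B' hB' => ?_⟩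
      by_cases hBB : B' = B
      · subst hBB
        exact (hf B' hB').eq_of_mem_Icc (hC C' hC') ⟨hs.le, hc.mono _ hs2.le⟩
          ⟨hs'.le, le_rfl⟩
      · rw [hc.eq_of_mem_Icc (hB B' hBB) ⟨hs1.le, hs2.le⟩ ⟨le_of_lt ht', le_rfl⟩]
    · exact ⟨B, t', ht', fun C _ => Finset.sum_congr rfl fun B' hB' => by
        rw [hB B' (fun h => hBP (h ▸ hB'))]⟩
  · have hmem : ∀ C s t, (∑ B ∈ P, f B (c s B) C) < (∑ B ∈ P, f B (c t B) C) →
        ∃ B ∈ P, C ∈ Q B := by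
      intro C s t hlt
      by_contra hno
      push Not at hno
      exact absurd (Finset.sum_congr rfl fun B hB =>
        (hf B hB).eq_of_notMem C (hno B hB) (c s B) (c t B)) hlt.ne
    obtain ⟨B, hB, hCB⟩ := hmem C _ _ h1
    obtain ⟨B', hB', hCB'⟩ := hmem C' _ _ h2
    have g1 := sub_pos.2 h1
    have g2 := sub_pos.2 h2
    have g3 := sub_pos.2 h3
    have g4 := sub_pos.2 h4
    rw [hdiff B hB C hCB, sub_pos] at g1 g3
    rw [hdiff B' hB' C' hCB', sub_pos] at g2 g4
    -- Two labels inserted into the same lobe are controlled by the inserted family, those inserted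
    -- into different lobes by the outer one.
    by_cases hBB : B = B'
    · subst hBB
      rw [hc.add_one B hB] at g4
      exact (hf B hB).noncrossing C C' hCC _ _ _ _ g1 g2 g3 g4
    · exact hc.noncrossing B B' hBB t₁ t₂ t₃ t₄ ((hf B hB).lt_of_lt g1)
        ((hf B' hB').lt_of_lt g2) ((hf B hB).lt_of_lt g3) ((hf B' hB').lt_of_lt g4)

/-! ### Cactus maps of the same combinatorial type -/

/-- Two cactus maps have the same type: they become constant at the same places after suitable
reparametrizations. -/
def Sim (c c' : ℝ → A → ℝ) : Prop :=
  ∃ φ φ' : ℝ → ℝ, (Monotone φ ∧ Function.Surjective φ ∧ ∀ t, φ (t + 1) = φ t + 1) ∧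
    (Monotone φ' ∧ Function.Surjective φ' ∧ ∀ t, φ' (t + 1) = φ' t + 1) ∧
    ∀ B u v, c (φ u) B = c (φ v) B ↔ c' (φ' u) B = c' (φ' v) B

theorem Sim.symm {c c' : ℝ → A → ℝ} (h : Sim c c') : Sim c' c := by
  obtain ⟨φ, φ', h1, h2, h3⟩ := h
  exact ⟨φ', φ, h2, h1, fun B u v => (h3 B u v).symm⟩

theorem Sim.rotMap_left {c c' : ℝ → A → ℝ} (h : Sim c c') (a : ℝ) : Sim (rotMap a c) c' := by
  obtain ⟨φ, φ', ⟨h1, h2, h3⟩, h4, h5⟩ := h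
  refine ⟨fun t => φ t - a, φ', ⟨fun s t hst => sub_le_sub_right (h1 hst) a, fun y => ?_,
    fun t => by simp only [h3]; ring⟩, h4, fun B u v => by simpa [rotMap] using h5 B u v⟩
  obtain ⟨t, ht⟩ := h2 (y + a)
  exact ⟨t, by simp [ht]⟩

theorem Sim.rotMap_right {c c' : ℝ → A → ℝ} (h : Sim c c') (a : ℝ) : Sim c (rotMap a c') :=
  (h.symm.rotMap_left a).symm

/-- A cactus map determines its time, so the two reparametrizations of a `Sim` have the same fibres.
One therefore descends along the other to a strictly increasing map, and the choice of a right
inverse does not matter. -/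
theorem Sim.exists_map {P : Finset A} {c c' : ℝ → A → ℝ} (hP : P.Nonempty)
    (hc : IsCactusMap P c) (hc' : IsCactusMap P c') (h : Sim c c') :
    ∃ η : ℝ → ℝ, StrictMono η ∧ (∀ t, η (t + 1) = η t + 1) ∧
      ∀ B u v, c u B = c v B ↔ c' (η u) B = c' (η v) B := by
  obtain ⟨φ, φ', ⟨h1, h2, h3⟩, ⟨h4, h5, h6⟩, h7⟩ := h
  obtain ⟨ψ, hψ⟩ := h2.hasRightInverse
  have key : ∀ u v, φ u = φ v ↔ φ' u = φ' v := fun u v =>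
    ⟨fun h => hc'.eq_of_forall hP fun B _ => (h7 B u v).1 (by rw [h]),
      fun h => hc.eq_of_forall hP fun B _ => (h7 B u v).2 (by rw [h])⟩
  refine ⟨fun t => φ' (ψ t), fun s t hst => ?_, fun t => ?_, fun B u v => ?_⟩
  · have : ψ s ≤ ψ t := by
      by_contra hlt
      have := h1 (not_le.1 hlt).le
      rw [hψ, hψ] at this
      linarith
    refine lt_of_le_of_ne (h4 this) fun heq => ?_
    have := (key _ _).2 heq
    rw [hψ, hψ] at this
    exact hst.ne this
  · simp only [← h6]
    exact (key _ _).1 (by rw [hψ, h3, hψ])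
  · rw [← h7, hψ, hψ]

/-- Weighted sums of the members of a loop family over groups of labels. -/
def grouped [DecidableEq A] (Q : Finset A) (g : A → A) (μ : A → ℝ) (w : ℝ → A → ℝ) : ℝ → A → ℝ :=
  fun u B => ∑ C ∈ Q with g C = B, μ C * w u C

section Grouped

variable [DecidableEq A] {P Q R : Finset A} {g : A → A} {μ : A → ℝ} {w : ℝ → A → ℝ}

theorem grouped_mono (hw : IsCactusMap Q w) (hμ : ∀ C ∈ R, 0 < μ C) (B : A) :
    Monotone fun u => grouped R g μ w u B := fun s t hst => by
  refine Finset.sum_le_sum fun C hC => ?_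
  exact mul_le_mul_of_nonneg_left (hw.mono C hst) (hμ C (Finset.mem_filter.1 hC).1).le

/-- The weights are positive and the coordinates monotone, so a weighted sum is stationary only if
all its terms are. -/
theorem grouped_eq_iff (hw : IsCactusMap Q w) (hμ : ∀ C ∈ R, 0 < μ C) (B : A) (u v : ℝ) :
    grouped R g μ w u B = grouped R g μ w v B ↔ ∀ C ∈ R, g C = B → w u C = w v C := by
  wlog huv : u ≤ v generalizing u v
  · rw [eq_comm, this v u (le_of_not_ge huv)]
    simp only [eq_comm]
  unfold grouped
  rw [Finset.sum_eq_sum_iff_of_le fun C hC =>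
    mul_le_mul_of_nonneg_left (hw.mono C huv) (hμ C (Finset.mem_filter.1 hC).1).le]
  refine ⟨fun h C hC hg => ?_, fun h C hC => ?_⟩
  · exact mul_left_cancel₀ (hμ C hC).ne' (h C (Finset.mem_filter.2 ⟨hC, hg⟩))
  · simp only [h C (Finset.mem_filter.1 hC).1 (Finset.mem_filter.1 hC).2]

theorem grouped_add_one (hw : IsCactusMap Q w) (hR : R ⊆ Q) {B : A}
    (h1 : ∑ C ∈ R with g C = B, μ C = 1) (u : ℝ) :
    grouped R g μ w (u + 1) B = grouped R g μ w u B + 1 := by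
  unfold grouped
  rw [Finset.sum_congr rfl fun C hC => by
    rw [hw.add_one C (hR (Finset.mem_filter.1 hC).1), mul_add, mul_one],
    Finset.sum_add_distrib, h1]

theorem grouped_continuous (hw : IsCactusMap Q w) (B : A) :
    Continuous fun u => grouped R g μ w u B :=
  continuous_finsetSum _ fun C _ => continuous_const.mul (hw.cont C)

/-- If `c` is obtained from `w` by grouping lobes, then grouping the lobes of a cactus map of the
same type as `w` gives a cactus map of the same type as `c`. -/
theorem exists_sim_of_grouped {w' c : ℝ → A → ℝ} (hw : IsCactusMap Q w) (hw' : IsCactusMap Q w')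
    (hs : Sim w w') (hc : IsCactusMap P c) (hP : P.Nonempty) (hR : R ⊆ Q)
    (hg : ∀ C ∈ R, g C ∈ P) {μ' : A → ℝ} (hμ : ∀ C ∈ R, 0 < μ C) (hμ' : ∀ C ∈ R, 0 < μ' C)
    (h1 : ∀ B ∈ P, ∑ C ∈ R with g C = B, μ C = 1) (h1' : ∀ B ∈ P, ∑ C ∈ R with g C = B, μ' C = 1)
    {φ : ℝ → ℝ} {k : A → ℝ} (hφ : ∀ u, ∀ B ∈ P, c (φ u) B = grouped R g μ w u B + k B) :
    ∃ c', IsCactusMap P c' ∧ Sim c c' ∧ ∃ φ' : ℝ → ℝ, ∀ u B, c' (φ' u) B = grouped R g μ' w' u B := by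
  have hp : (P.card : ℝ) ≠ 0 := by simpa using hP.ne_empty
  -- Monotonicity, continuity and degree of `φ` are not assumed; they follow because the
  -- normalization of `c` forces this formula.
  have hφ' : ∀ u, φ u = (∑ B ∈ P, (grouped R g μ w u B + k B)) / P.card := fun u => by
    rw [← Finset.sum_congr rfl (hφ u), hc.sum, mul_div_cancel_left₀ _ hp]
  have φmono : Monotone φ := fun s t hst => by
    rw [hφ', hφ']
    gcongr with B
    exact grouped_mono hw hμ B hst
  have φcont : Continuous φ := by
    rw [show φ = _ from funext hφ']
    have := fun B => grouped_continuous (R := R) (g := g) (μ := μ) hw B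
    fun_prop
  have φone : ∀ t, φ (t + 1) = φ t + 1 := fun t => by
    rw [hφ', hφ', Finset.sum_congr rfl fun B hB => by
      rw [grouped_add_one hw hR (h1 B hB) t, add_right_comm], Finset.sum_add_distrib]
    simp
    field_simp
  obtain ⟨χ, χ', ⟨hχ1, hχ2, hχ3⟩, ⟨hχ1', hχ2', hχ3'⟩, hχ⟩ := hs
  set b := grouped R g μ' w' with hb
  have hout : ∀ B ∉ P, ∀ s, b s B = 0 := fun B hB s => by
    rw [hb]
    refine Finset.sum_eq_zero fun C hC => absurd ?_ hB
    rw [← (Finset.mem_filter.1 hC).2]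
    exact hg C (Finset.mem_filter.1 hC).1
  -- The grouped family of `w'` is stationary exactly where `c` is. This transfers the noncrossing
  -- condition from `c` to `b`, and it is also the required `Sim`.
  have key : ∀ B u v, c (φ (χ u)) B = c (φ (χ v)) B ↔ b (χ' u) B = b (χ' v) B := by
    intro B u v
    by_cases hB : B ∈ P
    · rw [hφ _ B hB, hφ _ B hB, add_left_inj, grouped_eq_iff hw hμ, hb, grouped_eq_iff hw' hμ']
      simp only [hχ]
    · simp [hout B hB, hc.eq_zero hB]
  have hlt : ∀ B u v, b (χ' u) B < b (χ' v) B → c (φ (χ u)) B < c (φ (χ v)) B := by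
    intro B u v h
    refine lt_of_le_of_ne (hc.mono B (φmono (hχ1 ?_))) fun heq => h.ne ((key B u v).1 heq)
    by_contra huv
    exact absurd (grouped_mono hw' hμ' B (hχ1' (not_le.1 huv).le)) (not_le.2 h)
  have hfam : IsLoopFamily P b := by
    refine ⟨fun B hB s t => by rw [hout B hB, hout B hB], fun B => grouped_mono hw' hμ' B,
      fun B => grouped_continuous hw' B, fun B hB t => grouped_add_one hw' hR (h1' B hB) t,
      fun t => ?_, fun t => ?_, fun B C hBC t₁ t₂ t₃ t₄ a1 a2 a3 a4 => ?_⟩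
    · obtain ⟨C, t', ht', hC⟩ := hw'.right t
      refine ⟨g C, t', ht', fun B hB => (grouped_eq_iff hw' hμ' B _ _).2 fun C' _ hC' => hC C' ?_⟩
      rintro rfl
      exact hB hC'.symm
    · obtain ⟨C, t', ht', hC⟩ := hw'.left t
      refine ⟨g C, t', ht', fun B hB => (grouped_eq_iff hw' hμ' B _ _).2 fun C' _ hC' => hC C' ?_⟩
      rintro rfl
      exact hB hC'.symm
    · obtain ⟨u₁, rfl⟩ := hχ2' t₁
      obtain ⟨u₂, rfl⟩ := hχ2' t₂
      obtain ⟨u₃, rfl⟩ := hχ2' t₃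
      obtain ⟨u₄, rfl⟩ := hχ2' t₄
      rw [← hχ3'] at a4
      have b4 := hlt _ _ _ a4
      rw [hχ3, φone] at b4
      exact hc.noncrossing B C hBC _ _ _ _ (hlt _ _ _ a1) (hlt _ _ _ a2) (hlt _ _ _ a3) b4
  obtain ⟨c', hc', hcb⟩ := hfam.exists_isCactusMap hP
  have hb0 : ∀ B, b 0 B = 0 := fun B => by
    rw [hb]
    exact Finset.sum_eq_zero fun C _ => by rw [hw'.zero, mul_zero]
  simp only [hb0, sub_zero] at hcb
  refine ⟨c', hc', ⟨fun u => φ (χ u), fun u => loopParam P b (χ' u),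
    ⟨φmono.comp hχ1, (surjective_of_add_one φcont φone).comp hχ2, fun t => by simp only [hχ3, φone]⟩,
    ⟨hfam.loopParam_mono.comp hχ1', (hfam.loopParam_surjective hP).comp hχ2',
      fun t => by simp only [hχ3', hfam.loopParam_add_one hP]⟩, fun B u v => ?_⟩, _, hcb⟩
  rw [hcb, hcb, key]

end Grouped

end Maps

end NestedCacti

namespace NestedCacti

/-! ### Markings of cactus maps -/

section Marks

variable {A : Type} {P : Finset A} {c : ℝ → A → ℝ}

/-- The points `s 0 ≤ … ≤ s N = s 0 + 1` cut the circle into arcs, the `i`-th of which belongs to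
the lobe `letter i` of the cactus with map `c`. -/
structure IsMarking (N : ℕ) (letter : Fin N → A) (c : ℝ → A → ℝ) (s : ℕ → ℝ) : Prop where
  le : ∀ i < N, s i ≤ s (i + 1)
  last : s N = s 0 + 1
  const : ∀ i : Fin N, ∀ C ≠ letter i, c (s (i + 1)) C = c (s i) C

theorem exists_mem_Ico_of_steps {s : ℕ → ℝ} {N : ℕ} {t : ℝ} (h0 : s 0 ≤ t) (hN : t < s N) :
    ∃ i < N, s i ≤ t ∧ t < s (i + 1) := by
  induction N with
  | zero => exact absurd h0 (not_le.2 hN)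
  | succ N ih =>
    rcases lt_or_ge t (s N) with h | h
    · obtain ⟨i, hi, h'⟩ := ih h
      exact ⟨i, hi.trans N.lt_succ_self, h'⟩
    · exact ⟨N, N.lt_succ_self, h, hN⟩

theorem exists_mem_Ioc_of_steps {s : ℕ → ℝ} {N : ℕ} {t : ℝ} (h0 : s 0 < t) (hN : t ≤ s N) :
    ∃ i < N, s i < t ∧ t ≤ s (i + 1) := by
  induction N with
  | zero => exact absurd h0 (not_lt.2 hN)
  | succ N ih =>
    rcases le_or_gt t (s N) with h | h
    · obtain ⟨i, hi, h'⟩ := ih h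
      exact ⟨i, hi.trans N.lt_succ_self, h'⟩
    · exact ⟨N, N.lt_succ_self, h, hN⟩

theorem le_of_steps {s : ℕ → ℝ} {N : ℕ} (h : ∀ i < N, s i ≤ s (i + 1)) {i j : ℕ} (hij : i ≤ j)
    (hj : j ≤ N) : s i ≤ s j := by
  induction j with
  | zero => rw [Nat.le_zero.1 hij]
  | succ j ih =>
    rcases Nat.le_succ_iff.1 hij with h' | h'
    · exact (ih h' (by omega)).trans (h j (by omega))
    · rw [h']

theorem lt_of_steps {s : ℕ → ℝ} {N : ℕ} (h : ∀ i < N, s i < s (i + 1)) {i j : ℕ} (hij : i < j)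
    (hj : j ≤ N) : s i < s j :=
  (h i (by omega)).trans_le (le_of_steps (fun i hi => (h i hi).le) hij hj)

/-- If only `B` moves, it absorbs the total speed `P.card`. -/
theorem IsCactusMap.sub_eq_of_const (hc : IsCactusMap P c) {B : A} (hB : B ∈ P) {s t : ℝ}
    (h : ∀ C ≠ B, c t C = c s C) : c t B - c s B = P.card * (t - s) := by
  have := Finset.sum_eq_single_of_mem (f := fun C => c t C - c s C) B hB
    fun C _ hCB => by rw [h C hCB, sub_self]
  rw [Finset.sum_sub_distrib, hc.sum, hc.sum] at this
  linarith

theorem IsCactusMap.mem_of_const (hc : IsCactusMap P c) (hP : P.Nonempty) {B : A} {s t : ℝ}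
    (hst : s ≠ t) (h : ∀ C ≠ B, c t C = c s C) : B ∈ P := by
  by_contra hB
  exact hst (hc.eq_of_forall hP fun C hC => (h C (fun h => hB (h ▸ hC))).symm)

/-- With two different candidates for the moving lobe nothing would move on the common interval,
which contradicts `eq_of_forall`. The following lemma is the version on the left. -/
theorem IsCactusMap.eq_of_const (hc : IsCactusMap P c) (hP : P.Nonempty) {B B' : A} {s t t' : ℝ}
    (ht : s < t) (ht' : s < t') (h : ∀ C ≠ B, c t C = c s C) (h' : ∀ C ≠ B', c t' C = c s C) :
    B = B' := by
  by_contra hBB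
  have hm : s < min t t' := lt_min ht ht'
  refine hm.ne (hc.eq_of_forall hP fun C _ => ?_)
  by_cases hCB : C = B
  · subst hCB
    exact hc.eq_of_mem_Icc (h' C hBB).symm ⟨le_rfl, ht'.le⟩ ⟨hm.le, min_le_right _ _⟩
  · exact hc.eq_of_mem_Icc (h C hCB).symm ⟨le_rfl, ht.le⟩ ⟨hm.le, min_le_left _ _⟩

theorem IsCactusMap.eq_of_const_left (hc : IsCactusMap P c) (hP : P.Nonempty) {B B' : A}
    {s t t' : ℝ} (ht : t < s) (ht' : t' < s) (h : ∀ C ≠ B, c s C = c t C)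
    (h' : ∀ C ≠ B', c s C = c t' C) : B = B' := by
  by_contra hBB
  have hm : max t t' < s := max_lt ht ht'
  refine hm.ne (hc.eq_of_forall hP fun C _ => ?_)
  by_cases hCB : C = B
  · subst hCB
    exact hc.eq_of_mem_Icc (h' C hBB).symm ⟨le_max_right _ _, hm.le⟩ ⟨ht'.le, le_rfl⟩
  · exact hc.eq_of_mem_Icc (h C hCB).symm ⟨le_max_left _ _, hm.le⟩ ⟨ht.le, le_rfl⟩

theorem IsMarking.apply_sub [DecidableEq A] {N : ℕ} {letter : Fin N → A} {s : ℕ → ℝ}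
    (h : IsMarking N letter c s) (hc : IsCactusMap P c) (hl : ∀ i, letter i ∈ P) (B : A) {k : ℕ}
    (hk : k ≤ N) : c (s k) B - c (s 0) B =
      ∑ i : Fin N, if (i : ℕ) < k ∧ letter i = B then P.card * (s (i + 1) - s i) else 0 := by
  induction k with
  | zero => simp
  | succ k ih =>
    have hk' : k < N := hk
    have e : c (s (k + 1)) B - c (s k) B =
        if letter ⟨k, hk'⟩ = B then P.card * (s (k + 1) - s k) else 0 := by
      split_ifs with hB
      · subst hB
        exact hc.sub_eq_of_const (hl ⟨k, hk'⟩) (h.const ⟨k, hk'⟩)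
      · rw [h.const ⟨k, hk'⟩ B (Ne.symm hB), sub_self]
    have e2 : (∑ i : Fin N, if (i : ℕ) = k ∧ letter i = B then P.card * (s (i + 1) - s i) else 0)
        = if letter ⟨k, hk'⟩ = B then P.card * (s (k + 1) - s k) else 0 := by
      rw [Finset.sum_eq_single ⟨k, hk'⟩]
      · simp
      · intro i _ hi
        rw [if_neg]
        rintro ⟨rfl, _⟩
        exact hi rfl
      · simp
    have := ih (by omega)
    rw [← sub_add_sub_cancel (c (s (k + 1)) B) (c (s k) B), this, e, ← e2, ← Finset.sum_add_distrib]
    refine Finset.sum_congr rfl fun i _ => ?_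
    rcases lt_trichotomy (i : ℕ) k with h1 | h1 | h1
    · simp [h1, h1.ne, h1.trans k.lt_succ_self]
    · simp [h1]
    · simp [h1.not_gt, h1.ne', show ¬ (i : ℕ) < k + 1 by omega]

/-- The points of the line at which the lobe changes. -/
def changePoints (c : ℝ → A → ℝ) : Set ℝ :=
  {t | ¬ ∃ B, (∃ t' > t, ∀ C ≠ B, c t' C = c t C) ∧ ∃ t' < t, ∀ C ≠ B, c t' C = c t C}

theorem IsCactusMap.add_one_mem_changePoints (hc : IsCactusMap P c) {t : ℝ}
    (ht : t ∈ changePoints c) : t + 1 ∈ changePoints c := by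
  have h1 : ∀ t C, c (t + 1) C = c t C + c 1 C := fun t C => by
    simpa using hc.add_intCast t 1 C
  rintro ⟨B, ⟨u, hu, hu'⟩, v, hv, hv'⟩
  refine ht ⟨B, ⟨u - 1, by linarith, fun C hC => ?_⟩, v - 1, by linarith, fun C hC => ?_⟩
  · have := hu' C hC
    rw [h1, ← sub_add_cancel u 1, h1] at this
    linarith
  · have := hv' C hC
    rw [h1, ← sub_add_cancel v 1, h1] at this
    linarith

theorem IsLoopFamily.notMem_changePoints (hc : IsLoopFamily P c) {B : A} {s t u : ℝ}
    (h : ∀ C ≠ B, c s C = c t C) (hs : s < u) (ht : u < t) : u ∉ changePoints c := fun hu =>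
  hu ⟨B, ⟨t, ht, fun C hC => hc.eq_of_mem_Icc (h C hC) ⟨(hs.trans ht).le, le_rfl⟩ ⟨hs.le, ht.le⟩⟩,
    s, hs, fun C hC => hc.eq_of_mem_Icc (h C hC) ⟨le_rfl, (hs.trans ht).le⟩ ⟨hs.le, ht.le⟩⟩

/-- At an accumulation point, the intervals on its two sides along which a single lobe moves leave
no room for other change points. -/
theorem IsLoopFamily.finite_changePoints (hc : IsLoopFamily P c) (a b : ℝ) :
    (changePoints c ∩ Icc a b).Finite := by
  by_contra hinf
  obtain ⟨t, -, ht⟩ := Set.Infinite.exists_accPt_of_subset_isCompact hinf isCompact_Icc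
    inter_subset_right
  rw [accPt_iff_frequently] at ht
  obtain ⟨B, u, hu, hB⟩ := hc.right t
  obtain ⟨B', v, hv, hB'⟩ := hc.left t
  obtain ⟨x, ⟨hxt, hxD, _⟩, hx1, hx2⟩ := (ht.and_eventually (Ioo_mem_nhds hv hu)).exists
  rcases lt_or_gt_of_ne hxt with h | h
  · exact hc.notMem_changePoints hB' hx1 h hxD
  · exact hc.notMem_changePoints (fun C hC => (hB C hC).symm) h hx2 hxD

/-- Continuous induction from `a`: at a point where the lobe does not change, the lobe on its left,
which is already known to be `B`, is also the one on its right. -/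
theorem IsCactusMap.exists_const (hc : IsCactusMap P c) (hP : P.Nonempty) {a b : ℝ} (hab : a < b)
    (h : ∀ t ∈ Ioo a b, t ∉ changePoints c) : ∃ B, ∀ C ≠ B, c b C = c a C := by
  obtain ⟨B, a', ha', hB⟩ := hc.right a
  refine ⟨B, ?_⟩
  have hcl : IsClosed ({t | ∀ C ≠ B, c t C = c a C} ∩ Icc a b) := by
    refine IsClosed.inter ?_ isClosed_Icc
    simp only [Set.ofPred_forall]
    exact isClosed_iInter fun C => isClosed_iInter fun _ => isClosed_eq (hc.cont C) continuous_const
  refine (hcl.Icc_subset_of_forall_exists_gt (by simp) fun t ht y hy => ?_)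
    (right_mem_Icc.2 hab.le)
  obtain ⟨ht, hta, htb⟩ := ht
  have : ∃ t' > t, ∀ C ≠ B, c t' C = c t C := by
    rcases hta.eq_or_lt with rfl | hlt
    · exact ⟨a', ha', hB⟩
    · obtain ⟨B', hr, t'', ht'', hl⟩ := not_not.1 (h t ⟨hlt, htb⟩)
      rwa [hc.eq_of_const_left hP hlt ht'' ht fun C hC => (hl C hC).symm]
  obtain ⟨t', ht', hr⟩ := this
  have hm : t < min t' y := lt_min ht' hy
  exact ⟨min t' y, fun C hC => (hc.eq_of_mem_Icc (hr C hC).symm ⟨hm.le, min_le_left _ _⟩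
    ⟨le_rfl, ht'.le⟩).trans (ht C hC), hm, min_le_right _ _⟩

/-- Every cactus map has a reduced marking. -/
theorem IsCactusMap.exists_isMarking (hc : IsCactusMap P c) (hP : 2 ≤ P.card) :
    ∃ (N : ℕ) (letter : Fin N → A) (s : ℕ → ℝ), IsMarking N letter c s ∧
      (∀ i < N, s i < s (i + 1)) ∧ (∀ i, letter i ∈ P) ∧
      ∀ i j : Fin N, (j : ℕ) = (i + 1) % N → letter i ≠ letter j := by
  have hP0 : P.Nonempty := Finset.card_pos.1 (by omega)
  -- Without change points one lobe would occupy the whole circle, but there are at least two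
  -- labels.
  obtain ⟨d, hd⟩ : (changePoints c).Nonempty := by
    by_contra hempty
    rw [not_nonempty_iff_eq_empty] at hempty
    obtain ⟨B, hB⟩ := hc.exists_const hP0 zero_lt_one (by simp [hempty])
    obtain ⟨C, hC, hCB⟩ := Finset.exists_mem_ne (by omega : 1 < P.card) B
    have := hB C hCB
    rw [hc.one_apply hC, hc.zero] at this
    norm_num at this
  have hd1 := hc.add_one_mem_changePoints hd
  -- The marks are the change points in `[d, d + 1]` in increasing order. Both ends belong to them
  -- and represent the same point of the circle, so there are `N + 1` marks for `N` arcs.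
  have hfin := hc.finite_changePoints d (d + 1)
  set F := hfin.toFinset with hF
  have hdF : d ∈ F := by simp [hF, hd]
  have hd1F : d + 1 ∈ F := by simp [hF, hd1]
  have hFpos : 0 < F.card := Finset.card_pos.2 ⟨d, hdF⟩
  obtain ⟨N, hN⟩ : ∃ N, F.card = N + 1 := ⟨F.card - 1, by omega⟩
  let e := F.orderEmbOfFin hN
  have he : ∀ i, e i ∈ F := fun i => F.orderEmbOfFin_mem hN i
  have hrange : ∀ x ∈ F, ∃ i, e i = x := fun x hx => by
    have : x ∈ Set.range e := by rw [Finset.range_orderEmbOfFin]; exact hx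
    exact this
  let s : ℕ → ℝ := fun i => if h : i < N + 1 then e ⟨i, h⟩ else 0
  have hs : ∀ i (h : i < N + 1), s i = e ⟨i, h⟩ := fun i h => dif_pos h
  have hIcc : ∀ i, e i ∈ Icc d (d + 1) := fun i => by
    have := he i
    simp only [hF, Set.Finite.mem_toFinset] at this
    exact this.2
  have hD : ∀ i, e i ∈ changePoints c := fun i => by
    have := he i
    simp only [hF, Set.Finite.mem_toFinset] at this
    exact this.1
  have hs0 : s 0 = d := by
    rw [hs 0 (by omega)]
    obtain ⟨i, hi⟩ := hrange d hdF
    refine le_antisymm ?_ (hIcc _).1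
    exact (e.monotone (Fin.zero_le i)).trans hi.le
  have hsN : s N = d + 1 := by
    rw [hs N (by omega)]
    obtain ⟨i, hi⟩ := hrange _ hd1F
    refine le_antisymm (hIcc _).2 ?_
    exact hi.ge.trans (e.monotone (Fin.le_last i))
  have hlt : ∀ i < N, s i < s (i + 1) := fun i hi => by
    rw [hs i (by omega), hs (i + 1) (by omega)]
    exact e.strictMono (by simp [Fin.lt_def])
  have hgap : ∀ i < N, ∀ t ∈ Ioo (s i) (s (i + 1)), t ∉ changePoints c := by
    rintro i hi t ⟨h1, h2⟩ ht
    rw [hs i (by omega)] at h1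
    rw [hs (i + 1) (by omega)] at h2
    obtain ⟨j, rfl⟩ := hrange t (by
      simp only [hF, Set.Finite.mem_toFinset]
      exact ⟨ht, (hIcc _).1.trans h1.le, h2.le.trans (hIcc _).2⟩)
    rw [e.lt_iff_lt, Fin.lt_def] at h1 h2
    simp only at h1 h2
    omega
  choose letter hletter using fun i : Fin N =>
    hc.exists_const hP0 (hlt i i.2) (hgap i i.2)
  refine ⟨N, letter, s, ⟨fun i hi => (hlt i hi).le, by rw [hs0, hsN], hletter⟩, hlt, fun i =>
    hc.mem_of_const hP0 (hlt i i.2).ne (hletter i), fun i j hij heq => ?_⟩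
  have hD' : s (i + 1) ∈ changePoints c := by
    rw [hs (i + 1) (by omega)]
    exact hD _
  -- If adjacent letters were equal, the mark between them would not be a change point.
  refine hD' ⟨letter i, ?_, s i, hlt i i.2, fun C hC => (hletter i C hC).symm⟩
  rcases Nat.lt_or_ge (i + 1 : ℕ) N with h | h
  · rw [Nat.mod_eq_of_lt h] at hij
    refine ⟨s (j + 1), by rw [← hij]; exact hlt j j.2, fun C hC => ?_⟩
    rw [← hij]
    exact hletter j C (heq ▸ hC)
  -- The last arc is followed by the first one, moved by a full period.
  · have hi : (i : ℕ) + 1 = N := by omega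
    rw [hi, Nat.mod_self] at hij
    rw [hi]
    have hj := hletter j
    rw [hij, hs0] at hj
    have hlt0 := hlt j j.2
    rw [hij, hs0] at hlt0
    refine ⟨s (0 + 1) + 1, by rw [hsN]; linarith, fun C hC => ?_⟩
    have h1 : ∀ t C, c (t + 1) C = c t C + c 1 C := fun t C => by
      simpa using hc.add_intCast t 1 C
    rw [hsN, h1, h1, hj C (heq ▸ hC)]

/-- Transport of markings to cactus maps of the same type. -/
theorem IsMarking.of_sim {c' : ℝ → A → ℝ} {N : ℕ} {letter : Fin N → A} {s : ℕ → ℝ}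
    (h : IsMarking N letter c s) (hP : P.Nonempty) (hc : IsCactusMap P c)
    (hc' : IsCactusMap P c') (hs : Sim c c') :
    ∃ s', IsMarking N letter c' s' := by
  obtain ⟨η, h1, h2, h3⟩ := hs.exists_map hP hc hc'
  exact ⟨fun i => η (s i), fun i hi => h1.monotone (h.le i hi), by simp only [h.last, h2],
    fun i C hC => (h3 _ _ _).1 (h.const i C hC)⟩

/-! ### Cactus maps with given markings -/

/-- The progress in the first arc, for a circle of length `N` subdivided into `N` equal arcs. -/
def arcProgress (N : ℕ) (v : ℝ) : ℝ := ⌊v / N⌋ + min 1 (N * Int.fract (v / N))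

section ArcProgress

variable {N : ℕ}

theorem arcProgress_mono : Monotone (arcProgress N) := by
  intro u v huv
  unfold arcProgress
  have h : u / N ≤ v / N := by gcongr
  rcases (Int.floor_le_floor h).eq_or_lt with heq | hlt
  · rw [heq]
    gcongr
    rw [Int.fract, Int.fract, heq]
    linarith
  · have h1 : ((⌊u / N⌋ : ℝ)) + 1 ≤ ⌊v / N⌋ := by exact_mod_cast hlt
    have h2 : min 1 (N * Int.fract (u / N)) ≤ (1 : ℝ) := min_le_left _ _
    have h3 : (0 : ℝ) ≤ min 1 (N * Int.fract (v / N)) :=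
      le_min zero_le_one (by have := Int.fract_nonneg (v / N); positivity)
    linarith

theorem arcProgress_continuous (hN : 0 < N) : Continuous (arcProgress N) := by
  have : arcProgress N = fun v => v / N + (fun x : ℝ => min 1 (N * x) - x) (Int.fract (v / N)) := by
    funext v
    simp only [arcProgress]
    have := Int.floor_add_fract (v / N)
    linarith
  rw [this]
  have hc : Continuous ((fun x : ℝ => min 1 (N * x) - x) ∘ Int.fract) := by
    refine ContinuousOn.comp_fract'' (by fun_prop) ?_
    have : (1 : ℝ) ≤ N := by exact_mod_cast hN
    simp [this]
  exact (continuous_id.div_const _).add (hc.comp (continuous_id.div_const _))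

theorem arcProgress_add (hN : 0 < N) (v : ℝ) (q : ℤ) :
    arcProgress N (v + N * q) = arcProgress N v + q := by
  have h : (v + N * q) / N = v / N + q := by
    field_simp
  simp only [arcProgress, h, Int.floor_add_intCast, Int.fract_add_intCast]
  push_cast; ring

/-- The end `x = N` needs periodicity, because there the fractional part has jumped back to zero and
the floor has gone up. -/
theorem arcProgress_eq_one {x : ℝ} (h1 : 1 ≤ x) (hN : x ≤ N) : arcProgress N x = 1 := by
  have hN0 : (0 : ℝ) < N := by linarith
  have hN1 : 0 < N := by exact_mod_cast hN0
  rcases hN.eq_or_lt with rfl | hlt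
  · have := arcProgress_add hN1 0 1
    simpa [arcProgress] using this
  · have h2 : x / N < 1 := by rwa [div_lt_one hN0]
    have h3 : ⌊x / N⌋ = 0 := Int.floor_eq_zero_iff.2 ⟨by positivity, h2⟩
    rw [arcProgress, Int.fract, h3]
    simp [mul_div_cancel₀ x hN0.ne', h1]

theorem arcProgress_eq_zero {x : ℝ} (hN0 : 0 < N) (h1 : 1 - N ≤ x) (hx : x ≤ 0) :
    arcProgress N x = 0 := by
  have := arcProgress_add hN0 x 1
  rw [arcProgress_eq_one (by push_cast; linarith) (by push_cast; linarith)] at this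
  push_cast at this
  linarith

/-- While the `n`-th arc is traversed, the shifted argument stays in a translate of `[1, N]`, where
the arc with index `i` is complete and the next round has not begun. -/
theorem arcProgress_eq (hN : 0 < N) {n i : ℤ} (h : n % N ≠ i % N) {u v : ℝ}
    (hu : u ∈ Icc (n : ℝ) (n + 1)) (hv : v ∈ Icc (n : ℝ) (n + 1)) :
    arcProgress N (u - i) = arcProgress N (v - i) := by
  have hr : (n - i) % N ≠ 0 := fun h0 =>
    h (Int.emod_eq_emod_iff_emod_sub_eq_zero.2 h0)
  have hr1 : 1 ≤ (n - i) % N := by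
    have := Int.emod_nonneg (n - i) (by exact_mod_cast hN.ne' : (N : ℤ) ≠ 0)
    omega
  have hr2 : (n - i) % N + 1 ≤ N := Int.emod_lt_of_pos _ (by exact_mod_cast hN)
  have hq := Int.mul_ediv_add_emod (n - i) N
  have key : ∀ u ∈ Icc (n : ℝ) (n + 1), arcProgress N (u - i) = 1 + ((n - i) / N : ℤ) := by
    intro u hu
    have hq' : (N : ℝ) * ((n - i) / N : ℤ) + ((n - i) % N : ℤ) = n - i := by exact_mod_cast hq
    have h1 : (1 : ℝ) ≤ ((n - i) % N : ℤ) := by exact_mod_cast hr1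
    have h2 : (((n - i) % N : ℤ) : ℝ) + 1 ≤ N := by exact_mod_cast hr2
    rw [← sub_add_cancel (u - i) (N * ((n - i) / N : ℤ) : ℝ), arcProgress_add hN,
      arcProgress_eq_one] <;> linarith [hu.1, hu.2]
  rw [key u hu, key v hv]

theorem exists_of_arcProgress_lt (hN : 0 < N) {i : ℤ} {a b : ℝ}
    (h : arcProgress N (a - i) < arcProgress N (b - i)) :
    ∃ n : ℤ, n % N = i % N ∧ a < n + 1 ∧ (n : ℝ) < b := by
  have hN' : (0 : ℝ) < N := by exact_mod_cast hN
  -- The interval `[i + N q, i + N q + 1]` is the first occurrence of the arc `i` that is not yet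
  -- completed at `a`. If `b` does not pass its beginning, the progress equals `q` at both `a` and
  -- `b`.
  set q := ⌊(a - i - 1) / N⌋ + 1 with hq
  have h1 : a - i - 1 < N * q := by
    have := Int.lt_floor_add_one ((a - i - 1) / N)
    rw [div_lt_iff₀ hN'] at this
    rw [hq]; push_cast; linarith
  have h2 : N * ((q : ℝ) - 1) ≤ a - i - 1 := by
    have := Int.floor_le ((a - i - 1) / N)
    rw [le_div_iff₀ hN'] at this
    rw [hq]; push_cast; linarith
  refine ⟨i + N * q, by simp, by push_cast; linarith, ?_⟩
  by_contra hb
  have hab : a < b := by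
    by_contra hab
    exact absurd (arcProgress_mono (sub_le_sub_right (not_lt.1 hab) (i : ℝ))) (not_le.2 h)
  push_cast at hb
  have key : ∀ u, a ≤ u → u ≤ b → arcProgress N (u - i) = q := by
    intro u hu1 hu2
    have h3 := arcProgress_add hN (u - i - N * ((q - 1 : ℤ) : ℝ)) (q - 1)
    rw [sub_add_cancel, arcProgress_eq_one (x := u - i - N * ((q - 1 : ℤ) : ℝ))
      (by push_cast; linarith) (by push_cast; linarith)] at h3
    rw [h3]; push_cast; ring
  rw [key a le_rfl hab.le, key b hab.le le_rfl] at h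
  exact lt_irrefl _ h

end ArcProgress

/-- The family of maps for arcs of lengths `l` with labels `letter`, in a parameter for which all
arcs get the same length. -/
def arcFamily [DecidableEq A] {N : ℕ} (letter : Fin N → A) (l : Fin N → ℝ) : ℝ → A → ℝ :=
  fun u B => ∑ i with letter i = B, l i * arcProgress N (N * u - (i : ℕ))

section ArcFamily

variable [DecidableEq A] {N : ℕ} {letter : Fin N → A} {l : Fin N → ℝ}

theorem arcFamily_mono (hl : ∀ i, 0 ≤ l i) (B : A) : Monotone fun u => arcFamily letter l u B :=
  fun u v huv => by
    refine Finset.sum_le_sum fun i _ => mul_le_mul_of_nonneg_left (arcProgress_mono ?_) (hl i)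
    gcongr

theorem arcFamily_continuous (hN : 0 < N) (B : A) : Continuous fun u => arcFamily letter l u B := by
  have := arcProgress_continuous hN
  unfold arcFamily
  fun_prop

theorem arcFamily_add_int (hN : 0 < N) (u : ℝ) (q : ℤ) (B : A) :
    arcFamily letter l (u + q) B = arcFamily letter l u B + q * ∑ i with letter i = B, l i := by
  unfold arcFamily
  rw [Finset.mul_sum, ← Finset.sum_add_distrib]
  refine Finset.sum_congr rfl fun i _ => ?_
  rw [show (N : ℝ) * (u + q) - (i : ℕ) = N * u - (i : ℕ) + N * q by ring, arcProgress_add hN]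
  ring

theorem arcFamily_natCast (hN : 0 < N) {k : ℕ} (hk : k ≤ N) (B : A) :
    arcFamily letter l (k / N) B = ∑ i : Fin N, if (i : ℕ) < k ∧ letter i = B then l i else 0 := by
  have hN' : (N : ℝ) ≠ 0 := by exact_mod_cast hN.ne'
  rw [arcFamily, Finset.sum_filter]
  refine Finset.sum_congr rfl fun i _ => ?_
  rw [mul_div_cancel₀ _ hN']
  have hk' : (k : ℝ) ≤ N := by exact_mod_cast hk
  have hi : (i : ℝ) + 1 ≤ N := by exact_mod_cast i.2
  by_cases hB : letter i = B
  · rcases Nat.lt_or_ge i k with h | h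
    · have : (i : ℝ) + 1 ≤ k := by exact_mod_cast h
      have h0 : (0 : ℝ) ≤ (i : ℕ) := by positivity
      rw [arcProgress_eq_one (by linarith) (by linarith)]
      simp [hB, h]
    · have : (k : ℝ) ≤ (i : ℕ) := by exact_mod_cast h
      have h0 : (0 : ℝ) ≤ k := by positivity
      rw [arcProgress_eq_zero hN (by linarith) (by linarith)]
      simp [hB, h.not_gt]
  · simp [hB]

theorem arcFamily_eq_of_mem (hN : 0 < N) {n : ℤ} {u v : ℝ} (hu : N * u ∈ Icc (n : ℝ) (n + 1))
    (hv : N * v ∈ Icc (n : ℝ) (n + 1)) {B : A}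
    (hB : ∀ i : Fin N, (i : ℤ) = n % N → letter i ≠ B) :
    arcFamily letter l u B = arcFamily letter l v B := by
  refine Finset.sum_congr rfl fun i hi => ?_
  have h := arcProgress_eq hN (n := n) (i := i) (fun h => hB i (by
    rw [h, Int.emod_eq_of_lt (by positivity) (by exact_mod_cast i.2)]) (Finset.mem_filter.1 hi).2)
    hu hv
  rw [Int.cast_natCast] at h
  rw [h]

/-- The remainder of an integer, as an index. -/
def modIndex (hN : 0 < N) (n : ℤ) : Fin N :=
  ⟨(n % N).toNat, by
    have h1 := Int.emod_nonneg n (by exact_mod_cast hN.ne' : (N : ℤ) ≠ 0)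
    have h2 := Int.emod_lt_of_pos n (by exact_mod_cast hN : (0 : ℤ) < N)
    omega⟩

theorem coe_modIndex (hN : 0 < N) (n : ℤ) : ((modIndex hN n : ℕ) : ℤ) = n % N := by
  have h1 := Int.emod_nonneg n (by exact_mod_cast hN.ne' : (N : ℤ) ≠ 0)
  simp [modIndex, h1]

theorem exists_of_arcFamily_lt (hN : 0 < N) (hl : ∀ i, 0 ≤ l i) {B : A} {u v : ℝ}
    (h : arcFamily letter l u B < arcFamily letter l v B) :
    ∃ n : ℤ, letter (modIndex hN n) = B ∧ N * u < n + 1 ∧ (n : ℝ) < N * v := by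
  obtain ⟨i, hi, hlt⟩ := Finset.exists_lt_of_sum_lt h
  have h' := lt_of_mul_lt_mul_left hlt (hl i)
  obtain ⟨n, hn, h1, h2⟩ := exists_of_arcProgress_lt hN (i := (i : ℕ)) (by push_cast; exact h')
  refine ⟨n, ?_, h1, h2⟩
  rw [← (Finset.mem_filter.1 hi).2]
  congr 1
  ext
  have := coe_modIndex hN n
  rw [hn, Int.emod_eq_of_lt (by positivity) (by exact_mod_cast i.2)] at this
  exact_mod_cast this

/-- Words satisfy the condition for linearly ordered indices. Four integers within one period reduce
to indices in linear order up to a cyclic rotation, and the cases are the positions at which the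
period boundary is crossed; the alternating pattern is invariant under such rotations. -/
theorem noncrossing_of_cyclic (hN : 0 < N)
    (hnc : ∀ i j k l : Fin N, i < j → j < k → k < l →
      letter i = letter k → letter j = letter l → letter i = letter j)
    {n₁ n₂ n₃ n₄ : ℤ} (h1 : n₁ < n₂) (h2 : n₂ < n₃) (h3 : n₃ < n₄) (h4 : n₄ < n₁ + N)
    (e1 : letter (modIndex hN n₁) = letter (modIndex hN n₃))
    (e2 : letter (modIndex hN n₂) = letter (modIndex hN n₄)) :
    letter (modIndex hN n₁) = letter (modIndex hN n₂) := by
  have hN' : (0 : ℤ) < N := by exact_mod_cast hN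
  have hr := Int.emod_nonneg n₁ hN'.ne'
  have hr' := Int.emod_lt_of_pos n₁ hN'
  have hq := Int.mul_ediv_add_emod n₁ N
  set q := n₁ / N with hqdef
  have small : ∀ n : ℤ, N * q ≤ n → n < N * q + N → ((modIndex hN n : ℕ) : ℤ) = n - N * q := by
    intro n ha hb
    rw [coe_modIndex, ← Int.emod_eq_of_lt (a := n - N * q) (b := N) (by linarith) (by linarith)]
    simp
  have large : ∀ n : ℤ, N * q + N ≤ n → n < N * q + N + N →
      ((modIndex hN n : ℕ) : ℤ) = n - N * q - N := by
    intro n ha hb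
    rw [coe_modIndex, ← Int.emod_eq_of_lt (a := n - N * q - N) (b := N) (by linarith) (by linarith)]
    simp
  have m1 := small n₁ (by omega) (by omega)
  rcases lt_or_ge n₂ (N * q + N) with g2 | g2
  · have m2 := small n₂ (by omega) (by omega)
    rcases lt_or_ge n₃ (N * q + N) with g3 | g3
    · have m3 := small n₃ (by omega) (by omega)
      rcases lt_or_ge n₄ (N * q + N) with g4 | g4
      · have m4 := small n₄ (by omega) (by omega)
        exact hnc _ _ _ _ (Fin.lt_def.2 (by omega)) (Fin.lt_def.2 (by omega))
          (Fin.lt_def.2 (by omega)) e1 e2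
      · have m4 := large n₄ (by omega) (by omega)
        have := hnc _ _ _ _ (Fin.lt_def.2 (by omega)) (Fin.lt_def.2 (by omega))
          (Fin.lt_def.2 (by omega) : modIndex hN n₂ < modIndex hN n₃) e2.symm e1
        rw [e2, this]
    · have m3 := large n₃ (by omega) (by omega)
      have m4 := large n₄ (by omega) (by omega)
      have := hnc (modIndex hN n₃) (modIndex hN n₄) (modIndex hN n₁) (modIndex hN n₂)
        (Fin.lt_def.2 (by omega)) (Fin.lt_def.2 (by omega)) (Fin.lt_def.2 (by omega)) e1.symm e2.symm
      rw [e1, this, ← e2]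
  · have m2 := large n₂ (by omega) (by omega)
    have m3 := large n₃ (by omega) (by omega)
    have m4 := large n₄ (by omega) (by omega)
    have := hnc (modIndex hN n₂) (modIndex hN n₃) (modIndex hN n₄) (modIndex hN n₁)
      (Fin.lt_def.2 (by omega)) (Fin.lt_def.2 (by omega)) (Fin.lt_def.2 (by omega)) e2 e1.symm
    rw [this, e1]

theorem isLoopFamily_arcFamily (hN : 0 < N) (hl : ∀ i, 0 ≤ l i) (hP : ∀ i, letter i ∈ P)
    (h1 : ∀ B ∈ P, ∑ i with letter i = B, l i = 1)
    (hnc : ∀ i j k l : Fin N, i < j → j < k → k < l →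
      letter i = letter k → letter j = letter l → letter i = letter j) :
    IsLoopFamily P (arcFamily letter l) := by
  have hN' : (0 : ℝ) < N := by exact_mod_cast hN
  refine ⟨fun B hB s t => ?_, arcFamily_mono hl, arcFamily_continuous hN, fun B hB t => ?_,
    fun t => ?_, fun t => ?_, fun B C hBC t₁ t₂ t₃ t₄ a1 a2 a3 a4 => ?_⟩
  · refine Finset.sum_congr rfl fun i hi => absurd ?_ hB
    rw [← (Finset.mem_filter.1 hi).2]
    exact hP i
  · have := arcFamily_add_int (letter := letter) (l := l) hN t 1 B
    rw [h1 B hB] at this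
    simpa using this
  -- The arc to the right of `t` has the index `⌊N * t⌋` modulo `N`; on the left the ceiling is
  -- used, so that the end of an arc belongs to that arc.
  · have f1 := Int.floor_le (N * t)
    have f2 := Int.lt_floor_add_one (N * t)
    refine ⟨letter (modIndex hN ⌊N * t⌋), (⌊N * t⌋ + 1) / N, ?_, fun C hC => ?_⟩
    · rw [gt_iff_lt, lt_div_iff₀ hN']; linarith
    · refine arcFamily_eq_of_mem hN (n := ⌊N * t⌋) ?_ ⟨f1, f2.le⟩ fun i hi hiC => hC ?_
      · rw [mul_div_cancel₀ _ hN'.ne']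
        simp
      · rw [← hiC]
        congr 1
        ext
        have := coe_modIndex hN ⌊N * t⌋
        rw [← hi] at this
        exact_mod_cast this.symm
  · have f1 := Int.le_ceil (N * t)
    have f2 := Int.ceil_lt_add_one (N * t)
    refine ⟨letter (modIndex hN (⌈N * t⌉ - 1)), (⌈N * t⌉ - 1) / N, ?_, fun C hC => ?_⟩
    · rw [div_lt_iff₀ hN']; linarith
    · refine arcFamily_eq_of_mem hN (n := ⌈N * t⌉ - 1) ?_ ⟨by push_cast; linarith,
        by push_cast; linarith⟩ fun i hi hiC => hC ?_
      · rw [mul_div_cancel₀ _ hN'.ne']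
        simp
      · rw [← hiC]
        congr 1
        ext
        have := coe_modIndex hN (⌈N * t⌉ - 1)
        rw [← hi] at this
        exact_mod_cast this.symm
  · obtain ⟨n₁, e1, p1, q1⟩ := exists_of_arcFamily_lt hN hl a1
    obtain ⟨n₂, e2, p2, q2⟩ := exists_of_arcFamily_lt hN hl a2
    obtain ⟨n₃, e3, p3, q3⟩ := exists_of_arcFamily_lt hN hl a3
    obtain ⟨n₄, e4, p4, q4⟩ := exists_of_arcFamily_lt hN hl a4
    -- The overlaps give only weak inequalities between the indices; equality is excluded because
    -- the letters alternate.
    have o1 : n₁ < n₂ + 1 := by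
      have : (n₁ : ℝ) < n₂ + 1 := q1.trans p2
      exact_mod_cast this
    have o2 : n₂ < n₃ + 1 := by
      have : (n₂ : ℝ) < n₃ + 1 := q2.trans p3
      exact_mod_cast this
    have o3 : n₃ < n₄ + 1 := by
      have : (n₃ : ℝ) < n₄ + 1 := q3.trans p4
      exact_mod_cast this
    have o4 : n₄ < n₁ + N + 1 := by
      have : (n₄ : ℝ) < n₁ + N + 1 := by linarith
      exact_mod_cast this
    have d12 : n₁ ≠ n₂ := by rintro rfl; exact hBC (e1.symm.trans e2)
    have d23 : n₂ ≠ n₃ := by rintro rfl; exact hBC (e3.symm.trans e2)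
    have d34 : n₃ ≠ n₄ := by rintro rfl; exact hBC (e3.symm.trans e4)
    have d41 : n₄ ≠ n₁ + N := by
      rintro rfl
      refine hBC (e1.symm.trans (Eq.trans ?_ e4))
      congr 1
      ext
      have := coe_modIndex hN (n₁ + N)
      rw [Int.add_emod_right, ← coe_modIndex hN] at this
      exact_mod_cast this.symm
    refine hBC ?_
    rw [← e1, ← e2]
    exact noncrossing_of_cyclic hN hnc (by omega) (by omega) (by omega) (by omega)
      (e1.trans e3.symm) (e2.trans e4.symm)

/-- Every choice of arc lengths for a cyclic word is realized by a cactus map. -/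
theorem exists_isCactusMap_isMarking (hP : P.Nonempty) (hl : ∀ i, 0 ≤ l i) (hm : ∀ i, letter i ∈ P)
    (h1 : ∀ B ∈ P, ∑ i with letter i = B, l i = 1)
    (hnc : ∀ i j k l : Fin N, i < j → j < k → k < l →
      letter i = letter k → letter j = letter l → letter i = letter j) :
    ∃ c s, IsCactusMap P c ∧ IsMarking N letter c s ∧ ∀ i : Fin N, l i = P.card * (s (i + 1) - s i) := by
  have hp : (P.card : ℝ) ≠ 0 := by simpa using hP.ne_empty
  have hN : 0 < N := by
    rcases Nat.eq_zero_or_pos N with rfl | h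
    · obtain ⟨B, hB⟩ := hP
      simpa using h1 B hB
    · exact h
  have hN' : (N : ℝ) ≠ 0 := by exact_mod_cast hN.ne'
  have hb := isLoopFamily_arcFamily hN hl hm h1 hnc
  set b := arcFamily letter l with hbdef
  have hb0 : ∀ B, b 0 B = 0 := fun B => by
    have := arcFamily_natCast (letter := letter) (l := l) hN (Nat.zero_le N) B
    simpa using this
  obtain ⟨c, hc, hcb⟩ := hb.exists_isCactusMap hP
  simp only [hb0, sub_zero] at hcb
  have hconst : ∀ i : Fin N, ∀ C ≠ letter i, b ((i + 1 : ℕ) / N) C = b ((i : ℕ) / N) C := by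
    intro i C hC
    rw [hbdef, arcFamily_natCast hN (by omega), arcFamily_natCast hN (by omega)]
    refine Finset.sum_congr rfl fun j _ => ?_
    rcases eq_or_ne j i with rfl | hj
    · simp [hC.symm]
    · have : (j : ℕ) ≠ i := fun h => hj (Fin.ext h)
      simp [show ((j : ℕ) < i + 1) ↔ (j : ℕ) < i by omega]
  refine ⟨c, fun k => loopParam P b ((k : ℕ) / N), hc, ⟨fun i hi => hb.loopParam_mono (by gcongr; omega),
    ?_, fun i C hC => ?_⟩, fun i => ?_⟩
  · have := hb.loopParam_add_one hP 0
    rw [zero_add] at this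
    simp only [div_self hN', Nat.cast_zero, zero_div, this]
  · rw [hcb, hcb, hconst i C hC]
  · rw [← hc.sub_eq_of_const (B := letter i) (hm i) (fun C hC => by rw [hcb, hcb, hconst i C hC]),
      hcb, hcb, hbdef, arcFamily_natCast hN (by omega), arcFamily_natCast hN (by omega),
      eq_comm, ← Finset.sum_sub_distrib, Finset.sum_eq_single i]
    · simp
    · intro j _ hj
      have : (j : ℕ) ≠ i := fun h => hj (Fin.ext h)
      simp [show ((j : ℕ) < i + 1) ↔ (j : ℕ) < i by omega]
    · simp

/-- In the parameter for which all arcs have the same length, a marked cactus map is the arc family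
of its own arc lengths, up to translation. Both sides agree at the marks; between marks all
coordinates except the current letter are constant, and the remaining one is determined by the sum.
-/
theorem IsMarking.apply_eq {s : ℕ → ℝ} (h : IsMarking N letter c s) (hc : IsCactusMap P c)
    (hP : P.Nonempty) (hm : ∀ i, letter i ∈ P) :
    ∃ φ : ℝ → ℝ, (Monotone φ ∧ Function.Surjective φ ∧ ∀ t, φ (t + 1) = φ t + 1) ∧
      ∀ u B, c (φ u) B = arcFamily letter (fun i => P.card * (s (i + 1) - s i)) u B + c (s 0) B := by
  have hp : (P.card : ℝ) ≠ 0 := by simpa using hP.ne_empty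
  have hN : 0 < N := by
    rcases Nat.eq_zero_or_pos N with rfl | h'
    · have := h.last
      linarith
    · exact h'
  have hN' : (0 : ℝ) < N := by exact_mod_cast hN
  set l : Fin N → ℝ := fun i => P.card * (s (i + 1) - s i) with hldef
  have hl : ∀ i, 0 ≤ l i := fun i => mul_nonneg (Nat.cast_nonneg _) (sub_nonneg.2 (h.le i i.2))
  set b := arcFamily letter l with hb
  have h1 : ∀ B ∈ P, ∑ i with letter i = B, l i = 1 := by
    intro B hB
    have := h.apply_sub hc hm B le_rfl
    rw [h.last, hc.add_one B hB, add_sub_cancel_left] at this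
    rw [Finset.sum_filter, this]
    exact Finset.sum_congr rfl fun i _ => by simp [hldef, i.2]
  have hbk : ∀ k ≤ N, ∀ B, b (k / N) B = c (s k) B - c (s 0) B := by
    intro k hk B
    rw [hb, arcFamily_natCast hN hk, h.apply_sub hc hm B hk]
  let φ : ℝ → ℝ := fun u => s 0 + (∑ B ∈ P, b u B) / P.card
  have hφc : Continuous φ := by
    have := fun B => arcFamily_continuous (letter := letter) (l := l) hN B
    fun_prop
  have hφint : ∀ t (q : ℤ), φ (t + q) = φ t + q := fun t q => by
    simp only [φ, hb]
    rw [Finset.sum_congr rfl fun B hB => by rw [arcFamily_add_int hN, h1 B hB, mul_one],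
      Finset.sum_add_distrib]
    simp
    field_simp
    ring
  have hφ1 : ∀ t, φ (t + 1) = φ t + 1 := fun t => by simpa using hφint t 1
  have hφm : Monotone φ := fun u v huv => by
    simp only [φ]
    gcongr with B
    exact arcFamily_mono hl B huv
  have hφk : ∀ k ≤ N, φ (k / N) = s k := by
    intro k hk
    simp only [φ]
    rw [Finset.sum_congr rfl fun B _ => hbk k hk B, Finset.sum_sub_distrib, hc.sum, hc.sum]
    field_simp
    ring
  refine ⟨φ, ⟨hφm, surjective_of_add_one hφc hφ1, hφ1⟩, ?_⟩
  -- One period is enough; integer translations are treated at the end.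
  have hmain : ∀ u, 0 ≤ u → u < 1 → ∀ B, c (φ u) B = b u B + c (s 0) B := by
    intro u hu0 hu1
    set j := ⌊N * u⌋₊ with hj
    have j1 : (j : ℝ) ≤ N * u := Nat.floor_le (by positivity)
    have j2 : N * u < j + 1 := Nat.lt_floor_add_one _
    have hjN : j < N := by
      have : (j : ℝ) < N := j1.trans_lt (by nlinarith)
      exact_mod_cast this
    have hmem : φ u ∈ Icc (s j) (s (j + 1)) := by
      rw [← hφk j hjN.le, ← hφk (j + 1) hjN]
      constructor <;> apply hφm
      · rw [div_le_iff₀ hN']; linarith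
      · rw [le_div_iff₀ hN']; push_cast; linarith
    have hne : ∀ B ≠ letter ⟨j, hjN⟩, c (φ u) B = b u B + c (s 0) B := by
      intro B hB
      have e1 := hc.eq_of_mem_Icc (h.const ⟨j, hjN⟩ B hB).symm hmem ⟨le_rfl, h.le j hjN⟩
      have e2 : b u B = b (j / N) B := by
        refine arcFamily_eq_of_mem hN (n := j) ⟨by exact_mod_cast j1, by exact_mod_cast j2.le⟩
          (by rw [mul_div_cancel₀ _ hN'.ne']; simp) fun i hi hiB => hB ?_
        rw [← hiB]
        congr 1
        ext
        rw [Int.emod_eq_of_lt (by positivity) (by exact_mod_cast hjN)] at hi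
        exact_mod_cast hi
      rw [e1, e2, hbk j hjN.le]
      ring
    intro B
    by_cases hB : B = letter ⟨j, hjN⟩
    · have hBP : B ∈ P := hB ▸ hm _
      have e1 := hc.sum (φ u)
      have e2 : (∑ B ∈ P, (b u B + c (s 0) B)) = P.card * φ u := by
        rw [Finset.sum_add_distrib, hc.sum]
        simp only [φ]
        field_simp
        ring
      rw [← e2, ← Finset.add_sum_erase _ _ hBP, ← Finset.add_sum_erase _ (fun B => b u B + _) hBP,
        Finset.sum_congr rfl fun C hC => hne C (hB ▸ (Finset.ne_of_mem_erase hC))] at e1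
      exact add_right_cancel e1
    · exact hne B hB
  intro u B
  have hu := Int.floor_add_fract u
  rw [← hu, add_comm, hφint, hc.add_intCast, hmain _ (Int.fract_nonneg u) (Int.fract_lt_one u), hb,
    arcFamily_add_int hN, ← hb]
  by_cases hB : B ∈ P
  · rw [hc.one_apply hB, h1 B hB]; ring
  · rw [hc.eq_zero hB 1, Finset.sum_eq_zero fun (i : Fin N) hi => absurd
      (by rw [← (Finset.mem_filter.1 hi).2]; exact hm i) hB]
    ring

/-- Cactus maps with markings by the same word, with positive lengths, have the same type. -/
theorem sim_of_isMarking {c' : ℝ → A → ℝ} {s s' : ℕ → ℝ} (h : IsMarking N letter c s)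
    (h' : IsMarking N letter c' s') (hc : IsCactusMap P c) (hc' : IsCactusMap P c')
    (hP : P.Nonempty) (hm : ∀ i, letter i ∈ P) (hs : ∀ i < N, s i < s (i + 1))
    (hs' : ∀ i < N, s' i < s' (i + 1)) : Sim c c' := by
  have hp : (0 : ℝ) < P.card := by exact_mod_cast hP.card_pos
  obtain ⟨φ, hφ, e⟩ := h.apply_eq hc hP hm
  obtain ⟨φ', hφ', e'⟩ := h'.apply_eq hc' hP hm
  -- For positive lengths, the places where a coordinate is stationary do not depend on the lengths.
  have key : ∀ l : Fin N → ℝ, (∀ i, 0 < l i) → ∀ B u v,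
      (arcFamily letter l u B = arcFamily letter l v B ↔ ∀ i, letter i = B →
        arcProgress N (N * u - (i : ℕ)) = arcProgress N (N * v - (i : ℕ))) := by
    intro l hl B u v
    wlog huv : u ≤ v generalizing u v
    · rw [eq_comm, this v u (le_of_not_ge huv)]
      simp only [eq_comm]
    unfold arcFamily
    rw [Finset.sum_eq_sum_iff_of_le fun i _ => mul_le_mul_of_nonneg_left
      (arcProgress_mono (by gcongr)) (hl i).le]
    simp [(hl _).ne']
  refine ⟨φ, φ', hφ, hφ', fun B u v => ?_⟩
  rw [e, e, e', e', add_left_inj, add_left_inj, key _ fun i => ?_, key _ fun i => ?_]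
  · exact mul_pos hp (sub_pos.2 (hs' i i.2))
  · exact mul_pos hp (sub_pos.2 (hs i i.2))

end ArcFamily

end Marks

end NestedCacti

namespace NestedCacti

/-! ### The circle -/

theorem coe_add_int (t : ℝ) (k : ℤ) : ((t + k : ℝ) : Circ) = t := by
  rw [AddCircle.coe_add, (AddCircle.coe_eq_zero_iff (1 : ℝ) (x := k)).2 ⟨k, by simp⟩, add_zero]

theorem exists_coe_eq (u : Circ) : ∃ t : ℝ, (t : Circ) = u := QuotientAddGroup.mk_surjective u

theorem coe_eq_coe_iff {s t : ℝ} : (s : Circ) = t ↔ ∃ k : ℤ, t = s + k := by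
  constructor
  · intro h
    have h1 : ((t - s : ℝ) : Circ) = 0 := by rw [AddCircle.coe_sub, h, sub_self]
    obtain ⟨k, hk⟩ := (AddCircle.coe_eq_zero_iff (1 : ℝ)).1 h1
    exact ⟨k, by simp at hk; linarith⟩
  · rintro ⟨k, rfl⟩
    exact (coe_add_int s k).symm

theorem exists_add_int_mem_Ico (a t : ℝ) : ∃ k : ℤ, a ≤ t + k ∧ t + k < a + 1 :=
  ⟨-⌊t - a⌋, by push_cast; linarith [Int.floor_le (t - a)],
    by push_cast; linarith [Int.lt_floor_add_one (t - a)]⟩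

theorem exists_add_int_mem_Ioc (a t : ℝ) : ∃ k : ℤ, a < t + k ∧ t + k ≤ a + 1 :=
  ⟨-⌈t - a - 1⌉, by push_cast; linarith [Int.ceil_lt_add_one (t - a - 1)],
    by push_cast; linarith [Int.le_ceil (t - a - 1)]⟩

theorem coe_mem_arc_iff {a b t : ℝ} :
    (t : Circ) ∈ (fun u : ℝ => (u : Circ)) '' Icc a b ↔ ∃ k : ℤ, a ≤ t + k ∧ t + k ≤ b := by
  constructor
  · rintro ⟨u, hu, h⟩
    obtain ⟨k, rfl⟩ := coe_eq_coe_iff.1 h.symm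
    exact ⟨k, hu⟩
  · rintro ⟨k, h⟩
    exact ⟨t + k, h, coe_add_int t k⟩

theorem isClosed_arc (a b : ℝ) : IsClosed ((fun u : ℝ => (u : Circ)) '' Icc a b) :=
  (isCompact_Icc.image (AddCircle.continuous_mk' (1 : ℝ))).isClosed

theorem coe_mem_arc_iff_ceil {a b t : ℝ} :
    (t : Circ) ∈ (fun u : ℝ => (u : Circ)) '' Icc a b ↔ ⌈a - t⌉ ≤ ⌊b - t⌋ := by
  rw [coe_mem_arc_iff]
  constructor
  · rintro ⟨k, h1, h2⟩
    exact (Int.ceil_le.2 (by linarith)).trans (Int.le_floor.2 (by linarith) : k ≤ _)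
  · intro h
    refine ⟨⌈a - t⌉, by linarith [Int.le_ceil (a - t)], ?_⟩
    have : ((⌈a - t⌉ : ℤ) : ℝ) ≤ ⌊b - t⌋ := by exact_mod_cast h
    linarith [Int.floor_le (b - t)]

/-- For `u` slightly larger than `t` the integers `⌈a - u⌉` and `⌊b - u⌋` do not depend on `u`: they
are `⌈a - t⌉` and `⌈b - t⌉ - 1`. Membership in the arc is a comparison of these two. -/
theorem arc_right (a b t : ℝ) : ∃ t' > t,
    (∀ u ∈ Ioo t t', (u : Circ) ∈ (fun u : ℝ => (u : Circ)) '' Icc a b) ∨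
    ∀ u ∈ Ioo t t', (u : Circ) ∉ (fun u : ℝ => (u : Circ)) '' Icc a b := by
  have h1 := Int.ceil_lt_add_one (a - t)
  have h2 := Int.ceil_lt_add_one (b - t)
  have h1' := Int.le_ceil (a - t)
  have h2' := Int.le_ceil (b - t)
  refine ⟨min (a - ⌈a - t⌉ + 1) (b - ⌈b - t⌉ + 1), lt_min (by linarith) (by linarith), ?_⟩
  have key : ∀ u ∈ Ioo t (min (a - ⌈a - t⌉ + 1) (b - ⌈b - t⌉ + 1)),
      ((u : Circ) ∈ (fun u : ℝ => (u : Circ)) '' Icc a b ↔ ⌈a - t⌉ ≤ ⌈b - t⌉ - 1) := by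
    rintro u ⟨hu1, hu2⟩
    have hu3 := hu2.trans_le (min_le_left _ _)
    have hu4 := hu2.trans_le (min_le_right _ _)
    rw [coe_mem_arc_iff_ceil, Int.ceil_eq_iff (z := ⌈a - t⌉).2 ⟨by linarith, by linarith⟩,
      Int.floor_eq_iff (z := ⌈b - t⌉ - 1).2 ⟨by push_cast; linarith, by push_cast; linarith⟩]
  by_cases h : ⌈a - t⌉ ≤ ⌈b - t⌉ - 1
  · exact Or.inl fun u hu => (key u hu).2 h
  · exact Or.inr fun u hu => mt (key u hu).1 h

/-! ### Local structure of finite unions of arcs -/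

namespace IsArcUnion

variable {I : Set Circ}

theorem isClosed (h : IsArcUnion I) : IsClosed I := by
  obtain ⟨F, -, rfl⟩ := h
  exact F.finite_toSet.isClosed_biUnion fun a _ => isClosed_arc _ _

theorem right (h : IsArcUnion I) (t : ℝ) : ∃ t' > t,
    (∀ u ∈ Ioo t t', (u : Circ) ∈ I) ∨ ∀ u ∈ Ioo t t', (u : Circ) ∉ I := by
  obtain ⟨F, -, rfl⟩ := h
  choose f hf1 hf2 using fun a : ℝ × ℝ => arc_right a.1 a.2 t
  by_cases hex : ∃ a ∈ F, ∀ u ∈ Ioo t (f a), (u : Circ) ∈ (fun u : ℝ => (u : Circ)) '' Icc a.1 a.2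
  · obtain ⟨a, ha, h⟩ := hex
    exact ⟨f a, hf1 a, Or.inl fun u hu => mem_biUnion ha (h u hu)⟩
  · push Not at hex
    obtain ⟨t', h1, h2⟩ : ∃ t' > t, ∀ a ∈ F, t' ≤ f a := by
      rcases F.eq_empty_or_nonempty with rfl | hne
      · exact ⟨t + 1, by simp, by simp⟩
      · exact ⟨F.inf' hne f, (Finset.lt_inf'_iff hne).2 fun a _ => hf1 a,
          fun a ha => Finset.inf'_le f ha⟩
    refine ⟨t', h1, Or.inr fun u hu hmem => ?_⟩
    obtain ⟨a, ha, hu'⟩ := mem_iUnion₂.1 hmem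
    rcases hf2 a with h | h
    · obtain ⟨v, hv, hv'⟩ := hex a ha
      exact hv' (h v hv)
    · exact h u ⟨hu.1, hu.2.trans_le (h2 a ha)⟩ hu'

/-- Reflection reduces statements about left neighbourhoods to statements about right ones. -/
theorem neg (h : IsArcUnion I) : IsArcUnion {u | -u ∈ I} := by
  classical
  obtain ⟨F, hF, rfl⟩ := h
  refine ⟨F.image fun a => (-a.2, -a.1), ?_, ?_⟩
  · intro a ha
    obtain ⟨b, hb, rfl⟩ := Finset.mem_image.1 ha
    simpa using hF b hb
  · ext u
    obtain ⟨t, rfl⟩ := exists_coe_eq u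
    rw [mem_ofPred_eq, ← AddCircle.coe_neg]
    simp only [mem_iUnion, coe_mem_arc_iff, Finset.mem_image]
    constructor
    · rintro ⟨a, ha, k, h1, h2⟩
      exact ⟨_, ⟨a, ha, rfl⟩, -k, by push_cast; linarith, by push_cast; linarith⟩
    · rintro ⟨_, ⟨a, ha, rfl⟩, k, h1, h2⟩
      exact ⟨a, ha, -k, by push_cast; linarith, by push_cast; linarith⟩

theorem left (h : IsArcUnion I) (t : ℝ) : ∃ t' < t,
    (∀ u ∈ Ioo t' t, (u : Circ) ∈ I) ∨ ∀ u ∈ Ioo t' t, (u : Circ) ∉ I := by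
  obtain ⟨t', ht', h⟩ := h.neg.right (-t)
  refine ⟨-t', by linarith, h.imp (fun h u hu => ?_) fun h u hu hu' => ?_⟩
  · simpa using h (-u) ⟨by linarith [hu.2], by linarith [hu.1]⟩
  · exact h (-u) ⟨by linarith [hu.2], by linarith [hu.1]⟩ (by simpa using hu')

/-- The arcs have positive length, so there are no isolated points. -/
theorem exists_side (h : IsArcUnion I) {t : ℝ} (ht : (t : Circ) ∈ I) :
    (∃ t' > t, ∀ u ∈ Ioo t t', (u : Circ) ∈ I) ∨ ∃ t' < t, ∀ u ∈ Ioo t' t, (u : Circ) ∈ I := by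
  obtain ⟨F, hF, rfl⟩ := h
  obtain ⟨a, ha, ht'⟩ := mem_iUnion₂.1 ht
  obtain ⟨k, h1, h2⟩ := coe_mem_arc_iff.1 ht'
  rcases lt_or_ge (t + k) a.2 with h3 | h3
  · refine Or.inl ⟨a.2 - k, by linarith, fun u hu => mem_biUnion ha (coe_mem_arc_iff.2 ⟨k, ?_, ?_⟩)⟩
    · linarith [hu.1]
    · linarith [hu.2]
  · have := hF a ha
    refine Or.inr ⟨a.1 - k, by linarith, fun u hu => mem_biUnion ha (coe_mem_arc_iff.2 ⟨k, ?_, ?_⟩)⟩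
    · linarith [hu.1]
    · linarith [hu.2]

end IsArcUnion

/-! ### Lengths of subsets of the line -/

/-- The length of the part of `E` between `0` and `t`, with sign. -/
def lengthTo (E : Set ℝ) (t : ℝ) : ℝ := ∫ u in (0 : ℝ)..t, E.indicator (fun _ => (1 : ℝ)) u

/-- Continuous induction: the set where `g` keeps its initial value is closed and can always be
extended to the right. It identifies functions that are only known to advance in the same way just
after each time. -/
theorem eq_of_locally_const_right {g : ℝ → ℝ} (hg : Continuous g)
    (h : ∀ t, ∃ t' > t, ∀ u ∈ Ioo t t', g u = g t) (s t : ℝ) : g s = g t := by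
  wlog hst : s ≤ t generalizing s t
  · exact (this t s (le_of_not_ge hst)).symm
  have hcl : IsClosed ({u | g u = g s} ∩ Icc s t) :=
    (isClosed_eq hg continuous_const).inter isClosed_Icc
  refine ((hcl.Icc_subset_of_forall_exists_gt (by simp) fun u hu y hy => ?_)
    (right_mem_Icc.2 hst)).symm
  obtain ⟨t', ht', h'⟩ := h u
  have hm : u < min t' y := lt_min ht' hy
  exact ⟨(u + min t' y) / 2, (h' _ ⟨by linarith, by linarith [min_le_left t' y]⟩).trans hu.1,
    by linarith, by linarith [min_le_right t' y]⟩

section Length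

variable {E : Set ℝ}

theorem intervalIntegrable_indicator (hE : MeasurableSet E) (s t : ℝ) :
    IntervalIntegrable (E.indicator fun _ => (1 : ℝ)) volume s t := by
  rw [intervalIntegrable_iff]
  exact (integrableOn_const (by simp)).indicator hE

theorem lengthTo_sub (hE : MeasurableSet E) (s t : ℝ) :
    lengthTo E t - lengthTo E s = ∫ u in s..t, E.indicator (fun _ => (1 : ℝ)) u :=
  intervalIntegral.integral_interval_sub_left (intervalIntegrable_indicator hE _ _)
    (intervalIntegrable_indicator hE _ _)

theorem lengthTo_continuous (hE : MeasurableSet E) : Continuous (lengthTo E) :=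
  intervalIntegral.continuous_primitive (intervalIntegrable_indicator hE) 0

theorem lengthTo_mono (hE : MeasurableSet E) : Monotone (lengthTo E) := fun s t hst => by
  rw [← sub_nonneg, lengthTo_sub hE]
  exact intervalIntegral.integral_nonneg hst fun u _ => indicator_nonneg (fun _ _ => zero_le_one) u

theorem lengthTo_sub_of_subset (hE : MeasurableSet E) {s t : ℝ} (hst : s ≤ t)
    (h : ∀ u ∈ Ioo s t, u ∈ E) : lengthTo E t - lengthTo E s = t - s := by
  rw [lengthTo_sub hE, intervalIntegral.integral_congr_Ioo_of_le (g := fun _ => (1 : ℝ)) hst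
    fun u hu => indicator_of_mem (h u hu) _]
  simp

theorem lengthTo_eq_of_disjoint (hE : MeasurableSet E) {s t : ℝ} (hst : s ≤ t)
    (h : ∀ u ∈ Ioo s t, u ∉ E) : lengthTo E t = lengthTo E s := by
  rw [← sub_eq_zero, lengthTo_sub hE,
    intervalIntegral.integral_congr_Ioo_of_le (g := fun _ => (0 : ℝ)) hst
    fun u hu => indicator_of_notMem (h u hu) _]
  simp

end Length

/-! ### The map of a cactus -/

namespace Cactus

variable {A : Type} {P : Finset A}

/-- The cactus map, with zero coordinates at the labels outside `P`. -/
def map [DecidableEq A] (x : Cactus P) : ℝ → A → ℝ :=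
  fun t B => if h : B ∈ P then x.cactusMap t ⟨B, h⟩ else 0

theorem nonempty (x : Cactus P) : P.Nonempty := by
  have : (0 : Circ) ∈ ⋃ B, x.lobe B := by rw [x.cover]; trivial
  obtain ⟨B, -⟩ := mem_iUnion.1 this
  exact ⟨B, B.2⟩

theorem measurableSet_lobe (x : Cactus P) (B : P) :
    MeasurableSet ((fun u : ℝ => (u : Circ)) ⁻¹' x.lobe B) :=
  ((x.isArcUnion B).isClosed.preimage (AddCircle.continuous_mk' (1 : ℝ))).measurableSet

theorem cactusMap_eq (x : Cactus P) (t : ℝ) (B : P) :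
    x.cactusMap t B = P.card * lengthTo ((fun u : ℝ => (u : Circ)) ⁻¹' x.lobe B) t := rfl

/-- Each of the finitely many lobes is locally constant, in or out, to the right of `t`. On a common
interval the cover provides a lobe and disjointness of interiors makes it unique. -/
theorem exists_right (x : Cactus P) (t : ℝ) :
    ∃ B : P, ∃ t' > t, ∀ u ∈ Ioo t t', ∀ C, (u : Circ) ∈ x.lobe C ↔ C = B := by
  choose f hf1 hf2 using fun B => (x.isArcUnion B).right t
  have hne : (Finset.univ : Finset P).Nonempty := by
    obtain ⟨B, hB⟩ := x.nonempty
    exact ⟨⟨B, hB⟩, Finset.mem_univ _⟩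
  set t' := Finset.univ.inf' hne f with ht'
  have htt : t < t' := (Finset.lt_inf'_iff hne).2 fun B _ => hf1 B
  have hle : ∀ B, t' ≤ f B := fun B => Finset.inf'_le f (Finset.mem_univ B)
  have hmid : (t + t') / 2 ∈ Ioo t t' := ⟨by linarith, by linarith⟩
  obtain ⟨B, hB⟩ : ∃ B, (((t + t') / 2 : ℝ) : Circ) ∈ x.lobe B := by
    rw [← mem_iUnion, x.cover]; trivial
  have hall : ∀ C, (((t + t') / 2 : ℝ) : Circ) ∈ x.lobe C →
      ∀ u ∈ Ioo t t', (u : Circ) ∈ x.lobe C := by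
    intro C hC u hu
    rcases hf2 C with h | h
    · exact h u ⟨hu.1, hu.2.trans_le (hle C)⟩
    · exact absurd hC (h _ ⟨hmid.1, hmid.2.trans_le (hle C)⟩)
  have hint : ∀ C, (((t + t') / 2 : ℝ) : Circ) ∈ x.lobe C →
      (((t + t') / 2 : ℝ) : Circ) ∈ interior (x.lobe C) := by
    intro C hC
    refine mem_interior.2 ⟨(fun u : ℝ => (u : Circ)) '' Ioo t t', ?_,
      QuotientAddGroup.isOpenMap_coe _ isOpen_Ioo, mem_image_of_mem _ hmid⟩
    rintro _ ⟨u, hu, rfl⟩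
    exact hall C hC u hu
  refine ⟨B, t', htt, fun u hu C => ⟨fun hC => ?_, fun h => h ▸ hall B hB u hu⟩⟩
  by_contra hCB
  have hC' : (((t + t') / 2 : ℝ) : Circ) ∈ x.lobe C := by
    rcases hf2 C with h | h
    · exact h _ ⟨hmid.1, hmid.2.trans_le (hle C)⟩
    · exact absurd hC (h u ⟨hu.1, hu.2.trans_le (hle C)⟩)
  exact disjoint_left.1 (x.disjoint_interior C B hCB) (hint C hC') (hint B hB)

theorem exists_left (x : Cactus P) (t : ℝ) :
    ∃ B : P, ∃ t' < t, ∀ u ∈ Ioo t' t, ∀ C, (u : Circ) ∈ x.lobe C ↔ C = B := by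
  choose f hf1 hf2 using fun B => (x.isArcUnion B).left t
  have hne : (Finset.univ : Finset P).Nonempty := by
    obtain ⟨B, hB⟩ := x.nonempty
    exact ⟨⟨B, hB⟩, Finset.mem_univ _⟩
  set t' := Finset.univ.sup' hne f with ht'
  have htt : t' < t := (Finset.sup'_lt_iff hne).2 fun B _ => hf1 B
  have hle : ∀ B, f B ≤ t' := fun B => Finset.le_sup' f (Finset.mem_univ B)
  -- On the whole of `(t', t)` the set of lobes containing a point is constant, so it can be sampled
  -- just after `t'`, where `exists_right` applies.
  obtain ⟨B, u', hu', h'⟩ := x.exists_right t'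
  refine ⟨B, t', htt, fun u hu C => ?_⟩
  have hm : t' < min u' t := lt_min hu' htt
  have hmid : (t' + min u' t) / 2 ∈ Ioo t' u' := ⟨by linarith, by linarith [min_le_left u' t]⟩
  have hmid' : (t' + min u' t) / 2 ∈ Ioo t' t := ⟨by linarith, by linarith [min_le_right u' t]⟩
  rw [← h' _ hmid]
  rcases hf2 C with h | h
  · exact iff_of_true (h u ⟨(hle C).trans_lt hu.1, hu.2⟩) (h _ ⟨(hle C).trans_lt hmid'.1, hmid'.2⟩)
  · exact iff_of_false (h u ⟨(hle C).trans_lt hu.1, hu.2⟩) (h _ ⟨(hle C).trans_lt hmid'.1, hmid'.2⟩)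

variable [DecidableEq A]

theorem map_coe (x : Cactus P) (t : ℝ) (B : P) : x.map t B = x.cactusMap t B := by
  simp [map, B.2]

theorem map_sub_of_subset (x : Cactus P) (B : P) {s t : ℝ} (hst : s ≤ t)
    (h : ∀ u ∈ Ioo s t, (u : Circ) ∈ x.lobe B) : x.map t B - x.map s B = P.card * (t - s) := by
  rw [map_coe, map_coe, cactusMap_eq, cactusMap_eq, ← mul_sub,
    lengthTo_sub_of_subset (x.measurableSet_lobe B) hst h]

theorem map_eq_of_disjoint (x : Cactus P) (B : P) {s t : ℝ} (hst : s ≤ t)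
    (h : ∀ u ∈ Ioo s t, (u : Circ) ∉ x.lobe B) : x.map t B = x.map s B := by
  rw [map_coe, map_coe, cactusMap_eq, cactusMap_eq,
    lengthTo_eq_of_disjoint (x.measurableSet_lobe B) hst h]

theorem map_mono (x : Cactus P) (B : A) : Monotone fun t => x.map t B := by
  by_cases hB : B ∈ P
  · intro s t hst
    simp only [map, hB, dif_pos, cactusMap_eq]
    have := lengthTo_mono (x.measurableSet_lobe ⟨B, hB⟩) hst
    gcongr
  · simp only [map, hB, dif_neg, not_false_eq_true]
    exact monotone_const

theorem map_continuous (x : Cactus P) (B : A) : Continuous fun t => x.map t B := by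
  by_cases hB : B ∈ P
  · simp only [map, hB, dif_pos, cactusMap_eq]
    exact continuous_const.mul (lengthTo_continuous (x.measurableSet_lobe ⟨B, hB⟩))
  · simp only [map, hB, dif_neg, not_false_eq_true]
    exact continuous_const

theorem map_zero (x : Cactus P) (B : A) : x.map 0 B = 0 := by
  by_cases hB : B ∈ P <;> simp [map, hB, cactusMap_eq, lengthTo]

/-- Just after any time exactly one lobe is traversed, with slope `P.card`; thus the difference of
the two sides is locally constant to the right. -/
theorem sum_map (x : Cactus P) (t : ℝ) : ∑ B ∈ P, x.map t B = P.card * t := by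
  have hg : Continuous fun t => (∑ B ∈ P, x.map t B) - P.card * t := by
    have := x.map_continuous
    fun_prop
  have h := eq_of_locally_const_right hg (fun t => ?_) t 0
  · simp only [map_zero, Finset.sum_const_zero, mul_zero, sub_zero] at h
    linarith
  · obtain ⟨B, t', ht', hB⟩ := x.exists_right t
    refine ⟨t', ht', fun u hu => ?_⟩
    have e : ∑ C ∈ P, (x.map u C - x.map t C) = P.card * (u - t) := by
      rw [Finset.sum_eq_single_of_mem (B : A) B.2]
      · exact x.map_sub_of_subset B hu.1.le fun v hv => (hB v ⟨hv.1, hv.2.trans hu.2⟩ B).2 rfl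
      · intro C hC hCB
        rw [sub_eq_zero]
        exact x.map_eq_of_disjoint ⟨C, hC⟩ hu.1.le fun v hv hv' =>
          hCB (congrArg Subtype.val ((hB v ⟨hv.1, hv.2.trans hu.2⟩ _).1 hv'))
    rw [Finset.sum_sub_distrib] at e
    linarith

theorem map_add_one_sub (x : Cactus P) (t : ℝ) (B : P) :
    x.map (t + 1) B - x.map t B = P.card * volume.real (x.lobe B) := by
  rw [map_coe, map_coe, cactusMap_eq, cactusMap_eq, ← mul_sub, lengthTo_sub (x.measurableSet_lobe B)]
  congr 1
  have := AddCircle.intervalIntegral_preimage 1 t ((x.lobe B).indicator (1 : Circ → ℝ))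
  rw [integral_indicator_one (x.isArcUnion B).isClosed.measurableSet] at this
  exact this

/-- All lobes have equal measure, and by `sum_map` over a full period `P.card` times this measure is
one. -/
theorem map_add_one (x : Cactus P) (t : ℝ) {B : A} (hB : B ∈ P) : x.map (t + 1) B = x.map t B + 1 := by
  have hp : (P.card : ℝ) ≠ 0 := by simpa using x.nonempty.ne_empty
  have key : ∀ C ∈ P, x.map 1 C = P.card * volume.real (x.lobe ⟨B, hB⟩) := by
    intro C hC
    have := x.map_add_one_sub 0 ⟨C, hC⟩
    rw [zero_add, map_zero, sub_zero] at this
    rw [this, Measure.real, Measure.real, x.measure_eq]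
  have h1 := x.sum_map 1
  rw [Finset.sum_congr rfl key, Finset.sum_const, nsmul_eq_mul] at h1
  have h2 := x.map_add_one_sub t ⟨B, hB⟩
  rw [mul_left_cancel₀ hp h1] at h2
  simp only at h2
  linarith

theorem exists_mem_of_map_lt (x : Cactus P) (B : P) {s t : ℝ} (h : x.map s B < x.map t B) :
    ∃ u ∈ Ioo s t, (u : Circ) ∈ x.lobe B := by
  by_contra hno
  push Not at hno
  refine h.ne' (x.map_eq_of_disjoint B (le_of_lt ?_) hno)
  by_contra hst
  exact absurd (x.map_mono B (not_lt.1 hst)) (not_le.2 h)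

theorem isCactusMap (x : Cactus P) : IsCactusMap P x.map where
  eq_of_notMem B hB s t := by simp [map, hB]
  mono := x.map_mono
  cont := x.map_continuous
  add_one B hB t := x.map_add_one t hB
  right t := by
    obtain ⟨B, t', ht', hB⟩ := x.exists_right t
    refine ⟨B, t', ht', fun C hCB => ?_⟩
    by_cases hC : C ∈ P
    · exact x.map_eq_of_disjoint ⟨C, hC⟩ (le_of_lt ht') fun u hu hu' =>
        hCB (congrArg Subtype.val ((hB u hu _).1 hu'))
    · simp [map, hC]
  left t := by
    obtain ⟨B, t', ht', hB⟩ := x.exists_left t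
    refine ⟨B, t', ht', fun C hCB => ?_⟩
    by_cases hC : C ∈ P
    · exact (x.map_eq_of_disjoint ⟨C, hC⟩ (le_of_lt ht') fun u hu hu' =>
        hCB (congrArg Subtype.val ((hB u hu _).1 hu'))).symm
    · simp [map, hC]
  noncrossing B C hBC t₁ t₂ t₃ t₄ h1 h2 h3 h4 := by
    have hB : B ∈ P := by
      by_contra hB
      simp [map, hB] at h1
    have hC : C ∈ P := by
      by_contra hC
      simp [map, hC] at h2
    obtain ⟨u₁, m1, e1⟩ := x.exists_mem_of_map_lt ⟨B, hB⟩ h1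
    obtain ⟨u₂, m2, e2⟩ := x.exists_mem_of_map_lt ⟨C, hC⟩ h2
    obtain ⟨u₃, m3, e3⟩ := x.exists_mem_of_map_lt ⟨B, hB⟩ h3
    obtain ⟨u₄, m4, e4⟩ := x.exists_mem_of_map_lt ⟨C, hC⟩ h4
    exact x.noncrossing ⟨B, hB⟩ ⟨C, hC⟩ (fun h => hBC (congrArg Subtype.val h))
      ⟨u₁, u₂, u₃, u₄, m1.2.trans m2.1, m2.2.trans m3.1, m3.2.trans m4.1,
        by linarith [m4.2, m1.1], e1, e2, e3, e4⟩
  zero := x.map_zero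
  sum := x.sum_map

/-- The lobes of a cactus are the supports of the coordinates of the cactus map. -/
theorem mem_lobe_iff (x : Cactus P) (B : P) (t : ℝ) :
    (t : Circ) ∈ x.lobe B ↔ ∀ ε > 0, x.map (t - ε) B < x.map (t + ε) B := by
  have hp : (0 : ℝ) < P.card := by exact_mod_cast x.nonempty.card_pos
  constructor
  · intro ht ε hε
    rcases (x.isArcUnion B).exists_side ht with ⟨t', h1, h2⟩ | ⟨t', h1, h2⟩
    · have hm : t < min t' (t + ε) := lt_min h1 (by linarith)
      have := x.map_sub_of_subset B hm.le fun u hu => h2 u ⟨hu.1, hu.2.trans_le (min_le_left _ _)⟩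
      have h3 := x.map_mono B (min_le_right t' (t + ε))
      have h4 := x.map_mono B (by linarith : t - ε ≤ t)
      have := mul_pos hp (sub_pos.2 hm)
      simp only at h3 h4
      linarith
    · have hm : max t' (t - ε) < t := max_lt h1 (by linarith)
      have := x.map_sub_of_subset B hm.le fun u hu => h2 u ⟨(le_max_left _ _).trans_lt hu.1, hu.2⟩
      have h3 := x.map_mono B (le_max_right t' (t - ε))
      have h4 := x.map_mono B (by linarith : t ≤ t + ε)
      have := mul_pos hp (sub_pos.2 hm)
      simp only at h3 h4
      linarith
  · intro h
    have hcl : IsClosed ((fun u : ℝ => (u : Circ)) ⁻¹' x.lobe B) :=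
      (x.isArcUnion B).isClosed.preimage (AddCircle.continuous_mk' (1 : ℝ))
    by_contra ht
    obtain ⟨ε, hε, hsub⟩ := Metric.isOpen_iff.1 hcl.isOpen_compl t ht
    obtain ⟨u, hu, hu'⟩ := x.exists_mem_of_map_lt B (h ε hε)
    exact hsub (by rw [Real.ball_eq_Ioo]; exact hu) hu'

theorem map_of_rotation {x y : Cactus P} {a : ℝ}
    (h : ∀ B, y.lobe B = {u | u + (a : Circ) ∈ x.lobe B}) : y.map = rotMap a x.map := by
  funext t B
  by_cases hB : B ∈ P
  · have e1 := lengthTo_sub (x.measurableSet_lobe ⟨B, hB⟩) a (t + a)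
    simp only [rotMap, map, hB, dif_pos, cactusMap_eq]
    rw [← mul_sub, e1]
    congr 1
    have e2 := intervalIntegral.integral_comp_add_right (a := 0) (b := t)
      (((fun u : ℝ => (u : Circ)) ⁻¹' x.lobe ⟨B, hB⟩).indicator fun _ => (1 : ℝ)) a
    rw [zero_add] at e2
    rw [← e2, lengthTo]
    congr 1
    funext u
    have hm : u ∈ (fun u : ℝ => (u : Circ)) ⁻¹' y.lobe ⟨B, hB⟩ ↔
        u + a ∈ (fun u : ℝ => (u : Circ)) ⁻¹' x.lobe ⟨B, hB⟩ := by
      rw [mem_preimage, mem_preimage, h, mem_ofPred_eq, AddCircle.coe_add]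
    by_cases hu : u ∈ (fun u : ℝ => (u : Circ)) ⁻¹' y.lobe ⟨B, hB⟩
    · rw [indicator_of_mem hu, indicator_of_mem (hm.1 hu)]
    · rw [indicator_of_notMem hu, indicator_of_notMem (mt hm.2 hu)]
  · simp [rotMap, map, hB]

/-- The lobes are recovered from the map by `mem_lobe_iff`, so a rotation of the map is a rotation
of the cactus. Together with `map_of_equiv` this identifies unbased cacti with cactus maps up to
`rotMap`. -/
theorem equiv_of_map_eq {x y : Cactus P} {a : ℝ} (h : y.map = rotMap a x.map) :
    (⟦x⟧ : UnbasedCactus P) = ⟦y⟧ := by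
  refine Quotient.sound ⟨(a : Circ), fun B => ?_⟩
  ext u
  obtain ⟨t, rfl⟩ := exists_coe_eq u
  rw [mem_ofPred_eq, ← AddCircle.coe_add, mem_lobe_iff, mem_lobe_iff, h]
  simp only [rotMap, sub_lt_sub_iff_right, add_right_comm t, sub_add_eq_add_sub]

theorem map_of_equiv {x y : Cactus P} (h : (⟦x⟧ : UnbasedCactus P) = ⟦y⟧) :
    ∃ a : ℝ, y.map = rotMap a x.map := by
  obtain ⟨a, ha⟩ := Quotient.exact h
  obtain ⟨a, rfl⟩ := exists_coe_eq a
  exact ⟨a, map_of_rotation ha⟩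

end Cactus

end NestedCacti

namespace NestedCacti

/-! ### Cacti from cactus maps -/

section Support

variable {A : Type} {P : Finset A} {c : ℝ → A → ℝ}

/-- The support of a coordinate of a cactus map. -/
def lobeSupport (c : ℝ → A → ℝ) (B : A) : Set ℝ := {t | ∀ ε > 0, c (t - ε) B < c (t + ε) B}

theorem IsCactusMap.add_int_mem_lobeSupport (hc : IsCactusMap P c) {B : A} {t : ℝ} (k : ℤ) :
    t + k ∈ lobeSupport c B ↔ t ∈ lobeSupport c B := by
  simp only [lobeSupport, mem_ofPred_eq]
  refine forall₂_congr fun ε _ => ?_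
  rw [show t + k - ε = t - ε + k by ring, show t + k + ε = t + ε + k by ring, hc.add_intCast,
    hc.add_intCast, add_lt_add_iff_right]

theorem IsCactusMap.mem_lobeSupport_of_const (hc : IsCactusMap P c) {B : A} (hB : B ∈ P)
    {s s' t : ℝ} (hs : s < s') (h : ∀ C ≠ B, c s' C = c s C) (ht : t ∈ Icc s s') :
    t ∈ lobeSupport c B := by
  intro ε hε
  have hp : (0 : ℝ) < P.card := by exact_mod_cast Finset.card_pos.2 ⟨B, hB⟩
  have key : ∀ u v, s ≤ u → u < v → v ≤ s' → c u B < c v B := by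
    intro u v hu huv hv
    have := hc.sub_eq_of_const (s := u) (t := v) hB fun C hC =>
      hc.eq_of_mem_Icc (h C hC).symm ⟨hu.trans huv.le, hv⟩ ⟨hu, huv.le.trans hv⟩
    have := mul_pos hp (sub_pos.2 huv)
    linarith
  have h1 := hc.mono B (by linarith : t - ε ≤ t)
  have h2 := hc.mono B (by linarith : t ≤ t + ε)
  rcases ht.2.eq_or_lt with rfl | hlt
  · have hm : max s (t - ε) < t := max_lt hs (by linarith)
    have h3 := hc.mono B (le_max_right s (t - ε))
    have := key _ _ (le_max_left s (t - ε)) hm le_rfl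
    simp only at h1 h2 h3
    linarith
  · have hm : t < min s' (t + ε) := lt_min hlt (by linarith)
    have h3 := hc.mono B (min_le_right s' (t + ε))
    have := key _ _ ht.1 hm (min_le_left _ _)
    simp only at h1 h2 h3
    linarith

theorem IsCactusMap.exists_side (hc : IsCactusMap P c) {B : A} {t : ℝ} (h : t ∈ lobeSupport c B) :
    (∃ t' > t, ∀ C ≠ B, c t' C = c t C) ∨ ∃ t' < t, ∀ C ≠ B, c t' C = c t C := by
  obtain ⟨D, u, hu, hD⟩ := hc.right t
  obtain ⟨D', v, hv, hD'⟩ := hc.left t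
  by_cases h1 : D = B
  · exact Or.inl ⟨u, hu, h1 ▸ hD⟩
  by_cases h2 : D' = B
  · exact Or.inr ⟨v, hv, h2 ▸ hD'⟩
  exfalso
  have hε : 0 < min (u - t) (t - v) := lt_min (sub_pos.2 hu) (sub_pos.2 hv)
  have h3 := min_le_left (u - t) (t - v)
  have h4 := min_le_right (u - t) (t - v)
  have e := (hD' B (Ne.symm h2)).trans (hD B (Ne.symm h1)).symm
  exact (h _ hε).ne (hc.eq_of_mem_Icc e ⟨by linarith, by linarith⟩ ⟨by linarith, by linarith⟩)

/-- Next to a point of the support, `B` is the only moving lobe on one side. The arc of the marking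
on that side must carry the letter `B`, by uniqueness of the moving lobe. -/
theorem IsMarking.mem_lobeSupport_iff {N : ℕ} {letter : Fin N → A} {s : ℕ → ℝ}
    (h : IsMarking N letter c s) (hc : IsCactusMap P c) (hP : P.Nonempty) (hm : ∀ i, letter i ∈ P)
    {B : A} {t : ℝ} : t ∈ lobeSupport c B ↔ ∃ i : Fin N, letter i = B ∧ s i < s (i + 1) ∧
      (t : Circ) ∈ (fun u : ℝ => (u : Circ)) '' Icc (s i) (s (i + 1)) := by
  constructor
  · intro ht
    rcases hc.exists_side ht with ⟨t', ht', hB⟩ | ⟨t', ht', hB⟩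
    · obtain ⟨k, h1, h2⟩ := exists_add_int_mem_Ico (s 0) t
      rw [← h.last] at h2
      obtain ⟨i, hi, h3, h4⟩ := exists_mem_Ico_of_steps h1 h2
      refine ⟨⟨i, hi⟩, ?_, h3.trans_lt h4, coe_mem_arc_iff.2 ⟨k, h3, h4.le⟩⟩
      refine hc.eq_of_const hP (s := t + k) (t := s (i + 1)) (t' := t' + k) h4 (by linarith)
        (fun C hC => ?_) (fun C hC => ?_)
      · exact hc.eq_of_mem_Icc (h.const ⟨i, hi⟩ C hC).symm ⟨(h3.trans_lt h4).le, le_rfl⟩ ⟨h3, h4.le⟩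
      · rw [hc.add_intCast, hc.add_intCast, hB C hC]
    · obtain ⟨k, h1, h2⟩ := exists_add_int_mem_Ioc (s 0) t
      rw [← h.last] at h2
      obtain ⟨i, hi, h3, h4⟩ := exists_mem_Ioc_of_steps h1 h2
      refine ⟨⟨i, hi⟩, ?_, h3.trans_le h4, coe_mem_arc_iff.2 ⟨k, h3.le, h4⟩⟩
      refine hc.eq_of_const_left hP (s := t + k) (t := s i) (t' := t' + k) h3 (by linarith)
        (fun C hC => ?_) (fun C hC => ?_)
      · exact hc.eq_of_mem_Icc (h.const ⟨i, hi⟩ C hC).symm ⟨h3.le, h4⟩ ⟨le_rfl, (h3.trans_le h4).le⟩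
      · rw [hc.add_intCast, hc.add_intCast, hB C hC]
  · rintro ⟨i, rfl, hlt, hmem⟩
    obtain ⟨k, h1, h2⟩ := coe_mem_arc_iff.1 hmem
    rw [← hc.add_int_mem_lobeSupport k]
    exact hc.mem_lobeSupport_of_const (hm i) hlt (h.const i) ⟨h1, h2⟩

theorem IsMarking.rotMap {N : ℕ} {letter : Fin N → A} {s : ℕ → ℝ}
    (h : IsMarking N letter c s) (a : ℝ) :
    IsMarking N letter (NestedCacti.rotMap a c) fun k => s k - a where
  le i hi := sub_le_sub_right (h.le i hi) a
  last := by rw [h.last]; ring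
  const i C hC := by simp [NestedCacti.rotMap, h.const i C hC]

theorem Cactus.mem_lobe_iff_lobeSupport [DecidableEq A] (x : Cactus P) (B : P) (t : ℝ) :
    (t : Circ) ∈ x.lobe B ↔ t ∈ lobeSupport x.map B := x.mem_lobe_iff B t

theorem IsCactusMap.mem_lobeSupport_iff_of_mem_Ioo (hc : IsCactusMap P c) {B D : A} (hB : B ∈ P)
    {s t u : ℝ} (h : ∀ C ≠ D, c t C = c s C) (hu : u ∈ Ioo s t) : u ∈ lobeSupport c B ↔ B = D := by
  constructor
  · intro hu'
    by_contra hBD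
    have hε : 0 < min (u - s) (t - u) := lt_min (sub_pos.2 hu.1) (sub_pos.2 hu.2)
    have h3 := min_le_left (u - s) (t - u)
    have h4 := min_le_right (u - s) (t - u)
    exact (hu' _ hε).ne (hc.eq_of_mem_Icc (h B hBD).symm ⟨by linarith, by linarith⟩
      ⟨by linarith, by linarith⟩)
  · rintro rfl
    exact hc.mem_lobeSupport_of_const hB (hu.1.trans hu.2) h ⟨hu.1.le, hu.2.le⟩

/-- Both sides advance in the same way just after each time, and vanish at zero. This shows that the
cactus built from the supports has the map it was built from. -/
theorem IsCactusMap.lengthTo_lobeSupport (hc : IsCactusMap P c) {B : A} (hB : B ∈ P)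
    (hmeas : MeasurableSet (lobeSupport c B)) (t : ℝ) :
    P.card * lengthTo (lobeSupport c B) t = c t B := by
  have hg : Continuous fun t => P.card * lengthTo (lobeSupport c B) t - c t B :=
    (continuous_const.mul (lengthTo_continuous hmeas)).sub (hc.cont B)
  have := eq_of_locally_const_right hg (fun t => ?_) t 0
  · simp only [hc.zero, lengthTo, intervalIntegral.integral_same, mul_zero, sub_zero] at this
    simp only [lengthTo]
    linarith
  · obtain ⟨D, t', ht', hD⟩ := hc.right t
    refine ⟨t', ht', fun u hu => ?_⟩
    have hD' : ∀ C ≠ D, c u C = c t C := fun C hC =>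
      hc.eq_of_mem_Icc (hD C hC).symm ⟨hu.1.le, hu.2.le⟩ ⟨le_rfl, (hu.1.trans hu.2).le⟩
    by_cases hBD : B = D
    · have h1 := lengthTo_sub_of_subset hmeas hu.1.le fun v hv =>
        (hc.mem_lobeSupport_iff_of_mem_Ioo hB hD' hv).2 hBD
      have h2 := hc.sub_eq_of_const hB (hBD ▸ hD')
      linear_combination (P.card : ℝ) * h1 - h2
    · rw [lengthTo_eq_of_disjoint hmeas hu.1.le fun v hv hv' =>
        hBD ((hc.mem_lobeSupport_iff_of_mem_Ioo hB hD' hv).1 hv'), hD' B hBD]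

/-- The lobes are the supports of the coordinates. A reduced marking shows that they are unions of
nondegenerate arcs. -/
theorem IsCactusMap.exists_cactus [DecidableEq A] (hc : IsCactusMap P c) (hP : 2 ≤ P.card) :
    ∃ x : Cactus P, x.map = c := by
  have hP0 : P.Nonempty := Finset.card_pos.1 (by omega)
  have hp : (P.card : ℝ) ≠ 0 := by simpa using hP0.ne_empty
  obtain ⟨N, letter, s, hs, hlt, hm, -⟩ := hc.exists_isMarking hP
  let lobe : P → Set Circ := fun B => (fun u : ℝ => (u : Circ)) '' lobeSupport c B
  have hmem : ∀ (B : P) (t : ℝ), (t : Circ) ∈ lobe B ↔ t ∈ lobeSupport c (B : A) := by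
    intro B t
    constructor
    · rintro ⟨u, hu, h⟩
      obtain ⟨k, rfl⟩ := coe_eq_coe_iff.1 h
      exact (hc.add_int_mem_lobeSupport k).2 hu
    · exact fun h => ⟨t, h, rfl⟩
  have harc : ∀ B, IsArcUnion (lobe B) := by
    intro B
    refine ⟨(Finset.univ.filter fun i => letter i = B).image fun i : Fin N => (s i, s (i + 1)),
      fun a ha => ?_, ?_⟩
    · obtain ⟨i, -, rfl⟩ := Finset.mem_image.1 ha
      exact hlt i i.2
    · ext u
      obtain ⟨t, rfl⟩ := exists_coe_eq u
      rw [hmem, hs.mem_lobeSupport_iff hc hP0 hm]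
      simp only [mem_iUnion, Finset.mem_image, Finset.mem_filter, Finset.mem_univ, true_and]
      constructor
      · rintro ⟨i, h1, -, h2⟩
        exact ⟨_, ⟨i, h1, rfl⟩, h2⟩
      · rintro ⟨_, ⟨i, h1, rfl⟩, h2⟩
        exact ⟨i, h1, hlt i i.2, h2⟩
  have hmeas : ∀ B : P, MeasurableSet (lobeSupport c (B : A)) := fun B => by
    have : lobeSupport c (B : A) = (fun u : ℝ => (u : Circ)) ⁻¹' lobe B := by
      ext t
      exact (hmem B t).symm
    rw [this]
    exact ((harc B).isClosed.preimage (AddCircle.continuous_mk' (1 : ℝ))).measurableSet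
  have hpre : ∀ B : P, (fun u : ℝ => (u : Circ)) ⁻¹' lobe B = lobeSupport c (B : A) := fun B => by
    ext t
    exact hmem B t
  have hvol : ∀ B, volume.real (lobe B) = 1 / P.card := by
    intro B
    have h1 := AddCircle.intervalIntegral_preimage 1 0 ((lobe B).indicator (1 : Circ → ℝ))
    rw [integral_indicator_one (harc B).isClosed.measurableSet] at h1
    have h2 := hc.lengthTo_lobeSupport B.2 (hmeas B) 1
    rw [hc.one_apply B.2, lengthTo, ← hpre B] at h2
    rw [zero_add] at h1
    rw [← h1, eq_div_iff hp, mul_comm]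
    exact h2
  have hright : ∀ t : ℝ, ∃ D, ∃ t' > t, ∀ u ∈ Ioo t t', ∀ C : P, (u : Circ) ∈ lobe C ↔ (C : A) = D := by
    intro t
    obtain ⟨D, t', ht', hD⟩ := hc.right t
    exact ⟨D, t', ht', fun u hu C => by rw [hmem, hc.mem_lobeSupport_iff_of_mem_Ioo C.2 hD hu]⟩
  let x : Cactus P :=
    { lobe := lobe
      isArcUnion := harc
      cover := by
        refine eq_univ_of_forall fun u => ?_
        obtain ⟨t, rfl⟩ := exists_coe_eq u
        obtain ⟨D, t', ht', hD⟩ := hc.right t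
        have hDP := hc.mem_of_const hP0 (ne_of_lt ht') hD
        exact mem_iUnion.2 ⟨⟨D, hDP⟩, (hmem _ _).2
          (hc.mem_lobeSupport_of_const hDP ht' hD ⟨le_rfl, le_of_lt ht'⟩)⟩
      measure_eq := fun B C => by
        have := (hvol B).trans (hvol C).symm
        rwa [Measure.real, Measure.real,
          ENNReal.toReal_eq_toReal_iff' (measure_ne_top _ _) (measure_ne_top _ _)] at this
      disjoint_interior := fun B C hBC => by
        refine disjoint_left.2 fun u hB hC => hBC ?_
        obtain ⟨t, rfl⟩ := exists_coe_eq u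
        have hopen : IsOpen ((fun u : ℝ => (u : Circ)) ⁻¹' (interior (lobe B) ∩ interior (lobe C))) :=
          (isOpen_interior.inter isOpen_interior).preimage (AddCircle.continuous_mk' (1 : ℝ))
        obtain ⟨D, t', ht', hD⟩ := hright t
        obtain ⟨u, ⟨hu1, hu2⟩, hu⟩ := Filter.nonempty_of_mem (Filter.inter_mem
          (mem_nhdsWithin_of_mem_nhds (hopen.mem_nhds ⟨hB, hC⟩))
          (Ioo_mem_nhdsGT ht' : Ioo t t' ∈ nhdsWithin t (Ioi t)))
        exact Subtype.ext (((hD u hu B).1 (interior_subset hu1)).trans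
          ((hD u hu C).1 (interior_subset hu2)).symm)
      noncrossing := by
        rintro B C hBC ⟨u₁, u₂, u₃, u₄, h1, h2, h3, h4, m1, m2, m3, m4⟩
        rw [hmem] at m1 m2 m3 m4
        -- A point of a support only gives growth over small intervals around it, so the four points
        -- are thickened to disjoint intervals.
        obtain ⟨ε, hε, e1, e2, e3, e4⟩ : ∃ ε > 0, 2 * ε < u₂ - u₁ ∧ 2 * ε < u₃ - u₂ ∧
            2 * ε < u₄ - u₃ ∧ 2 * ε < u₁ + 1 - u₄ := by
          have q1 := sub_pos.2 h1
          have q2 := sub_pos.2 h2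
          have q3 := sub_pos.2 h3
          have q4 := sub_pos.2 h4
          set m := min (min (u₂ - u₁) (u₃ - u₂)) (min (u₄ - u₃) (u₁ + 1 - u₄)) with hm
          have hm0 : 0 < m := lt_min (lt_min q1 q2) (lt_min q3 q4)
          have l1 : m ≤ u₂ - u₁ := (min_le_left _ _).trans (min_le_left _ _)
          have l2 : m ≤ u₃ - u₂ := (min_le_left _ _).trans (min_le_right _ _)
          have l3 : m ≤ u₄ - u₃ := (min_le_right _ _).trans (min_le_left _ _)
          have l4 : m ≤ u₁ + 1 - u₄ := (min_le_right _ _).trans (min_le_right _ _)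
          exact ⟨m / 4, by linarith, by linarith, by linarith, by linarith, by linarith⟩
        refine hc.noncrossing B C (fun h => hBC (Subtype.ext h)) (u₁ - ε) (u₁ + ε) (u₂ + ε) (u₃ + ε)
          (m1 ε hε) ((hc.mono C (by linarith)).trans_lt (m2 ε hε)) ?_ ?_
        · exact (hc.mono B (by linarith : u₂ + ε ≤ u₃ - ε)).trans_lt (m3 ε hε)
        · exact ((hc.mono C (by linarith : u₃ + ε ≤ u₄ - ε)).trans_lt (m4 ε hε)).trans_le
            (hc.mono C (by linarith)) }
  refine ⟨x, ?_⟩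
  funext t B
  by_cases hB : B ∈ P
  · have h1 := x.map_coe t ⟨B, hB⟩
    simp only at h1
    rw [h1, Cactus.cactusMap_eq, ← hc.lengthTo_lobeSupport hB (hmeas ⟨B, hB⟩)]
    rw [show x.lobe = lobe from rfl, hpre]
  · rw [x.isCactusMap.eq_zero hB, hc.eq_zero hB]

end Support

/-! ### Realizations of cyclic words -/

namespace CyclicWord

variable {A : Type} [DecidableEq A] {P : Finset A} (X : CyclicWord P)

theorem letter_mem (i : Fin X.len) : X.letter i ∈ P := (X.mem_iff _).2 ⟨i, rfl⟩

theorem start_zero (l : Fin X.len → ℝ) : X.start l 0 = 0 := by simp [start]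

theorem start_succ_sub (l : Fin X.len → ℝ) (i : Fin X.len) :
    X.start l (i + 1) - X.start l i = l i / P.card := by
  rw [start, start, ← sub_div, ← Finset.sum_sub_distrib, Finset.sum_eq_single i]
  · simp
  · intro j _ hj
    have : (j : ℕ) ≠ i := fun h => hj (Fin.ext h)
    simp [show ((j : ℕ) < i + 1) ↔ (j : ℕ) < i by omega]
  · simp

theorem sum_eq_card {l : Fin X.len → ℝ} (hl : l ∈ X.closedModel) : ∑ i, l i = P.card := by
  rw [← Finset.sum_fiberwise_of_maps_to (fun i _ => X.letter_mem i), Finset.sum_congr rfl hl.2]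
  simp

theorem start_len {l : Fin X.len → ℝ} (hl : l ∈ X.closedModel) (hP : P.Nonempty) :
    X.start l X.len = 1 := by
  have hp : (P.card : ℝ) ≠ 0 := by simpa using hP.ne_empty
  simp only [start, Fin.is_lt, if_true, X.sum_eq_card hl, div_self hp]

theorem openModel_subset_closedModel : X.openModel ⊆ X.closedModel :=
  fun _ hl => ⟨fun i => (hl.1 i).le, hl.2⟩

variable {X}

/-- The starting points of the arcs are marks for the cactus in the definition of `Realizes`, since
on the arc `i` the lobe of its letter absorbs the total speed. Any other representative differs by a
rotation, which shifts the marks. -/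
theorem Realizes.exists_isMarking {l : Fin X.len → ℝ} {x : UnbasedCactus P} (h : X.Realizes l x)
    (hl : l ∈ X.closedModel) {z : Cactus P} (hz : ⟦z⟧ = x) :
    ∃ s, IsMarking X.len X.letter z.map s ∧ ∀ i, l i = P.card * (s (i + 1) - s i) := by
  obtain ⟨y, rfl, hy⟩ := h
  have hp : (0 : ℝ) < P.card := by exact_mod_cast y.nonempty.card_pos
  obtain ⟨a, ha⟩ := Cactus.map_of_equiv hz.symm
  have hd := X.start_succ_sub l
  have hle : ∀ i < X.len, X.start l i ≤ X.start l (i + 1) := fun i hi => by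
    have := hd ⟨i, hi⟩
    have h2 := div_nonneg (hl.1 ⟨i, hi⟩) hp.le
    simp only at this
    linarith
  have hmark : IsMarking X.len X.letter y.map (X.start l) := by
    refine ⟨hle, by rw [X.start_zero, X.start_len hl y.nonempty, zero_add], fun i C hC => ?_⟩
    have hi := X.letter_mem i
    by_cases hCP : C ∈ P
    swap
    · rw [y.isCactusMap.eq_zero hCP, y.isCactusMap.eq_zero hCP]
    rcases (hl.1 i).eq_or_lt with h0 | hpos
    · have := hd i
      rw [← h0, zero_div, sub_eq_zero] at this
      rw [this]
    have e1 := y.map_sub_of_subset ⟨X.letter i, hi⟩ (hle i i.2) fun u hu => by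
      rw [hy]
      exact mem_iUnion₂.2 ⟨i, ⟨rfl, hpos⟩, u, ⟨hu.1.le, hu.2.le⟩, rfl⟩
    have e2 : ∑ C ∈ P, (y.map (X.start l (i + 1)) C - y.map (X.start l i) C) =
        P.card * (X.start l (i + 1) - X.start l i) := by
      rw [Finset.sum_sub_distrib, y.sum_map, y.sum_map]; ring
    rw [← Finset.add_sum_erase _ _ hi, e1, add_eq_left, Finset.sum_eq_zero_iff_of_nonneg
      fun C _ => sub_nonneg.2 (y.map_mono C (hle i i.2))] at e2
    exact sub_eq_zero.1 (e2 C (Finset.mem_erase.2 ⟨hC, hCP⟩))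
  refine ⟨fun k => X.start l k - a, ha ▸ hmark.rotMap a, fun i => ?_⟩
  rw [sub_sub_sub_cancel_right, hd i]
  field_simp

theorem exists_of_isMarking {z : Cactus P} {s : ℕ → ℝ} (h : IsMarking X.len X.letter z.map s)
    (hP : 2 ≤ P.card) :
    (fun i : Fin X.len => P.card * (s (i + 1) - s i)) ∈ X.closedModel ∧
      X.Realizes (fun i => P.card * (s (i + 1) - s i)) ⟦z⟧ := by
  have hp : (0 : ℝ) < P.card := by exact_mod_cast z.nonempty.card_pos
  set l : Fin X.len → ℝ := fun i => P.card * (s (i + 1) - s i) with hldef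
  have hl : l ∈ X.closedModel := by
    refine ⟨fun i => mul_nonneg hp.le (sub_nonneg.2 (h.le i i.2)), fun B hB => ?_⟩
    have := h.apply_sub z.isCactusMap X.letter_mem B le_rfl
    rw [h.last, z.isCactusMap.add_one B hB, add_sub_cancel_left] at this
    rw [Finset.sum_filter, this]
    exact Finset.sum_congr rfl fun i _ => by simp [hldef, i.2]
  refine ⟨hl, ?_⟩
  -- `Realizes` lets the first arc start at the base point, so the cactus is rotated to its first
  -- mark.
  obtain ⟨y, hy⟩ := (z.isCactusMap.rotMap (s 0)).exists_cactus hP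
  refine ⟨y, (Cactus.equiv_of_map_eq hy).symm, fun B => ?_⟩
  have hstart : ∀ k ≤ X.len, X.start l k = s k - s 0 := by
    intro k hk
    induction k with
    | zero => rw [X.start_zero, sub_self]
    | succ k ih =>
      have := X.start_succ_sub l ⟨k, hk⟩
      rw [ih (by omega)] at this
      simp only [hldef, mul_div_cancel_left₀ _ hp.ne'] at this
      linarith
  have hm := h.rotMap (s 0)
  rw [← hy] at hm
  ext u
  obtain ⟨t, rfl⟩ := exists_coe_eq u
  rw [y.mem_lobe_iff_lobeSupport, hm.mem_lobeSupport_iff y.isCactusMap y.nonempty X.letter_mem]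
  simp only [mem_iUnion, mem_ofPred_eq, exists_prop]
  refine exists_congr fun i => ?_
  rw [hstart i i.2.le, hstart (i + 1) i.2, and_assoc]
  simp only [sub_lt_sub_iff_right, hldef, hp, mul_pos_iff_of_pos_left, sub_pos]

/-- Every point of the closed cell of a word is realized. -/
theorem exists_realizes (X : CyclicWord P) {l : Fin X.len → ℝ} (hl : l ∈ X.closedModel)
    (hP : 2 ≤ P.card) : ∃ x, X.Realizes l x := by
  obtain ⟨c, s, hc, hs, e⟩ := exists_isCactusMap_isMarking (Finset.card_pos.1 (by omega)) hl.1
    X.letter_mem hl.2 X.noncrossing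
  obtain ⟨z, rfl⟩ := hc.exists_cactus hP
  refine ⟨⟦z⟧, ?_⟩
  rw [show l = _ from funext e]
  exact (exists_of_isMarking hs hP).2

/-- Every cactus lies in an open cell. -/
theorem exists_mem_openModel (x : UnbasedCactus P) (hP : 2 ≤ P.card) :
    ∃ X : CyclicWord P, ∃ l ∈ X.openModel, X.Realizes l x := by
  obtain ⟨z, rfl⟩ := Quotient.exists_rep x
  have hp : (0 : ℝ) < P.card := by exact_mod_cast z.nonempty.card_pos
  have hc := z.isCactusMap
  obtain ⟨N, letter, s, hs, hlt, hm, hadj⟩ := hc.exists_isMarking hP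
  have hmove : ∀ i : Fin N, z.map (s i) (letter i) < z.map (s (i + 1)) (letter i) := fun i => by
    have := hc.sub_eq_of_const (hm i) (hs.const i)
    have := mul_pos hp (sub_pos.2 (hlt i i.2))
    linarith
  let X : CyclicWord P :=
    { len := N
      letter := letter
      mem_iff := fun B => by
        refine ⟨fun hB => ?_, ?_⟩
        · by_contra hno
          push Not at hno
          have := hs.apply_sub hc hm B le_rfl
          rw [hs.last, hc.add_one B hB, Finset.sum_eq_zero fun i _ => by simp [hno i]] at this
          norm_num at this
        · rintro ⟨i, rfl⟩
          exact hm i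
      adjacent_ne := hadj
      noncrossing := fun i j k l hij hjk hkl e1 e2 => by
        by_contra hne
        have mono : ∀ {i j : ℕ}, i ≤ j → j ≤ N → s i ≤ s j := le_of_steps hs.le
        have h3 := hmove k
        have h4 := hmove l
        rw [← e1] at h3
        rw [← e2] at h4
        rw [Fin.lt_def] at hij hjk hkl
        -- Each of the four arcs contributes strict growth of its letter, so an alternating pattern
        -- in the word would be a crossing of the map.
        refine hc.noncrossing (letter i) (letter j) hne (s i) (s (i + 1)) (s (j + 1)) (s (k + 1))
          (hmove i) ((hc.mono _ (mono hij (by omega))).trans_lt (hmove j))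
          ((hc.mono _ (mono hjk (by omega))).trans_lt h3)
          (((hc.mono _ (mono hkl (by omega))).trans_lt h4).trans_le (hc.mono _ ?_))
        have a1 := mono (show (l : ℕ) + 1 ≤ N by omega) le_rfl
        have a2 := mono (Nat.zero_le i) i.2.le
        rw [hs.last] at a1
        linarith }
  have hX := exists_of_isMarking (X := X) hs hP
  exact ⟨X, _, ⟨fun i => mul_pos hp (sub_pos.2 (hlt i i.2)), hX.1.2⟩, hX.2⟩

/-- Closed cells are saturated with respect to cacti of the same type. -/
theorem Realizes.of_sim {l : Fin X.len → ℝ} {z z' : Cactus P} (h : X.Realizes l ⟦z⟧)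
    (hl : l ∈ X.closedModel) (hP : 2 ≤ P.card) (hs : Sim z.map z'.map) :
    ∃ l' ∈ X.closedModel, X.Realizes l' ⟦z'⟧ := by
  obtain ⟨s, hm, -⟩ := h.exists_isMarking hl rfl
  obtain ⟨s', hm'⟩ := hm.of_sim z.nonempty z.isCactusMap z'.isCactusMap hs
  exact ⟨_, exists_of_isMarking hm' hP⟩

theorem Realizes.sim {l l' : Fin X.len → ℝ} {z z' : Cactus P} (h : X.Realizes l ⟦z⟧)
    (h' : X.Realizes l' ⟦z'⟧) (hl : l ∈ X.openModel) (hl' : l' ∈ X.openModel) :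
    Sim z.map z'.map := by
  have hp : (0 : ℝ) < P.card := by exact_mod_cast z.nonempty.card_pos
  obtain ⟨s, hm, e⟩ := h.exists_isMarking (X.openModel_subset_closedModel hl) rfl
  obtain ⟨s', hm', e'⟩ := h'.exists_isMarking (X.openModel_subset_closedModel hl') rfl
  refine sim_of_isMarking hm hm' z.isCactusMap z'.isCactusMap z.nonempty X.letter_mem
    (fun i hi => ?_) fun i hi => ?_
  · have := hl.1 ⟨i, hi⟩
    rw [e, mul_pos_iff_of_pos_left hp] at this
    exact sub_pos.1 this
  · have := hl'.1 ⟨i, hi⟩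
    rw [e', mul_pos_iff_of_pos_left hp] at this
    exact sub_pos.1 this

end CyclicWord

/-! ### Intersection points of lobes -/

/-- The points of the circle belonging to two lobes. -/
def Cactus.doublePoints {A : Type} {P : Finset A} (x : Cactus P) : Set Circ :=
  {u | ∃ B C, B ≠ C ∧ u ∈ x.lobe B ∧ u ∈ x.lobe C}

theorem Cactus.ncard_doublePoints_eq {A : Type} {P : Finset A} {x y : Cactus P}
    (h : (⟦x⟧ : UnbasedCactus P) = ⟦y⟧) : x.doublePoints.ncard = y.doublePoints.ncard := by
  obtain ⟨a, ha⟩ := Quotient.exact h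
  have : y.doublePoints = (fun u => u + a) ⁻¹' x.doublePoints := by
    ext u
    simp only [doublePoints, ha, mem_ofPred_eq, mem_preimage]
  rw [this, ncard_preimage_of_injective_subset_range (add_left_injective a)
    fun u _ => ⟨u - a, sub_add_cancel u a⟩]

namespace CyclicWord

variable {A : Type} [DecidableEq A] {P : Finset A} {X : CyclicWord P}

/-- Arcs with different indices meet only in end points, and such a point is the start of one of the
two arcs. Only arcs of positive length occur in the lobes, which later makes the count drop on the
boundary of a simplex. -/
theorem doublePoints_subset {l : Fin X.len → ℝ} {y : Cactus P} (hl : l ∈ X.closedModel)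
    (hy : ∀ B : P, y.lobe B = ⋃ i ∈ {i : Fin X.len | X.letter i = B ∧ 0 < l i},
      (fun u : ℝ => (u : Circ)) '' Icc (X.start l i) (X.start l (i + 1))) :
    y.doublePoints ⊆ (fun i : Fin X.len => ((X.start l i : ℝ) : Circ)) ''
      (Finset.univ.filter fun i => 0 < l i : Finset _) := by
  have hp : (0 : ℝ) < P.card := by exact_mod_cast y.nonempty.card_pos
  have hle : ∀ i < X.len, X.start l i ≤ X.start l (i + 1) := fun i hi => by
    have := X.start_succ_sub l ⟨i, hi⟩
    have h2 := div_nonneg (hl.1 ⟨i, hi⟩) hp.le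
    simp only at this
    linarith
  have mono : ∀ {i j : ℕ}, i ≤ j → j ≤ X.len → X.start l i ≤ X.start l j := le_of_steps hle
  have h0 : ∀ i : Fin X.len, 0 ≤ X.start l i := fun i => X.start_zero l ▸ mono (Nat.zero_le _) i.2.le
  have h1 : ∀ i : Fin X.len, X.start l (i + 1) ≤ 1 := fun i =>
    X.start_len hl y.nonempty ▸ mono i.2 le_rfl
  rintro u ⟨B, C, hBC, hB, hC⟩
  rw [hy] at hB hC
  obtain ⟨i, ⟨hiB, hi⟩, v, hv, rfl⟩ := mem_iUnion₂.1 hB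
  obtain ⟨j, ⟨hjC, hj⟩, w, hw, hvw⟩ := mem_iUnion₂.1 hC
  have hij : i ≠ j := fun h => hBC (Subtype.ext (hiB.symm.trans (h ▸ hjC)))
  obtain ⟨k, hk⟩ := coe_eq_coe_iff.1 hvw
  have hi0 := h0 i
  have hj0 := h0 j
  have hi1 := h1 i
  have hj1 := h1 j
  have hk1 : -1 ≤ k := by
    have : (-1 : ℝ) ≤ k := by linarith [hv.1, hw.2]
    exact_mod_cast this
  have hk2 : k ≤ 1 := by
    have : (k : ℝ) ≤ 1 := by linarith [hv.2, hw.1]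
    exact_mod_cast this
  have hi' : i ∈ ((Finset.univ.filter fun i => 0 < l i : Finset _) : Set (Fin X.len)) := by simpa using hi
  have hj' : j ∈ ((Finset.univ.filter fun i => 0 < l i : Finset _) : Set (Fin X.len)) := by simpa using hj
  -- Both lifts lie in `[0, 1]`, so they coincide or are the two ends of the period.
  obtain rfl | rfl | rfl : k = -1 ∨ k = 0 ∨ k = 1 := by omega
  · refine ⟨i, hi', ?_⟩
    push_cast at hk
    rw [show v = X.start l i by linarith [hv.1, hw.2]]
  · push_cast at hk
    rcases lt_or_gt_of_ne hij with h | h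
    · have := mono (show (i : ℕ) + 1 ≤ j from h) j.2.le
      refine ⟨j, hj', ?_⟩
      rw [show v = X.start l j by linarith [hv.2, hw.1]]
    · have := mono (show (j : ℕ) + 1 ≤ i from h) i.2.le
      refine ⟨i, hi', ?_⟩
      rw [show v = X.start l i by linarith [hv.1, hw.2]]
  · refine ⟨j, hj', ?_⟩
    push_cast at hk
    rw [← hvw, show w = X.start l j by linarith [hw.1, hv.2]]

theorem Realizes.ncard_le {l : Fin X.len → ℝ} {z : Cactus P} (h : X.Realizes l ⟦z⟧)
    (hl : l ∈ X.closedModel) :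
    z.doublePoints.ncard ≤ (Finset.univ.filter fun i => 0 < l i).card := by
  obtain ⟨y, hyz, hy⟩ := h
  rw [← Cactus.ncard_doublePoints_eq hyz, ← Set.ncard_coe_finset]
  exact (ncard_le_ncard (doublePoints_subset hl hy) ((Finset.finite_toSet _).image _)).trans
    (ncard_image_le (Finset.finite_toSet _))

/-- Cyclically adjacent letters differ, so with positive lengths every starting point belongs to two
lobes and these points are distinct. This makes the length of the word an invariant of the cactus.
-/
theorem Realizes.ncard_eq {l : Fin X.len → ℝ} {z : Cactus P} (h : X.Realizes l ⟦z⟧)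
    (hl : l ∈ X.openModel) : z.doublePoints.ncard = X.len := by
  have hl' := X.openModel_subset_closedModel hl
  refine le_antisymm ((h.ncard_le hl').trans
    ((Finset.card_filter_le _ _).trans (by simp))) ?_
  obtain ⟨y, hyz, hy⟩ := h
  rw [← Cactus.ncard_doublePoints_eq hyz]
  have hp : (0 : ℝ) < P.card := by exact_mod_cast y.nonempty.card_pos
  have hlt : ∀ i < X.len, X.start l i < X.start l (i + 1) := fun i hi => by
    have := X.start_succ_sub l ⟨i, hi⟩
    have h2 := div_pos (hl.1 ⟨i, hi⟩) hp
    simp only at this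
    linarith
  have mono : ∀ {i j : ℕ}, i < j → j ≤ X.len → X.start l i < X.start l j := lt_of_steps hlt
  have h1 : X.start l X.len = 1 := X.start_len hl' y.nonempty
  have hIco : ∀ i : Fin X.len, X.start l i ∈ Ico (0 : ℝ) (0 + 1) := fun i =>
    ⟨X.start_zero l ▸ le_of_steps (fun i hi => (hlt i hi).le) (Nat.zero_le _) i.2.le,
      by rw [zero_add, ← h1]; exact mono i.2 le_rfl⟩
  have hinj : Function.Injective fun i : Fin X.len => ((X.start l i : ℝ) : Circ) := by
    intro i j hij
    have := (AddCircle.coe_eq_coe_iff_of_mem_Ico (hIco i) (hIco j)).1 hij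
    by_contra hne
    rcases lt_or_gt_of_ne hne with h | h
    · exact (mono h j.2.le).ne this
    · exact (mono h i.2.le).ne' this
  have hsub : range (fun i : Fin X.len => ((X.start l i : ℝ) : Circ)) ⊆ y.doublePoints := by
    rintro _ ⟨i, rfl⟩
    have hmem : ∀ (i : Fin X.len) (t : ℝ), t ∈ Icc (X.start l i) (X.start l (i + 1)) →
        (t : Circ) ∈ y.lobe ⟨X.letter i, X.letter_mem i⟩ := fun i t ht => by
      rw [hy]
      exact mem_iUnion₂.2 ⟨i, ⟨rfl, hl.1 i⟩, t, ht, rfl⟩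
    have hm1 := hmem i (X.start l i) ⟨le_rfl, (hlt i i.2).le⟩
    rcases Nat.eq_zero_or_pos (i : ℕ) with h0 | hpos
    · let j : Fin X.len := ⟨X.len - 1, by omega⟩
      have hj : (j : ℕ) + 1 = X.len := by simp only [j]; omega
      have h := hmem j (X.start l (j + 1)) ⟨(hlt j j.2).le, le_rfl⟩
      refine ⟨⟨X.letter j, X.letter_mem j⟩, ⟨X.letter i, X.letter_mem i⟩, fun h => X.adjacent_ne j i ?_ (Subtype.ext_iff.1 h), ?_, hm1⟩
      · rw [hj, Nat.mod_self, h0]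
      · rw [hj, h1] at h
        simp only [h0, X.start_zero, AddCircle.coe_zero]
        rwa [AddCircle.coe_period] at h
    · let j : Fin X.len := ⟨i - 1, by omega⟩
      have hj : (j : ℕ) + 1 = i := by simp only [j]; omega
      have h := hmem j (X.start l (j + 1)) ⟨(hlt j j.2).le, le_rfl⟩
      rw [hj] at h
      refine ⟨⟨X.letter j, X.letter_mem j⟩, ⟨X.letter i, X.letter_mem i⟩, fun h => X.adjacent_ne j i ?_ (Subtype.ext_iff.1 h),
        h, hm1⟩
      rw [hj, Nat.mod_eq_of_lt i.2]
  have hfin : y.doublePoints.Finite :=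
    ((Finset.finite_toSet _).image _).subset (doublePoints_subset hl' hy)
  have := ncard_le_ncard hsub hfin
  rwa [← image_univ, ncard_image_of_injective _ hinj, ncard_univ, Nat.card_fin] at this

end CyclicWord

end NestedCacti

namespace NestedCacti

/-! ### Combinatorics of nested trees -/

namespace NestedTree

variable {n : ℕ} {T : NestedTree n} {S V W B B' : Finset (Fin n)}

theorem mem_inEdges : B ∈ T.inEdges S ↔
    (B ∈ T.verts ∨ B.card = 1) ∧ B ⊂ S ∧ ∀ B' ∈ T.verts, B ⊂ B' → ¬ B' ⊂ S := by
  simp [inEdges]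

theorem nonempty_of_mem_verts (h : S ∈ T.verts) : S.Nonempty :=
  Finset.card_pos.1 (by have := T.two_le_card S h; omega)

theorem nonempty_of_mem_inEdges (h : B ∈ T.inEdges S) : B.Nonempty := by
  rcases (mem_inEdges.1 h).1 with h | h
  · exact nonempty_of_mem_verts h
  · exact Finset.card_pos.1 (by omega)

theorem mem_verts_of_ssubset (hB : B ∈ T.inEdges S) (h : B' ∈ T.verts ∨ B'.card = 1)
    (hlt : B ⊂ B') : B' ∈ T.verts := by
  refine h.resolve_right fun h1 => ?_
  have := Finset.card_lt_card hlt
  have := (nonempty_of_mem_inEdges hB).card_pos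
  omega

theorem disjoint_of_mem_inEdges (hB : B ∈ T.inEdges S) (hB' : B' ∈ T.inEdges S) (hne : B ≠ B') :
    Disjoint B B' := by
  have h1 := mem_inEdges.1 hB
  have h2 := mem_inEdges.1 hB'
  have hlam : Disjoint B B' ∨ B ⊆ B' ∨ B' ⊆ B := by
    rcases h1.1 with hv | hc
    · rcases h2.1 with hv' | hc'
      · exact T.laminar B hv B' hv'
      · obtain ⟨i, rfl⟩ := Finset.card_eq_one.1 hc'
        by_cases hi : i ∈ B
        · exact Or.inr (Or.inr (Finset.singleton_subset_iff.2 hi))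
        · exact Or.inl (Finset.disjoint_singleton_right.2 hi)
    · obtain ⟨i, rfl⟩ := Finset.card_eq_one.1 hc
      by_cases hi : i ∈ B'
      · exact Or.inr (Or.inl (Finset.singleton_subset_iff.2 hi))
      · exact Or.inl (Finset.disjoint_singleton_left.2 hi)
  rcases hlam with h | h | h
  · exact h
  · have hlt := Finset.ssubset_iff_subset_ne.2 ⟨h, hne⟩
    exact absurd h2.2.1 (h1.2.2 B' (mem_verts_of_ssubset hB h2.1 hlt) hlt)
  · have hlt := Finset.ssubset_iff_subset_ne.2 ⟨h, hne.symm⟩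
    exact absurd h1.2.1 (h2.2.2 B (mem_verts_of_ssubset hB' h1.1 hlt) hlt)

theorem exists_mem_inEdges (hS : S ∈ T.verts) {i : Fin n} (hi : i ∈ S) : ∃ B ∈ T.inEdges S, i ∈ B := by
  classical
  let F : Finset (Finset (Fin n)) :=
    Finset.univ.filter fun B => (B ∈ T.verts ∨ B.card = 1) ∧ B ⊂ S ∧ i ∈ B
  have hF : F.Nonempty := ⟨{i}, by
    simp only [F, Finset.mem_filter, Finset.mem_univ, true_and, Finset.card_singleton, or_true,
      Finset.mem_singleton, and_true]
    refine Finset.ssubset_iff_subset_ne.2 ⟨Finset.singleton_subset_iff.2 hi, ?_⟩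
    rintro rfl
    have := T.two_le_card _ hS
    simp at this⟩
  obtain ⟨B, hB, hmax⟩ := F.exists_max_image Finset.card hF
  simp only [F, Finset.mem_filter, Finset.mem_univ, true_and] at hB hmax
  refine ⟨B, mem_inEdges.2 ⟨hB.1, hB.2.1, fun B' hB' h1 h2 => ?_⟩, hB.2.2⟩
  exact absurd (hmax B' ⟨Or.inl hB', h2, h1.1 hB.2.2⟩) (not_le.2 (Finset.card_lt_card h1))

theorem two_le_card_inEdges (hS : S ∈ T.verts) : 2 ≤ (T.inEdges S).card := by
  obtain ⟨i, hi⟩ := nonempty_of_mem_verts hS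
  obtain ⟨B, hB, -⟩ := exists_mem_inEdges hS hi
  obtain ⟨j, hj, hjB⟩ := Finset.exists_of_ssubset (ssubset_of_mem_inEdges hB)
  obtain ⟨B', hB', hjB'⟩ := exists_mem_inEdges hS hj
  exact Finset.one_lt_card.2 ⟨B, hB, B', hB', fun h => hjB (h ▸ hjB')⟩

theorem inEdges_nonempty (hS : S ∈ T.verts) : (T.inEdges S).Nonempty :=
  Finset.card_pos.1 (by have := two_le_card_inEdges hS; omega)

theorem exists_parent (hV : V ∈ T.verts) (hne : V ≠ Finset.univ) :
    ∃ W ∈ T.verts, V ∈ T.inEdges W := by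
  classical
  let F : Finset (Finset (Fin n)) := T.verts.filter fun W => V ⊂ W
  have hF : F.Nonempty := ⟨Finset.univ, Finset.mem_filter.2 ⟨T.root_mem,
    Finset.ssubset_univ_iff.2 hne⟩⟩
  obtain ⟨W, hW, hmin⟩ := F.exists_min_image Finset.card hF
  obtain ⟨hW1, hW2⟩ := Finset.mem_filter.1 hW
  refine ⟨W, hW1, mem_inEdges.2 ⟨Or.inl hV, hW2, fun B' hB' h1 h2 => ?_⟩⟩
  exact absurd (hmin B' (Finset.mem_filter.2 ⟨hB', h1⟩)) (not_le.2 (Finset.card_lt_card h2))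

theorem subset_total (hS : S ∈ T.verts) (hW : W ∈ T.verts) (hB : B.Nonempty) (h1 : B ⊆ S)
    (h2 : B ⊆ W) : S ⊆ W ∨ W ⊆ S := by
  refine (T.laminar S hS W hW).resolve_left fun h => ?_
  obtain ⟨i, hi⟩ := hB
  exact Finset.disjoint_left.1 h (h1 hi) (h2 hi)

theorem parent_unique (hS : S ∈ T.verts) (hW : W ∈ T.verts) (h1 : B ∈ T.inEdges S)
    (h2 : B ∈ T.inEdges W) : S = W := by
  have l1 := mem_inEdges.1 h1
  have l2 := mem_inEdges.1 h2
  by_contra hne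
  rcases subset_total hS hW (nonempty_of_mem_inEdges h1) l1.2.1.1 l2.2.1.1 with h | h
  · exact l2.2.2 S hS l1.2.1 (Finset.ssubset_iff_subset_ne.2 ⟨h, hne⟩)
  · exact l1.2.2 W hW l2.2.1 (Finset.ssubset_iff_subset_ne.2 ⟨h, Ne.symm hne⟩)

/-- Removal of a vertex different from the root. -/
@[simps]
def eraseVert (T : NestedTree n) (V : Finset (Fin n)) (hV : V ≠ Finset.univ) : NestedTree n where
  verts := T.verts.erase V
  two_le_card S hS := T.two_le_card S (Finset.mem_of_mem_erase hS)
  root_mem := Finset.mem_erase.2 ⟨hV.symm, T.root_mem⟩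
  laminar S hS S' hS' := T.laminar S (Finset.mem_of_mem_erase hS) S' (Finset.mem_of_mem_erase hS')

theorem inEdges_eraseVert_of_notMem (hV : V ∈ T.verts) (hVu : V ≠ Finset.univ) (hS : S ∈ T.verts)
    (hne : S ≠ V) (h : V ∉ T.inEdges S) : (T.eraseVert V hVu).inEdges S = T.inEdges S := by
  ext B
  simp only [mem_inEdges, eraseVert_verts, Finset.mem_erase]
  constructor
  · rintro ⟨h1, h2, h3⟩
    refine ⟨h1.imp_left And.right, h2, fun B' hB' h4 h5 => ?_⟩
    by_cases hB'V : B' = V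
    · subst hB'V
      -- If the removed vertex was the obstruction between `B` and `S`, its parent is one too: it
      -- lies strictly inside `S` because `V` is not a child of `S`.
      obtain ⟨W, hW, hVW⟩ := exists_parent hV hVu
      have l := mem_inEdges.1 hVW
      have hWS : W ⊂ S := by
        refine Finset.ssubset_iff_subset_ne.2 ⟨?_, fun h' => h (h' ▸ hVW)⟩
        rcases subset_total hS hW (nonempty_of_mem_verts hV) h5.1 l.2.1.1 with h' | h'
        · by_cases hSW : S = W
          · exact hSW ▸ le_rfl
          · exact absurd (Finset.ssubset_iff_subset_ne.2 ⟨h', hSW⟩) (l.2.2 S hS h5)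
        · exact h'
      exact h3 W ⟨l.2.1.ne', hW⟩ (h4.trans l.2.1) hWS
    · exact h3 B' ⟨hB'V, hB'⟩ h4 h5
  · rintro ⟨h1, h2, h3⟩
    refine ⟨?_, h2, fun B' hB' => h3 B' hB'.2⟩
    by_cases hBV : B = V
    · exact absurd (mem_inEdges.2 ⟨Or.inl hV, hBV ▸ h2, hBV ▸ h3⟩) h
    · exact h1.imp_left fun h1 => ⟨hBV, h1⟩

theorem inEdges_eraseVert_parent (hV : V ∈ T.verts) (hVu : V ≠ Finset.univ)
    (h : V ∈ T.inEdges W) :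
    (T.eraseVert V hVu).inEdges W = (T.inEdges W).erase V ∪ T.inEdges V := by
  have l := mem_inEdges.1 h
  ext B
  rw [Finset.mem_union, Finset.mem_erase]
  constructor
  · intro hB
    have hB' := mem_inEdges.1 hB
    simp only [eraseVert_verts, Finset.mem_erase] at hB'
    obtain ⟨h1, h2, h3⟩ := hB'
    have hBV : B ≠ V := by
      rintro rfl
      rcases h1 with h1 | h1
      · exact h1.1 rfl
      · have := T.two_le_card _ hV
        omega
    by_cases hlt : B ⊂ V
    · exact Or.inr (mem_inEdges.2 ⟨h1.imp_left And.right, hlt, fun B' hB' h4 h5 =>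
        h3 B' ⟨h5.ne, hB'⟩ h4 (h5.trans l.2.1)⟩)
    · refine Or.inl ⟨hBV, mem_inEdges.2 ⟨h1.imp_left And.right, h2, fun B' hB' h4 h5 => ?_⟩⟩
      exact h3 B' ⟨fun h' => hlt (h' ▸ h4), hB'⟩ h4 h5
  · rintro (⟨hBV, hB⟩ | hB)
    · have hB' := mem_inEdges.1 hB
      refine mem_inEdges.2 ⟨hB'.1.imp_left fun h => Finset.mem_erase.2 ⟨hBV, h⟩, hB'.2.1,
        fun C hC => hB'.2.2 C (Finset.mem_of_mem_erase hC)⟩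
    · have hB' := mem_inEdges.1 hB
      refine mem_inEdges.2 ⟨hB'.1.imp_left fun h => Finset.mem_erase.2 ⟨hB'.2.1.ne, h⟩,
        hB'.2.1.trans l.2.1, fun C hC h4 h5 => ?_⟩
      obtain ⟨hCV, hC⟩ := Finset.mem_erase.1 hC
      rcases subset_total hC hV (nonempty_of_mem_inEdges hB) h4.1 hB'.2.1.1 with h' | h'
      · exact hB'.2.2 C hC h4 (Finset.ssubset_iff_subset_ne.2 ⟨h', hCV⟩)
      · exact l.2.2 C hC (Finset.ssubset_iff_subset_ne.2 ⟨h', Ne.symm hCV⟩) h5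

theorem disjoint_inEdges_erase (h : V ∈ T.inEdges W) :
    Disjoint ((T.inEdges W).erase V) (T.inEdges V) := by
  refine Finset.disjoint_left.2 fun B hB hB' => ?_
  obtain ⟨hBV, hB⟩ := Finset.mem_erase.1 hB
  obtain ⟨i, hi⟩ := nonempty_of_mem_inEdges hB
  exact Finset.disjoint_left.1 (disjoint_of_mem_inEdges hB h hBV) hi
    ((ssubset_of_mem_inEdges hB').1 hi)

end NestedTree

/-! ### Weighted parameters and compositions -/

section Weighted

variable {A : Type} {P : Finset A} {c : ℝ → A → ℝ} {m : A → ℝ}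

/-- The parameter of the composite of cacti for which the lobe `B` is dilated by the factor
`m B`. -/
def weightedParam (P : Finset A) (m : A → ℝ) (c : ℝ → A → ℝ) (t : ℝ) : ℝ :=
  (∑ B ∈ P, m B * c t B) / ∑ B ∈ P, m B

theorem weightedParam_strictMono (hc : IsCactusMap P c) (hP : P.Nonempty) (hm : ∀ B ∈ P, 0 < m B) :
    StrictMono (weightedParam P m c) := by
  intro s t hst
  have hM : 0 < ∑ B ∈ P, m B := Finset.sum_pos hm hP
  unfold weightedParam
  rw [div_lt_div_iff_of_pos_right hM]
  refine Finset.sum_lt_sum (fun B hB => mul_le_mul_of_nonneg_left (hc.mono B hst.le) (hm B hB).le) ?_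
  by_contra hno
  push Not at hno
  refine hst.ne (hc.eq_of_forall hP fun B hB => le_antisymm (hc.mono B hst.le) ?_)
  exact le_of_mul_le_mul_left (hno B hB) (hm B hB)

theorem weightedParam_continuous (hc : IsCactusMap P c) : Continuous (weightedParam P m c) := by
  have := hc.cont
  unfold weightedParam
  fun_prop

theorem weightedParam_add_one (hc : IsCactusMap P c) (hP : P.Nonempty) (hm : ∀ B ∈ P, 0 < m B)
    (t : ℝ) : weightedParam P m c (t + 1) = weightedParam P m c t + 1 := by
  have hM : 0 < ∑ B ∈ P, m B := Finset.sum_pos hm hP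
  unfold weightedParam
  rw [Finset.sum_congr rfl fun B hB => by rw [hc.add_one B hB, mul_add, mul_one],
    Finset.sum_add_distrib]
  field_simp

theorem weightedParam_zero (hc : IsCactusMap P c) : weightedParam P m c 0 = 0 := by
  simp [weightedParam, hc.zero]

theorem weightedParam_surjective (hc : IsCactusMap P c) (hP : P.Nonempty)
    (hm : ∀ B ∈ P, 0 < m B) : Function.Surjective (weightedParam P m c) :=
  surjective_of_add_one (weightedParam_continuous hc) (weightedParam_add_one hc hP hm)

theorem IsCactusMap.sum_univ [Fintype A] (hc : IsCactusMap P c) (t : ℝ) :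
    ∑ B, c t B = P.card * t := by
  rw [← hc.sum]
  exact (Finset.sum_subset (Finset.subset_univ P) fun B _ hB => hc.eq_zero hB t).symm

/-- The composite of cactus maps is a cactus map. -/
theorem IsCactusMap.compose [DecidableEq A] [Fintype A] (hc : IsCactusMap P c) (hP : P.Nonempty)
    {f : A → ℝ → A → ℝ} {Q : A → Finset A} (hf : ∀ B ∈ P, IsCactusMap (Q B) (f B))
    (hQ0 : ∀ B ∈ P, (Q B).Nonempty)
    (hQ : ∀ B ∈ P, ∀ B' ∈ P, B ≠ B' → Disjoint (Q B) (Q B')) {g : ℝ → A → ℝ}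
    (hg : ∀ t C, g (weightedParam P (fun B => ∑ C, f B 1 C) c t) C = ∑ B ∈ P, f B (c t B) C) :
    IsCactusMap (P.biUnion Q) g := by
  have hfam := hc.toIsLoopFamily.compose (fun B hB => (hf B hB).toIsLoopFamily) hQ
  have hU : (P.biUnion Q).Nonempty := by
    obtain ⟨B, hB⟩ := hP
    obtain ⟨C, hC⟩ := hQ0 B hB
    exact ⟨C, Finset.mem_biUnion.2 ⟨B, hB, hC⟩⟩
  obtain ⟨c', hc', e⟩ := hfam.exists_isCactusMap hU
  have hm : ∀ B ∈ P, ∑ C, f B 1 C = (Q B).card := fun B hB => by rw [(hf B hB).sum_univ, mul_one]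
  have hm0 : ∀ B ∈ P, 0 < ∑ C, f B 1 C := fun B hB => by
    rw [hm B hB]
    exact_mod_cast (hQ0 B hB).card_pos
  have h0 : ∀ C, ∑ B ∈ P, f B (c 0 B) C = 0 := fun C => Finset.sum_eq_zero fun B hB => by
    rw [hc.zero, (hf B hB).zero]
  -- The inserted cactus with `m` lobes contributes a total slope `m`, so normalizing the composite
  -- family gives exactly the parameter used in `composeMap`.
  have hparam : ∀ t, loopParam (P.biUnion Q) (fun t C => ∑ B ∈ P, f B (c t B) C) t =
      weightedParam P (fun B => ∑ C, f B 1 C) c t := by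
    intro t
    simp only [loopParam, weightedParam, h0, sub_zero]
    rw [Finset.sum_comm, Finset.card_biUnion hQ]
    push_cast
    congr 1
    · refine Finset.sum_congr rfl fun B hB => ?_
      rw [hm B hB, ← (hf B hB).sum]
      refine (Finset.sum_subset (Finset.subset_biUnion_of_mem Q hB) fun C _ hC => ?_).symm
      rw [(hf B hB).eq_zero hC]
    · exact Finset.sum_congr rfl fun B hB => (hm B hB).symm
  have : g = c' := by
    funext u C
    obtain ⟨t, rfl⟩ := weightedParam_surjective hc hP hm0 u
    rw [hg, ← hparam, e, h0, sub_zero]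
  exact this ▸ hc'

/-- The `Function.invFun` in the definition is a genuine left inverse as soon as the weighted
parameter is injective. -/
theorem composeMap_apply [Fintype A] [DecidableEq A] {c : ℝ → P → ℝ} {f : P → ℝ → A → ℝ}
    (hinj : Function.Injective fun t => (∑ B, (∑ C, f B 1 C) * c t B) / ∑ B, ∑ C, f B 1 C)
    (t : ℝ) (C : A) :
    composeMap c f ((∑ B, (∑ C, f B 1 C) * c t B) / ∑ B, ∑ C, f B 1 C) C =
      ∑ B, f B (c t B) C := by
  have h := Function.leftInverse_invFun hinj t
  simp only [composeMap, h]

end Weighted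

/-! ### Composites along subtrees -/

namespace Stratum

variable {n : ℕ} {T : NestedTree n} (σ : Sections n)

/-- The cactus map of the based cactus assigned by the sections to the vertex `S`. -/
def secMap (p : Stratum T) (S : Finset (Fin n)) : ℝ → Finset (Fin n) → ℝ :=
  if h : S ∈ T.verts then (σ.sec _ (p.1 ⟨S, h⟩)).map else 0

/-- The map inserted into the lobe `B`. -/
def input (p : Stratum T) (B : Finset (Fin n)) : ℝ → Finset (Fin n) → ℝ :=
  if p.coord B = 0 then unitMap B
  else rotMap (Complex.arg (p.coord B) / (2 * Real.pi)) (p.gamma σ B)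

/-- The number of lobes of the map inserted into the lobe `B`. -/
def mass (p : Stratum T) (B : Finset (Fin n)) : ℝ := ∑ C, p.input σ B 1 C

variable {σ} {p : Stratum T} {S B : Finset (Fin n)}

theorem mem_verts_of_coord_ne_zero (h : p.coord S ≠ 0) : S ∈ T.verts ∧ S ≠ Finset.univ := by
  by_contra hS
  exact h (dif_neg hS)

theorem isCactusMap_secMap (hS : S ∈ T.verts) : IsCactusMap (T.inEdges S) (p.secMap σ S) := by
  rw [secMap, dif_pos hS]
  exact Cactus.isCactusMap _

theorem gamma_apply_of_mass_pos (hS : S ∈ T.verts) (hm : ∀ B ∈ T.inEdges S, 0 < p.mass σ B) (t : ℝ)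
    (C : Finset (Fin n)) :
    p.gamma σ S (weightedParam (T.inEdges S) (p.mass σ) (p.secMap σ S) t) C =
      ∑ B ∈ T.inEdges S, p.input σ B (p.secMap σ S t B) C := by
  have hsec : ∀ t (B : T.inEdges S), (σ.sec _ (p.1 ⟨S, hS⟩)).cactusMap t B = p.secMap σ S t B := by
    intro t B
    rw [secMap, dif_pos hS, Cactus.map_coe]
  have hg : p.gamma σ S = composeMap (σ.sec _ (p.1 ⟨S, hS⟩)).cactusMap
      (fun B => p.input σ B.1) := by
    rw [gamma, dif_pos hS]
    rfl
  have hw : ∀ t, (∑ B : T.inEdges S, (∑ C, p.input σ B.1 1 C) *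
      (σ.sec _ (p.1 ⟨S, hS⟩)).cactusMap t B) / ∑ B : T.inEdges S, ∑ C, p.input σ B.1 1 C =
      weightedParam (T.inEdges S) (p.mass σ) (p.secMap σ S) t := by
    intro t
    simp only [hsec, weightedParam, mass]
    rw [Finset.sum_coe_sort (T.inEdges S) fun B => (∑ C, p.input σ B 1 C) * p.secMap σ S t B,
      Finset.sum_coe_sort (T.inEdges S) fun B => ∑ C, p.input σ B 1 C]
  have := composeMap_apply (c := (σ.sec _ (p.1 ⟨S, hS⟩)).cactusMap) (f := fun B => p.input σ B.1)
    (by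
      simp only [hw]
      exact (weightedParam_strictMono (isCactusMap_secMap hS) (NestedTree.inEdges_nonempty hS)
        hm).injective) t C
  rw [hw, ← hg] at this
  rw [this]
  simp only [hsec]
  exact Finset.sum_coe_sort (T.inEdges S) fun B => p.input σ B (p.secMap σ S t B) C

variable (σ p) in
-- Induction along the tree. All labels of a composite at `S` are non-empty subsets of `S`, so the
-- composites inserted at different edges have disjoint label sets and `IsCactusMap.compose`
-- applies. Positivity of the masses comes out of the same induction, which is why
-- `gamma_apply_of_mass_pos` takes it as a hypothesis.
theorem exists_isCactusMap_gamma (hS : S ∈ T.verts) :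
    (∃ Q : Finset (Finset (Fin n)), Q.Nonempty ∧ (∀ C ∈ Q, C.Nonempty ∧ C ⊆ S) ∧
      IsCactusMap Q (p.gamma σ S)) ∧
    ∀ B ∈ T.inEdges S, ∃ Q : Finset (Finset (Fin n)), Q.Nonempty ∧
      (∀ C ∈ Q, C.Nonempty ∧ C ⊆ B) ∧ IsCactusMap Q (p.input σ B) := by
  induction hk : S.card using Nat.strong_induction_on generalizing S with
  | _ k ih =>
    subst hk
    have hin : ∀ B ∈ T.inEdges S, ∃ Q : Finset (Finset (Fin n)), Q.Nonempty ∧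
        (∀ C ∈ Q, C.Nonempty ∧ C ⊆ B) ∧ IsCactusMap Q (p.input σ B) := by
      intro B hB
      by_cases h0 : p.coord B = 0
      · refine ⟨{B}, by simp, ?_, ?_⟩
        · simp [NestedTree.nonempty_of_mem_inEdges hB]
        · rw [input, if_pos h0]
          exact isCactusMap_unitMap B
      · obtain ⟨⟨Q, h1, h2, h3⟩, -⟩ := ih B.card
          (Finset.card_lt_card (NestedTree.ssubset_of_mem_inEdges hB))
          (mem_verts_of_coord_ne_zero h0).1 rfl
        refine ⟨Q, h1, h2, ?_⟩
        rw [input, if_neg h0]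
        exact h3.rotMap _
    refine ⟨?_, hin⟩
    choose! Q hQ0 hQ1 hQ2 using hin
    have hm : ∀ B ∈ T.inEdges S, 0 < p.mass σ B := fun B hB => by
      rw [mass, (hQ2 B hB).sum_univ, mul_one]
      exact_mod_cast (hQ0 B hB).card_pos
    refine ⟨(T.inEdges S).biUnion Q, ?_, fun C hC => ?_, ?_⟩
    · obtain ⟨B, hB⟩ := NestedTree.inEdges_nonempty hS
      obtain ⟨C, hC⟩ := hQ0 B hB
      exact ⟨C, Finset.mem_biUnion.2 ⟨B, hB, hC⟩⟩
    · obtain ⟨B, hB, hC⟩ := Finset.mem_biUnion.1 hC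
      exact ⟨(hQ1 B hB C hC).1,
        (hQ1 B hB C hC).2.trans (NestedTree.ssubset_of_mem_inEdges hB).1⟩
    · refine (isCactusMap_secMap hS).compose (NestedTree.inEdges_nonempty hS) hQ2 hQ0
        (fun B hB B' hB' hne => Finset.disjoint_left.2 fun C hC hC' => ?_)
        (gamma_apply_of_mass_pos hS hm)
      obtain ⟨i, hi⟩ := (hQ1 B hB C hC).1
      exact Finset.disjoint_left.1 (NestedTree.disjoint_of_mem_inEdges hB hB' hne)
        ((hQ1 B hB C hC).2 hi) ((hQ1 B' hB' C hC').2 hi)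

theorem mass_pos (hS : S ∈ T.verts) (hB : B ∈ T.inEdges S) : 0 < p.mass σ B := by
  obtain ⟨Q, h1, -, h3⟩ := (exists_isCactusMap_gamma σ p hS).2 B hB
  rw [mass, h3.sum_univ, mul_one]
  exact_mod_cast h1.card_pos

theorem gamma_apply (hS : S ∈ T.verts) (t : ℝ) (C : Finset (Fin n)) :
    p.gamma σ S (weightedParam (T.inEdges S) (p.mass σ) (p.secMap σ S) t) C =
      ∑ B ∈ T.inEdges S, p.input σ B (p.secMap σ S t B) C :=
  gamma_apply_of_mass_pos hS (fun _ hB => mass_pos hS hB) t C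

theorem weightedParam_secMap_surjective (hS : S ∈ T.verts) :
    Function.Surjective (weightedParam (T.inEdges S) (p.mass σ) (p.secMap σ S)) :=
  weightedParam_surjective (isCactusMap_secMap hS) (NestedTree.inEdges_nonempty hS)
    fun _ hB => mass_pos hS hB

theorem gamma_congr {T' : NestedTree n} {q : Stratum T'} (hS : S ∈ T.verts) (hS' : S ∈ T'.verts)
    (hE : T.inEdges S = T'.inEdges S) (hsec : p.secMap σ S = q.secMap σ S)
    (hin : ∀ B ∈ T.inEdges S, p.input σ B = q.input σ B) : p.gamma σ S = q.gamma σ S := by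
  funext u C
  obtain ⟨t, rfl⟩ := weightedParam_secMap_surjective (p := p) (σ := σ) hS u
  have : weightedParam (T.inEdges S) (p.mass σ) (p.secMap σ S) t =
      weightedParam (T'.inEdges S) (q.mass σ) (q.secMap σ S) t := by
    rw [weightedParam, weightedParam, hE, hsec]
    congr 1 <;> refine Finset.sum_congr rfl fun B hB => ?_ <;> rw [mass, mass, hin B (hE ▸ hB)]
  rw [gamma_apply hS, this, gamma_apply hS', hE, hsec]
  exact Finset.sum_congr rfl fun B hB => by rw [hin B (hE ▸ hB)]

theorem secMap_congr {T' : NestedTree n} {q : Stratum T'} (hS : S ∈ T.verts) (hS' : S ∈ T'.verts)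
    (hE : T.inEdges S = T'.inEdges S) (h : HEq (p.1 ⟨S, hS⟩) (q.1 ⟨S, hS'⟩)) :
    p.secMap σ S = q.secMap σ S := by
  rw [secMap, secMap, dif_pos hS, dif_pos hS']
  generalize p.1 ⟨S, hS⟩ = x at h
  generalize q.1 ⟨S, hS'⟩ = y at h
  revert x y
  simp only
  rw [hE]
  intro x y h
  rw [eq_of_heq h]

end Stratum

end NestedCacti

namespace NestedCacti

/-! ### Rotations by points of the unit circle -/

/-- The point of the unit circle with angular parameter `x`. -/
def cis (x : ℝ) : ℂ := Complex.exp ((2 * Real.pi * x : ℝ) * Complex.I)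

theorem norm_cis (x : ℝ) : ‖cis x‖ = 1 := Complex.norm_exp_ofReal_mul_I _

theorem cis_ne_zero (x : ℝ) : cis x ≠ 0 := Complex.exp_ne_zero _

theorem cis_zero : cis 0 = 1 := by simp [cis]

theorem cis_add (x y : ℝ) : cis (x + y) = cis x * cis y := by
  rw [cis, cis, cis, ← Complex.exp_add]
  congr 1
  push_cast
  ring

theorem eq_norm_mul_cis (z : ℂ) : z = ‖z‖ * cis (Complex.arg z / (2 * Real.pi)) := by
  have : (2 * Real.pi * (Complex.arg z / (2 * Real.pi)) : ℝ) = Complex.arg z := by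
    field_simp
  rw [cis, this, Complex.norm_mul_exp_arg_mul_I]

/-- Arguments add only up to full turns. The integer `k` is harmless, since `rotMap` ignores integer
shifts of cactus maps. -/
theorem exists_arg_mul_cis {z : ℂ} (hz : z ≠ 0) (x : ℝ) : ∃ k : ℤ,
    Complex.arg (z * cis x) / (2 * Real.pi) = Complex.arg z / (2 * Real.pi) + x + k := by
  have h : ((Complex.arg (z * cis x) : ℝ) : Real.Angle) =
      ((Complex.arg z + 2 * Real.pi * x : ℝ) : Real.Angle) := by
    rw [Complex.arg_mul_coe_angle hz (cis_ne_zero x), Real.Angle.coe_add]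
    congr 1
    rw [cis, Complex.arg_exp_mul_I, Real.Angle.coe_toIocMod]
  obtain ⟨k, hk⟩ := Real.Angle.angle_eq_iff_two_pi_dvd_sub.1 h
  refine ⟨k, ?_⟩
  have hpi := Real.pi_pos
  field_simp
  linarith

theorem rotMap_arg_mul_cis {A : Type} {Q : Finset A} {g : ℝ → A → ℝ} (hg : IsCactusMap Q g) {z : ℂ}
    (hz : z ≠ 0) (x : ℝ) : rotMap (Complex.arg (z * cis x) / (2 * Real.pi)) g =
      rotMap (Complex.arg z / (2 * Real.pi) + x) g := by
  obtain ⟨k, hk⟩ := exists_arg_mul_cis hz x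
  rw [hk, rotMap_add_intCast hg]

theorem rotMap_arg_cis {A : Type} {Q : Finset A} {g : ℝ → A → ℝ} (hg : IsCactusMap Q g) (x : ℝ) :
    rotMap (Complex.arg (cis x) / (2 * Real.pi)) g = rotMap x g := by
  have := rotMap_arg_mul_cis hg one_ne_zero x
  simpa using this

theorem rotMap_unitMap {A : Type} [DecidableEq A] (x : ℝ) (B : A) :
    rotMap x (unitMap B) = unitMap B := by
  funext t C
  simp only [rotMap, unitMap]
  split_ifs <;> ring

/-! ### Contraction of an edge -/

/-- The cactus map `w` is obtained, up to rescaling, by inserting the cactus with map `cV` into the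
lobe `V` of the cactus with map `cW`. Here `E` is the set of the other lobes of the latter, `PV` is
the set of lobes of the former, these have weights `m`, and base points are shifted by `k` and
`β`. -/
def IsMerge {A : Type} (E PV : Finset A) (V : A) (m k : A → ℝ) (β : ℝ) (cW cV w : ℝ → A → ℝ) :
    Prop :=
  ∃ φW φV : ℝ → ℝ, (∀ u, ∀ B ∈ E, cW (φW u) B = w u B + k B) ∧
    (∀ u, ∀ B ∈ PV, cV (φV u) B = w u B + k B) ∧
    ∀ u, (∑ B ∈ PV, m B) * (cW (φW u) V + β) = ∑ B ∈ PV, m B * (w u B + k B)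

namespace Stratum

variable {n : ℕ} {T T' : NestedTree n} {σ : Sections n} {p : Stratum T}
  {S V W B : Finset (Fin n)}

theorem exists_isCactusMap_gamma_of_coord (h : p.coord B ≠ 0) : ∃ Q, IsCactusMap Q (p.gamma σ B) :=
  let ⟨Q, _, _, h⟩ := (exists_isCactusMap_gamma σ p (mem_verts_of_coord_ne_zero h).1).1
  ⟨Q, h⟩

theorem exists_isCactusMap_input (p : Stratum T) (B : Finset (Fin n)) :
    ∃ Q, IsCactusMap Q (p.input σ B) := by
  by_cases h : p.coord B = 0
  · exact ⟨{B}, by rw [input, if_pos h]; exact isCactusMap_unitMap B⟩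
  · obtain ⟨Q, hQ⟩ := exists_isCactusMap_gamma_of_coord (σ := σ) h
    exact ⟨Q, by rw [input, if_neg h]; exact hQ.rotMap _⟩

/-- A rotation of the disc coordinate and a rotation of the composite below it have additive effects
on what is inserted. They can thus compensate each other. -/
theorem input_eq_rotMap {q : Stratum T'} {x y : ℝ} (hc : q.coord B = p.coord B * cis x)
    (hγ : p.coord B ≠ 0 → q.gamma σ B = rotMap y (p.gamma σ B)) :
    q.input σ B = rotMap (x + y) (p.input σ B) := by
  by_cases h : p.coord B = 0
  · rw [input, input, if_pos h, if_pos (by rw [hc, h, zero_mul]), rotMap_unitMap]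
  · obtain ⟨Q, hQ⟩ := exists_isCactusMap_gamma_of_coord (σ := σ) h
    rw [input, input, if_neg h, if_neg (by rw [hc]; exact mul_ne_zero h (cis_ne_zero x)), hγ h, hc,
      rotMap_arg_mul_cis (hQ.rotMap y) h, rotMap_rotMap, rotMap_rotMap]
    congr 1
    ring

theorem mass_eq_of_input_eq_rotMap {q : Stratum T'} {x : ℝ}
    (h : q.input σ B = rotMap x (p.input σ B)) : q.mass σ B = p.mass σ B := by
  obtain ⟨Q, hQ⟩ := exists_isCactusMap_input (σ := σ) p B
  rw [mass, mass, h, (hQ.rotMap x).sum_univ, hQ.sum_univ]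

theorem sum_gamma_one (hS : S ∈ T.verts) :
    ∑ C, p.gamma σ S 1 C = ∑ B ∈ T.inEdges S, p.mass σ B := by
  have h1 : weightedParam (T.inEdges S) (p.mass σ) (p.secMap σ S) 1 = 1 := by
    have hc := isCactusMap_secMap (σ := σ) (p := p) hS
    have := weightedParam_add_one hc (NestedTree.inEdges_nonempty hS)
      (fun B hB => mass_pos (σ := σ) (p := p) hS hB) 0
    rwa [weightedParam_zero hc, zero_add] at this
  have h2 := gamma_apply (σ := σ) (p := p) hS 1
  rw [h1] at h2
  simp only [h2]
  rw [Finset.sum_comm]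
  refine Finset.sum_congr rfl fun B hB => ?_
  rw [mass, (isCactusMap_secMap hS).one_apply hB]

theorem mass_eq_sum (h : p.coord B ≠ 0) : p.mass σ B = ∑ C ∈ T.inEdges B, p.mass σ C := by
  obtain ⟨Q, hQ⟩ := exists_isCactusMap_gamma_of_coord (σ := σ) h
  rw [← sum_gamma_one (mem_verts_of_coord_ne_zero h).1, hQ.sum_univ, mass, input, if_neg h,
    (hQ.rotMap _).sum_univ]

/-- The decorations `p` and `q` are related by the contraction of the edge from `V` to `W`. -/
structure Contracts (σ : Sections n) (p : Stratum T) {V : Finset (Fin n)} (hVu : V ≠ Finset.univ)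
    (q : Stratum (T.eraseVert V hVu)) (W : Finset (Fin n)) (k : Finset (Fin n) → ℝ) (β : ℝ) :
    Prop where
  mem : V ∈ T.verts
  parent_mem : W ∈ T.verts
  edge : V ∈ T.inEdges W
  heq : ∀ S (h : S ∈ T.verts) (h' : S ∈ (T.eraseVert V hVu).verts), S ≠ W →
    HEq (p.1 ⟨S, h⟩) (q.1 ⟨S, h'⟩)
  merge : IsMerge ((T.inEdges W).erase V) (T.inEdges V) V (p.mass σ) k β (p.secMap σ W)
    (p.secMap σ V) (q.secMap σ W)
  coord_eq : p.coord V = cis β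
  coord_child : ∀ B ∈ (T.eraseVert V hVu).inEdges W, q.coord B = p.coord B * cis (k B)
  coord_parent : q.coord W = p.coord W * cis (-((∑ B ∈ (T.eraseVert V hVu).inEdges W,
    p.mass σ B * k B - (∑ B ∈ T.inEdges V, p.mass σ B) * β) /
      ∑ B ∈ (T.eraseVert V hVu).inEdges W, p.mass σ B))
  coord_other : ∀ B, B ≠ V → B ≠ W → B ∉ (T.eraseVert V hVu).inEdges W → q.coord B = p.coord B

namespace Contracts

variable {hVu : V ≠ Finset.univ} {q : Stratum (T.eraseVert V hVu)} {k : Finset (Fin n) → ℝ}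
  {β : ℝ}

theorem ne (h : Contracts σ p hVu q W k β) : W ≠ V :=
  (NestedTree.ssubset_of_mem_inEdges h.edge).ne'

theorem parent_mem' (h : Contracts σ p hVu q W k β) : W ∈ (T.eraseVert V hVu).verts :=
  Finset.mem_erase.2 ⟨h.ne, h.parent_mem⟩

/-- The composite at `S` sees the contraction only through the input at `W`. This is used first
below `W`, where the condition is vacuous, and again above `W` once `gamma_parent` is available. -/
theorem gamma_eq (h : Contracts σ p hVu q W k β) (hS : S ∈ T.verts) (hSV : S ≠ V) (hSW : S ≠ W)
    (hin : W ⊆ S → q.input σ W = p.input σ W) : q.gamma σ S = p.gamma σ S := by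
  induction hk : S.card using Nat.strong_induction_on generalizing S with
  | _ N ih =>
    subst hk
    have hS' : S ∈ (T.eraseVert V hVu).verts := Finset.mem_erase.2 ⟨hSV, hS⟩
    have hVS : V ∉ T.inEdges S := fun h' => hSW (NestedTree.parent_unique hS h.parent_mem h' h.edge)
    have hE : T.inEdges S = (T.eraseVert V hVu).inEdges S :=
      (NestedTree.inEdges_eraseVert_of_notMem h.mem hVu hS hSV hVS).symm
    refine (gamma_congr hS hS' hE (secMap_congr hS hS' hE (h.heq S hS hS' hSW)) fun B hB => ?_).symm
    have hBS := NestedTree.ssubset_of_mem_inEdges hB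
    by_cases hBW : B = W
    · subst hBW
      exact (hin hBS.1).symm
    have hBV : B ≠ V := fun h' => hVS (h' ▸ hB)
    have hc : q.coord B = p.coord B * cis 0 := by
      rw [cis_zero, mul_one]
      exact h.coord_other B hBV hBW fun h' =>
        hSW (NestedTree.parent_unique hS' h.parent_mem' (hE ▸ hB) h')
    obtain ⟨Q, hQ⟩ := exists_isCactusMap_input (σ := σ) p B
    rw [input_eq_rotMap (y := 0) hc fun h0 => ?_, add_zero, rotMap_zero hQ]
    obtain ⟨Q, hQ⟩ := exists_isCactusMap_gamma_of_coord (σ := σ) h0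
    rw [rotMap_zero hQ]
    exact ih B.card (Finset.card_lt_card hBS) (mem_verts_of_coord_ne_zero h0).1 hBV hBW
      (fun h' => hin (h'.trans hBS.1)) rfl

theorem input_child (h : Contracts σ p hVu q W k β) (hB : B ∈ (T.eraseVert V hVu).inEdges W) :
    q.input σ B = rotMap (k B) (p.input σ B) := by
  have hBW := NestedTree.ssubset_of_mem_inEdges hB
  have := input_eq_rotMap (σ := σ) (y := 0) (h.coord_child B hB) fun h0 => by
    obtain ⟨Q, hQ⟩ := exists_isCactusMap_gamma_of_coord (σ := σ) h0
    rw [rotMap_zero hQ]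
    refine h.gamma_eq (mem_verts_of_coord_ne_zero h0).1 ?_ hBW.ne fun h' => absurd h' hBW.2
    rintro rfl
    rcases (NestedTree.mem_inEdges.1 hB).1 with h1 | h1
    · simp at h1
    · have := T.two_le_card _ h.mem
      omega
  rwa [add_zero] at this

theorem sum_inEdges (h : Contracts σ p hVu q W k β) (f : Finset (Fin n) → ℝ) :
    ∑ B ∈ (T.eraseVert V hVu).inEdges W, f B =
      ∑ B ∈ (T.inEdges W).erase V, f B + ∑ B ∈ T.inEdges V, f B := by
  rw [NestedTree.inEdges_eraseVert_parent h.mem hVu h.edge,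
    Finset.sum_union (NestedTree.disjoint_inEdges_erase h.edge)]

theorem mem_inEdges_right (h : Contracts σ p hVu q W k β) (hB : B ∈ T.inEdges V) :
    B ∈ (T.eraseVert V hVu).inEdges W := by
  rw [NestedTree.inEdges_eraseVert_parent h.mem hVu h.edge]
  exact Finset.mem_union_right _ hB

theorem coord_ne_zero (h : Contracts σ p hVu q W k β) : p.coord V ≠ 0 :=
  h.coord_eq ▸ cis_ne_zero β

/-- The parameters of the two composites at `W` differ by a constant, which is the rotation in the
statement: the weighted mean of the shifts `k`, corrected by the shift `β` of the contracted edge.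
The field `coord_parent` rotates by the opposite angle, so that nothing changes above `W`. -/
theorem gamma_parent (h : Contracts σ p hVu q W k β) :
    q.gamma σ W = rotMap ((∑ B ∈ (T.eraseVert V hVu).inEdges W,
      p.mass σ B * k B - (∑ B ∈ T.inEdges V, p.mass σ B) * β) /
      ∑ B ∈ (T.eraseVert V hVu).inEdges W, p.mass σ B) (p.gamma σ W) := by
  obtain ⟨φW, φV, h1, h2, h3⟩ := h.merge
  set P' := (T.eraseVert V hVu).inEdges W
  set M := ∑ B ∈ T.inEdges V, p.mass σ B with hM
  set a := (∑ B ∈ P', p.mass σ B * k B - M * β) / ∑ B ∈ P', p.mass σ B with ha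
  set w := q.secMap σ W
  have hw : IsCactusMap P' w := isCactusMap_secMap h.parent_mem'
  have hmass : ∀ B ∈ P', q.mass σ B = p.mass σ B := fun B hB =>
    mass_eq_of_input_eq_rotMap (h.input_child hB)
  have hMpos : 0 < M := Finset.sum_pos (fun B hB => mass_pos h.mem hB)
    (NestedTree.inEdges_nonempty h.mem)
  have hmV : p.mass σ V = M := mass_eq_sum h.coord_ne_zero
  have hP'pos : 0 < ∑ B ∈ P', p.mass σ B := Finset.sum_pos (fun B hB => by
    rw [← hmass B hB]; exact mass_pos h.parent_mem' hB) (NestedTree.inEdges_nonempty h.parent_mem')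
  -- The lobe `V` has the mass of all edges into `V` together, so by the merge relation its term
  -- splits into their terms.
  have hα : ∀ u, weightedParam (T.inEdges W) (p.mass σ) (p.secMap σ W) (φW u) =
      weightedParam P' (q.mass σ) w u + a := by
    intro u
    rw [weightedParam, weightedParam, Finset.sum_congr rfl hmass,
      Finset.sum_congr (rfl : P' = P') fun B hB => by rw [hmass B hB],
      ← Finset.add_sum_erase _ _ h.edge, ← Finset.add_sum_erase _ _ h.edge, ha, ← add_div, hmV,
      add_comm M, hM, ← h.sum_inEdges, ← hM]
    congr 1
    have e1 : ∑ B ∈ (T.inEdges W).erase V, p.mass σ B * p.secMap σ W (φW u) B =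
        ∑ B ∈ (T.inEdges W).erase V, p.mass σ B * (w u B + k B) :=
      Finset.sum_congr rfl fun B hB => by rw [h1 u B hB]
    have e2 := h.sum_inEdges fun B => p.mass σ B * (w u B + k B)
    rw [← h3 u] at e2
    have e3 : ∑ B ∈ P', p.mass σ B * (w u B + k B) =
        ∑ B ∈ P', p.mass σ B * w u B + ∑ B ∈ P', p.mass σ B * k B := by
      rw [← Finset.sum_add_distrib]
      exact Finset.sum_congr rfl fun B _ => by ring
    rw [e1]
    linarith
  obtain ⟨QV, hQV⟩ := exists_isCactusMap_gamma_of_coord (σ := σ) h.coord_ne_zero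
  -- Since the coordinate of `V` is `cis β`, the cactus inserted there is the composite at `V` read
  -- at the time `p.secMap σ W (φW u) V + β`, which is the weighted parameter of the cactus at `V`.
  have hinV : ∀ u C, p.input σ V (p.secMap σ W (φW u) V) C =
      ∑ B ∈ T.inEdges V, p.input σ B (w u B + k B) C - p.gamma σ V β C := by
    intro u C
    rw [input, if_neg h.coord_ne_zero, h.coord_eq, rotMap_arg_cis hQV]
    simp only [rotMap]
    congr 1
    have : p.secMap σ W (φW u) V + β =
        weightedParam (T.inEdges V) (p.mass σ) (p.secMap σ V) (φV u) := by
      rw [weightedParam, eq_div_iff hMpos.ne', mul_comm, h3 u]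
      exact Finset.sum_congr rfl fun B hB => by rw [h2 u B hB]
    rw [this, gamma_apply h.mem]
    exact Finset.sum_congr rfl fun B hB => by rw [h2 u B hB]
  -- Equality up to an additive constant is enough: evaluating at zero identifies the constant with
  -- that of `rotMap`.
  have key : ∀ u C, q.gamma σ W (weightedParam P' (q.mass σ) w u) C =
      p.gamma σ W (weightedParam P' (q.mass σ) w u + a) C + (p.gamma σ V β C -
        ∑ B ∈ P', p.input σ B (k B) C) := by
    intro u C
    have e1 : ∑ B ∈ (T.inEdges W).erase V, p.input σ B (p.secMap σ W (φW u) B) C =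
        ∑ B ∈ (T.inEdges W).erase V, p.input σ B (w u B + k B) C :=
      Finset.sum_congr rfl fun B hB => by rw [h1 u B hB]
    have e2 : ∑ B ∈ P', q.input σ B (w u B) C =
        ∑ B ∈ P', p.input σ B (w u B + k B) C - ∑ B ∈ P', p.input σ B (k B) C := by
      rw [← Finset.sum_sub_distrib]
      exact Finset.sum_congr rfl fun B hB => by rw [h.input_child hB, rotMap]
    rw [← hα, gamma_apply h.parent_mem, gamma_apply h.parent_mem',
      ← Finset.add_sum_erase _ _ h.edge, hinV, e1, e2,
      h.sum_inEdges fun B => p.input σ B (w u B + k B) C]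
    ring
  funext t C
  obtain ⟨u, rfl⟩ := weightedParam_secMap_surjective (p := q) (σ := σ) h.parent_mem' t
  obtain ⟨Q, -, -, hQ⟩ := (exists_isCactusMap_gamma σ q h.parent_mem').1
  have h0 := key 0 C
  rw [weightedParam_zero hw, hQ.zero, zero_add] at h0
  rw [key u C]
  simp only [rotMap]
  linarith

theorem gamma_eq_of_ne (h : Contracts σ p hVu q W k β) (hS : S ∈ T.verts) (hSV : S ≠ V)
    (hSW : S ≠ W) : q.gamma σ S = p.gamma σ S := by
  refine h.gamma_eq hS hSV hSW fun _ => ?_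
  obtain ⟨Q, hQ⟩ := exists_isCactusMap_input (σ := σ) p W
  rw [input_eq_rotMap h.coord_parent fun _ => h.gamma_parent, neg_add_cancel, rotMap_zero hQ]

theorem norm_coord (h : Contracts σ p hVu q W k β) (hB : B ≠ V) : ‖p.coord B‖ = ‖q.coord B‖ := by
  by_cases h1 : B ∈ (T.eraseVert V hVu).inEdges W
  · rw [h.coord_child B h1, norm_mul, norm_cis, mul_one]
  by_cases h2 : B = W
  · subst h2
    rw [h.coord_parent, norm_mul, norm_cis, mul_one]
  · rw [h.coord_other B hB h2 h1]

/-- Contraction of an edge is an elementary identification. -/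
theorem step (h : Contracts σ p hVu q W k β) : Step σ ⟨T, p⟩ ⟨T.eraseVert V hVu, q⟩ := by
  have hVW := NestedTree.mem_inEdges.1 h.edge
  -- `U` is the smallest vertex strictly above `V` with zero coordinate; the root always qualifies.
  obtain ⟨U, hU, hmin⟩ := (T.verts.filter fun U => V ⊂ U ∧ p.coord U = 0).exists_min_image
    Finset.card ⟨Finset.univ, Finset.mem_filter.2 ⟨T.root_mem, Finset.ssubset_univ_iff.2 hVu, by
      simp [coord]⟩⟩
  obtain ⟨hU1, hVU, hU0⟩ := Finset.mem_filter.1 hU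
  have hbetween : ∀ X ∈ T.verts, V ⊆ X → X ⊂ U → p.coord X ≠ 0 := by
    intro X hX h1 h2 h3
    by_cases hXV : X = V
    · exact h.coord_ne_zero (hXV ▸ h3)
    · have := hmin X (Finset.mem_filter.2 ⟨hX, Finset.ssubset_iff_subset_ne.2 ⟨h1, Ne.symm hXV⟩, h3⟩)
      exact absurd this (not_le.2 (Finset.card_lt_card h2))
  have hWU : W ⊆ U := by
    rcases NestedTree.subset_total h.parent_mem hU1 (NestedTree.nonempty_of_mem_verts h.mem)
      hVW.2.1.1 hVU.1 with h' | h'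
    · exact h'
    · by_contra hne
      exact hVW.2.2 U hU1 hVU ⟨h', hne⟩
  have hWsub : W ∈ p.subtree U :=
    ⟨h.parent_mem, hWU, fun X hX h1 h2 => hbetween X hX (hVW.2.1.1.trans h1) h2⟩
  refine ⟨V, U, h.mem, hVu, ?_, rfl, hU1, hU0, ⟨h.mem, hVU.1, hbetween⟩, ?_, ?_, ?_⟩
  · exact h.coord_eq ▸ norm_cis β
  · intro S hS hS' hnot
    have hSW : S ≠ W := fun h' => hnot (h' ▸ hWsub)
    have hSV : S ≠ V := Finset.ne_of_mem_erase hS'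
    refine ⟨h.heq S hS hS' hSW, ?_⟩
    by_cases h1 : S ∈ (T.eraseVert V hVu).inEdges W
    · have h1' := NestedTree.mem_inEdges.1 h1
      suffices h0 : p.coord S = 0 by rw [h.coord_child S h1, h0, zero_mul]
      by_contra h0
      refine hnot ⟨hS, h1'.2.1.1.trans hWU, fun X hX h2 h3 => ?_⟩
      by_cases hXS : X = S
      · exact hXS ▸ h0
      by_cases hXV : X = V
      · exact hXV ▸ h.coord_ne_zero
      refine hbetween X hX ?_ h3
      rcases NestedTree.subset_total hX h.parent_mem (NestedTree.nonempty_of_mem_verts hS) h2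
        h1'.2.1.1 with h' | h'
      · by_cases hXW : X = W
        · exact hXW ▸ hVW.2.1.1
        · exact absurd (Finset.ssubset_iff_subset_ne.2 ⟨h', hXW⟩) (h1'.2.2 X
            (Finset.mem_erase.2 ⟨hXV, hX⟩) (Finset.ssubset_iff_subset_ne.2 ⟨h2, Ne.symm hXS⟩))
      · exact hVW.2.1.1.trans h'
    · exact (h.coord_other S hSV hSW h1).symm
  · exact fun S _ hSV => h.norm_coord hSV
  · by_cases hUW : U = W
    · exact hUW ▸ ⟨_, h.gamma_parent.symm⟩
    · obtain ⟨Q, -, -, hQ⟩ := (exists_isCactusMap_gamma σ p hU1).1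
      exact ⟨0, (rotMap_zero hQ).trans (h.gamma_eq_of_ne hU1 hVU.ne' hUW).symm⟩

end Contracts

end Stratum

end NestedCacti

namespace NestedCacti

/-! ### Merging two cactus maps, and splitting of merged types -/

section Merge

variable {A : Type} {E PV PW : Finset A} {V : A} {m k : A → ℝ} {β : ℝ} {cW cV w : ℝ → A → ℝ}

theorem IsMerge.rotMap_right (h : IsMerge E PV V m k β cW cV w) (a : ℝ) :
    IsMerge E PV V m (fun B => k B + w a B) β cW cV (rotMap a w) := by
  obtain ⟨φW, φV, h1, h2, h3⟩ := h
  have e : ∀ u B, rotMap a w u B + (k B + w a B) = w (u + a) B + k B := fun u B => by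
    simp only [rotMap]
    ring
  exact ⟨fun u => φW (u + a), fun u => φV (u + a), fun u B hB => by rw [e, h1 _ B hB],
    fun u B hB => by rw [e, h2 _ B hB], fun u => by simp only [e, h3]⟩

/-- Cactus maps can be merged. -/
theorem exists_isMerge [DecidableEq A] (hW : IsCactusMap PW cW) (hV : IsCactusMap PV cV) (hVW : V ∈ PW)
    (hPV : PV.Nonempty) (hd : Disjoint (PW.erase V) PV) (hm : ∀ B ∈ PV, 0 < m B) (β : ℝ) :
    ∃ w k, IsCactusMap (PW.erase V ∪ PV) w ∧ IsMerge (PW.erase V) PV V m k β cW cV w := by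
  have hα := weightedParam_strictMono hV hPV hm
  have hαs := weightedParam_surjective hV hPV hm
  -- When the lobe `V` has progressed by `s`, the inserted cactus must be at the time `ν s` whose
  -- weighted parameter is `s + β`. The other lobes get trivial insertions.
  let e := hα.orderIsoOfSurjective _ hαs
  have he : ∀ s, weightedParam PV m cV (e.symm s) = s := fun s => e.apply_symm_apply s
  let ν : ℝ → ℝ := fun s => e.symm (s + β)
  have hν1 : ∀ s, ν (s + 1) = ν s + 1 := fun s => hα.injective (by
    rw [weightedParam_add_one hV hPV hm, he, he]
    ring)
  have hνm : Monotone ν := fun s t hst => e.symm.monotone (by linarith)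
  have hνc : Continuous ν := e.symm.continuous.comp (by fun_prop)
  let f : A → ℝ → A → ℝ := fun B => if B = V then fun s => cV (ν s) else unitMap B
  let Q : A → Finset A := fun B => if B = V then PV else {B}
  have hfV : f V = fun s => cV (ν s) := if_pos rfl
  have hfE : ∀ {B}, B ≠ V → f B = unitMap B := fun h => if_neg h
  have hQV : Q V = PV := if_pos rfl
  have hQE : ∀ {B}, B ≠ V → Q B = {B} := fun h => if_neg h
  have hf : ∀ B ∈ PW, IsLoopFamily (Q B) (f B) := by
    intro B hB
    by_cases h : B = V
    · subst h
      rw [hfV, hQV]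
      exact hV.toIsLoopFamily.comp_param hνm hνc hν1
    · rw [hfE h, hQE h]
      exact (isCactusMap_unitMap B).toIsLoopFamily
  have hdis : ∀ B ∈ PW, B ≠ V → B ∉ PV := fun B hB h =>
    Finset.disjoint_left.1 hd (Finset.mem_erase.2 ⟨h, hB⟩)
  have hQ : ∀ B ∈ PW, ∀ B' ∈ PW, B ≠ B' → Disjoint (Q B) (Q B') := by
    intro B hB B' hB' hne
    by_cases h : B = V
    · subst h
      rw [hQV, hQE (Ne.symm hne), Finset.disjoint_singleton_right]
      exact hdis B' hB' (Ne.symm hne)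
    · by_cases h' : B' = V
      · subst h'
        rw [hQV, hQE h, Finset.disjoint_singleton_left]
        exact hdis B hB h
      · rw [hQE h, hQE h', Finset.disjoint_singleton]
        exact hne
  have hU : PW.biUnion Q = PW.erase V ∪ PV := by
    ext C
    rw [Finset.mem_biUnion, Finset.mem_union, Finset.mem_erase]
    constructor
    · rintro ⟨B, hB, hC⟩
      by_cases h : B = V
      · subst h
        exact Or.inr (hQV ▸ hC)
      · rw [hQE h, Finset.mem_singleton] at hC
        exact Or.inl (hC ▸ ⟨h, hB⟩)
    · rintro (⟨h, hC⟩ | hC)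
      · exact ⟨C, hC, by rw [hQE h]; exact Finset.mem_singleton_self C⟩
      · exact ⟨V, hVW, hQV ▸ hC⟩
  have hfam := hW.toIsLoopFamily.compose hf hQ
  rw [hU] at hfam
  have hne : (PW.erase V ∪ PV).Nonempty := hPV.mono Finset.subset_union_right
  obtain ⟨w, hw, hb⟩ := hfam.exists_isCactusMap hne
  choose g hg using hfam.loopParam_surjective hne
  have hw' : ∀ u B, w u B + ∑ C ∈ PW, f C (cW 0 C) B = ∑ C ∈ PW, f C (cW (g u) C) B := by
    intro u B
    have := hb (g u) B
    rw [hg] at this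
    rw [this]
    ring
  have hE : ∀ t, ∀ B ∈ PW.erase V, ∑ C ∈ PW, f C (cW t C) B = cW t B := by
    intro t B hB
    obtain ⟨h, hB⟩ := Finset.mem_erase.1 hB
    have hBPV := hdis B hB h
    rw [Finset.sum_eq_single_of_mem B hB fun C hC hCB => ?_, hfE h]
    · simp [unitMap]
    · by_cases hCV : C = V
      · rw [hCV, hfV]
        exact hV.eq_zero hBPV _
      · rw [hfE hCV, unitMap, if_neg (Ne.symm hCB)]
  have hPVv : ∀ t, ∀ B ∈ PV, ∑ C ∈ PW, f C (cW t C) B = cV (ν (cW t V)) B := by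
    intro t B hB
    rw [Finset.sum_eq_single_of_mem V hVW fun C hC hCV => ?_, hfV]
    rw [hfE hCV, unitMap, if_neg]
    rintro rfl
    exact hdis B hC hCV hB
  refine ⟨w, fun B => ∑ C ∈ PW, f C (cW 0 C) B, hw, g, fun u => ν (cW (g u) V), fun u B hB => ?_,
    fun u B hB => ?_, fun u => ?_⟩
  · rw [hw', hE _ B hB]
  · rw [hw', hPVv _ B hB]
  · have hM := Finset.sum_pos hm hPV
    have := he (cW (g u) V + β)
    rw [weightedParam, div_eq_iff hM.ne'] at this
    rw [mul_comm, ← this]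
    exact Finset.sum_congr rfl fun B hB => by rw [hw', hPVv _ B hB]

/-- Merging is compatible with passing to cactus maps of the same type. -/
theorem IsMerge.exists_sim [DecidableEq A] (h : IsMerge (PW.erase V) PV V m k β cW cV w)
    (hcW : IsCactusMap PW cW) (hcV : IsCactusMap PV cV) (hw : IsCactusMap (PW.erase V ∪ PV) w)
    (hVW : V ∈ PW) (hPV : PV.Nonempty) (hd : Disjoint (PW.erase V) PV) (hm : ∀ B ∈ PV, 0 < m B)
    {m' : A → ℝ} (hm' : ∀ B ∈ PV, 0 < m' B) {w' : ℝ → A → ℝ}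
    (hw' : IsCactusMap (PW.erase V ∪ PV) w') (hs : Sim w w') :
    ∃ cW' cV', IsCactusMap PW cW' ∧ IsCactusMap PV cV' ∧ Sim cW cW' ∧ Sim cV cV' ∧
      ∀ a b, ∃ k' β', IsMerge (PW.erase V) PV V m' k' β' (rotMap a cW') (rotMap b cV') w' := by
  obtain ⟨φW, φV, h1, h2, h3⟩ := h
  -- The map `cW` comes from `w` by collapsing the labels in `PV` to `V` with normalized weights,
  -- and `cV` by keeping only the labels in `PV`. Applying both groupings to `w'`, with the new
  -- weights, gives the two maps sought.
  let g : A → A := fun C => if C ∈ PV then V else C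
  let μ : (A → ℝ) → A → ℝ := fun m C => if C ∈ PV then m C / ∑ B ∈ PV, m B else 1
  have hdis : ∀ B ∈ PW.erase V, B ∉ PV := fun B hB => Finset.disjoint_left.1 hd hB
  have hfV : (PW.erase V ∪ PV).filter (fun C => g C = V) = PV := by
    ext C
    simp only [Finset.mem_filter, Finset.mem_union, g]
    constructor
    · rintro ⟨h | h, h'⟩
      · rw [if_neg (hdis C h)] at h'
        exact absurd h' (Finset.ne_of_mem_erase h)
      · exact h
    · exact fun h => ⟨Or.inr h, if_pos h⟩
  have hfE : ∀ B ∈ PW.erase V, (PW.erase V ∪ PV).filter (fun C => g C = B) = {B} := by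
    intro B hB
    ext C
    simp only [Finset.mem_filter, Finset.mem_union, g, Finset.mem_singleton]
    constructor
    · rintro ⟨h, h'⟩
      split_ifs at h' with hC
      · exact absurd h'.symm (Finset.ne_of_mem_erase hB)
      · exact h'
    · rintro rfl
      exact ⟨Or.inl hB, if_neg (hdis C hB)⟩
  have hgE : ∀ m w u, ∀ B ∈ PW.erase V, grouped (PW.erase V ∪ PV) g (μ m) w u B = w u B := by
    intro m w u B hB
    rw [grouped, hfE B hB, Finset.sum_singleton]
    simp only [μ, if_neg (hdis B hB), one_mul]
  have hgV : ∀ m w u, grouped (PW.erase V ∪ PV) g (μ m) w u V =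
      (∑ C ∈ PV, m C * w u C) / ∑ C ∈ PV, m C := by
    intro m w u
    rw [grouped, hfV, Finset.sum_div]
    refine Finset.sum_congr rfl fun C hC => ?_
    simp only [μ, if_pos hC]
    ring
  have hμ : ∀ {m : A → ℝ}, (∀ B ∈ PV, 0 < m B) → ∀ C ∈ PW.erase V ∪ PV, 0 < μ m C := by
    intro m hm C hC
    simp only [μ]
    split_ifs with h
    · exact div_pos (hm C h) (Finset.sum_pos hm hPV)
    · exact one_pos
  have hμ1 : ∀ {m : A → ℝ}, (∀ B ∈ PV, 0 < m B) →
      ∀ B ∈ PW, ∑ C ∈ PW.erase V ∪ PV with g C = B, μ m C = 1 := by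
    intro m hm B hB
    by_cases h : B = V
    · subst h
      rw [hfV, Finset.sum_congr rfl fun C hC => show μ m C = m C / ∑ B ∈ PV, m B from if_pos hC,
        ← Finset.sum_div, div_self (Finset.sum_pos hm hPV).ne']
    · have hB' := Finset.mem_erase.2 ⟨h, hB⟩
      rw [hfE B hB', Finset.sum_singleton]
      exact if_neg (hdis B hB')
  have hM := Finset.sum_pos hm hPV
  have hM' := Finset.sum_pos hm' hPV
  obtain ⟨cW', hcW', hsW, φW', hφW'⟩ := exists_sim_of_grouped hw hw' hs hcW ⟨V, hVW⟩
    (Finset.Subset.refl _) (g := g) (fun C hC => by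
      simp only [g]
      split_ifs with h
      · exact hVW
      · exact Finset.mem_of_mem_erase ((Finset.mem_union.1 hC).resolve_right h))
    (hμ hm) (hμ hm') (hμ1 hm) (hμ1 hm') (φ := φW)
    (k := fun B => if B = V then (∑ C ∈ PV, m C * k C) / ∑ C ∈ PV, m C - β else k B)
    fun u B hB => by
      by_cases h : B = V
      · subst h
        rw [if_pos rfl, hgV]
        have := h3 u
        simp only [mul_add, Finset.sum_add_distrib] at this
        field_simp
        linarith
      · have hB' := Finset.mem_erase.2 ⟨h, hB⟩
        rw [if_neg h, hgE _ _ _ B hB', h1 u B hB']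
  have hid : ∀ B ∈ PV, PV.filter (fun C => id C = B) = {B} := by
    intro B hB
    ext C
    simp only [id, Finset.mem_filter, Finset.mem_singleton]
    exact ⟨And.right, fun h => ⟨h ▸ hB, h⟩⟩
  obtain ⟨cV', hcV', hsV, φV', hφV'⟩ := exists_sim_of_grouped hw hw' hs hcV hPV
    (Finset.subset_union_right (s₁ := PW.erase V)) (g := id) (fun C hC => hC)
    (μ := fun _ => 1) (μ' := fun _ => 1) (fun _ _ => one_pos) (fun _ _ => one_pos)
    (fun B hB => by rw [hid B hB, Finset.sum_singleton])
    (fun B hB => by rw [hid B hB, Finset.sum_singleton]) (φ := φV) (k := k) fun u B hB => by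
      rw [grouped, hid B hB, Finset.sum_singleton, one_mul, h2 u B hB]
  -- The sections fix based representatives only up to rotation, hence arbitrary `a` and `b`. The
  -- shifts `k'` and `β'` absorb the values that `rotMap` subtracts.
  refine ⟨cW', cV', hcW', hcV', hsW, hsV, fun a b => ⟨fun B => if B ∈ PV then -cV' b B else -cW' a B,
    cW' a V + (∑ C ∈ PV, m' C * -cV' b C) / ∑ C ∈ PV, m' C, fun u => φW' u - a,
    fun u => φV' u - b, fun u B hB => ?_, fun u B hB => ?_, fun u => ?_⟩⟩
  · simp only [if_neg (hdis B hB)]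
    rw [rotMap, sub_add_cancel, hφW', hgE _ _ _ B hB]
    ring
  · simp only [if_pos hB]
    rw [rotMap, sub_add_cancel, hφV', grouped, hid B hB, Finset.sum_singleton]
    ring
  · have e : ∑ B ∈ PV, m' B * (w' u B + if B ∈ PV then -cV' b B else -cW' a B) =
        ∑ B ∈ PV, m' B * w' u B + ∑ B ∈ PV, m' B * -cV' b B := by
      rw [← Finset.sum_add_distrib]
      exact Finset.sum_congr rfl fun B hB => by rw [if_pos hB, mul_add]
    rw [e, rotMap, sub_add_cancel, hφW', hgV]
    field_simp
    ring

end Merge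

/-! ### Existence and lifting of contractions of decorated trees -/

namespace Stratum

variable {n : ℕ} {T T' : NestedTree n} {σ : Sections n} {p : Stratum T}
  {S V W B : Finset (Fin n)}

theorem mass_eq_one (h : p.coord B = 0) : p.mass σ B = 1 := by
  rw [mass, input, if_pos h, (isCactusMap_unitMap B).sum_univ]
  simp

/-- The mass counts the lobes of the inserted composite. It depends only on the tree and on which
coordinates vanish, not on the cacti. -/
theorem mass_congr {q : Stratum T'} (h : ∀ S ⊆ B, S ∈ T.verts → T.inEdges S = T'.inEdges S)
    (h0 : ∀ S ⊆ B, p.coord S = 0 ↔ q.coord S = 0) : p.mass σ B = q.mass σ B := by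
  induction hk : B.card using Nat.strong_induction_on generalizing B with
  | _ N ih =>
    subst hk
    by_cases hB : p.coord B = 0
    · rw [mass_eq_one hB, mass_eq_one ((h0 B subset_rfl).1 hB)]
    · rw [mass_eq_sum hB, mass_eq_sum (mt (h0 B subset_rfl).2 hB),
        ← h B subset_rfl (mem_verts_of_coord_ne_zero hB).1]
      refine Finset.sum_congr rfl fun C hC => ?_
      have hCB := NestedTree.ssubset_of_mem_inEdges hC
      exact ih C.card (Finset.card_lt_card hCB) (fun S hS => h S (hS.trans hCB.1))
        (fun S hS => h0 S (hS.trans hCB.1)) rfl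

theorem exists_eq (x : ∀ S : T.verts, UnbasedCactus (T.inEdges S)) (z : Finset (Fin n) → ℂ)
    (hz : ∀ B, ‖z B‖ ≤ 1) : ∃ p : Stratum T, p.1 = x ∧
      ∀ B, p.coord B = if B ∈ T.verts ∧ B ≠ Finset.univ then z B else 0 :=
  ⟨⟨x, fun S => ⟨z S, mem_closedBall_zero_iff.2 (hz S)⟩⟩, rfl, fun B => by simp [coord]⟩

theorem norm_coord_le (p : Stratum T) (B : Finset (Fin n)) : ‖p.coord B‖ ≤ 1 := by
  rw [coord]
  split_ifs with h
  · exact mem_closedBall_zero_iff.1 (p.2 ⟨B, h⟩).2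
  · simp

theorem coord_eq_zero (h : ¬ (B ∈ T.verts ∧ B ≠ Finset.univ)) : p.coord B = 0 := dif_neg h

variable (σ) in
-- A section meets every rotation class, but the based representative is not at our disposal; this
-- is the source of the rotations in the contraction lemmas.
theorem exists_sec_map_eq_rotMap {P : Finset (Finset (Fin n))} {c : ℝ → Finset (Fin n) → ℝ}
    (hc : IsCactusMap P c) (hP : 2 ≤ P.card) :
    ∃ (y : UnbasedCactus P) (a : ℝ), (σ.sec P y).map = rotMap a c := by
  obtain ⟨x, hx⟩ := hc.exists_cactus hP
  obtain ⟨a, ha⟩ := Cactus.map_of_equiv (σ.mk_sec P ⟦x⟧).symm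
  exact ⟨⟦x⟧, a, hx ▸ ha⟩

theorem heq_cast {P P' : Finset (Finset (Fin n))} (h : P = P') (x : UnbasedCactus P) :
    ∃ y : UnbasedCactus P', HEq x y := by
  subst h
  exact ⟨x, HEq.rfl⟩

/-- An edge of unit length can be contracted. -/
theorem exists_contracts (σ : Sections n) (p : Stratum T) (hVu : V ≠ Finset.univ)
    (hV : ‖p.coord V‖ = 1) : ∃ q W k β, Contracts σ p hVu q W k β := by
  have h0 : p.coord V ≠ 0 := by
    rw [← norm_ne_zero_iff, hV]
    exact one_ne_zero
  have hVT := (mem_verts_of_coord_ne_zero h0).1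
  obtain ⟨W, hW, hVW⟩ := NestedTree.exists_parent hVT hVu
  have hWV : W ≠ V := (NestedTree.ssubset_of_mem_inEdges hVW).ne'
  have hW' : W ∈ (T.eraseVert V hVu).verts := Finset.mem_erase.2 ⟨hWV, hW⟩
  have hP' := NestedTree.inEdges_eraseVert_parent hVT hVu hVW
  obtain ⟨β, hβ⟩ : ∃ β, p.coord V = cis β := by
    have := eq_norm_mul_cis (p.coord V)
    rw [hV, Complex.ofReal_one, one_mul] at this
    exact ⟨_, this⟩
  obtain ⟨w, k₀, hw, hmerge⟩ := exists_isMerge (isCactusMap_secMap (σ := σ) (p := p) hW)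
    (isCactusMap_secMap (σ := σ) (p := p) hVT) hVW (NestedTree.inEdges_nonempty hVT)
    (NestedTree.disjoint_inEdges_erase hVW) (m := p.mass σ) (fun B hB => mass_pos hVT hB) β
  rw [← hP'] at hw
  obtain ⟨y, a, hy⟩ := exists_sec_map_eq_rotMap σ hw (NestedTree.two_le_card_inEdges hW')
  replace hmerge := hmerge.rotMap_right a
  rw [← hy] at hmerge
  set k := fun B => k₀ B + w a B
  have hx : ∀ S : (T.eraseVert V hVu).verts, ∃ x : UnbasedCactus ((T.eraseVert V hVu).inEdges S),
      (∀ h : S.1 ∈ T.verts, S.1 ≠ W → HEq (p.1 ⟨S.1, h⟩) x) ∧ (S.1 = W → HEq x y) := by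
    rintro ⟨S, hS⟩
    by_cases h : S = W
    · subst h
      exact ⟨y, fun _ h => absurd rfl h, fun _ => HEq.rfl⟩
    · obtain ⟨hSV, hST⟩ := Finset.mem_erase.1 hS
      obtain ⟨x, hx⟩ := heq_cast (NestedTree.inEdges_eraseVert_of_notMem hVT hVu hST hSV fun h' =>
        h (NestedTree.parent_unique hST hW h' hVW)).symm (p.1 ⟨S, hST⟩)
      exact ⟨x, fun _ _ => hx, fun h' => absurd h' h⟩
  choose x hx1 hx2 using hx
  let P' := (T.eraseVert V hVu).inEdges W
  let s : ℝ := -((∑ B ∈ P', p.mass σ B * k B - (∑ B ∈ T.inEdges V, p.mass σ B) * β) /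
      ∑ B ∈ P', p.mass σ B)
  -- The coordinates of the new children of `W` and of `W` itself are rotated to compensate the new
  -- base points; norms are unchanged.
  obtain ⟨q, hq1, hq2⟩ := exists_eq x (fun B => p.coord B * cis (if B ∈ P' then k B else
    if B = W then s else 0)) fun B => by
      rw [norm_mul, norm_cis, mul_one]
      exact norm_coord_le p B
  have hq3 : ∀ B ≠ V, q.coord B = p.coord B * cis (if B ∈ P' then k B else
      if B = W then s else 0) := by
    intro B hB
    rw [hq2]
    by_cases h : B ∈ (T.eraseVert V hVu).verts ∧ B ≠ Finset.univ
    · rw [if_pos h]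
    · rw [if_neg h, coord_eq_zero (p := p) fun h' => h ⟨Finset.mem_erase.2 ⟨hB, h'.1⟩, h'.2⟩,
        zero_mul]
  have hWP' : W ∉ P' := fun h => (NestedTree.ssubset_of_mem_inEdges h).ne rfl
  refine ⟨q, W, k, β, hVT, hW, hVW, fun S h h' hSW => ?_, ?_, hβ, fun B hB => ?_, ?_,
    fun B h1 h2 h3 => ?_⟩
  · rw [hq1]
    exact hx1 ⟨S, h'⟩ h hSW
  · have : q.secMap σ W = (σ.sec _ y).map := by
      rw [secMap, dif_pos hW', hq1, eq_of_heq (hx2 ⟨W, hW'⟩ rfl)]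
    rw [this]
    exact hmerge
  · have hBV : B ≠ V := by
      rintro rfl
      have := NestedTree.mem_inEdges.1 hB
      rcases this.1 with h | h
      · simp at h
      · have := T.two_le_card _ hVT
        omega
    rw [hq3 B hBV, if_pos hB]
  · rw [hq3 W hWV, if_neg hWP', if_pos rfl]
  · rw [hq3 B h1, if_neg h3, if_neg h2, cis_zero, mul_one]

/-- Decorations over the tree with an edge contracted which are of the same type as the
contraction of some decorations are themselves contractions. -/
theorem Contracts.exists_sim {hVu : V ≠ Finset.univ} {q q' : Stratum (T.eraseVert V hVu)}
    {k : Finset (Fin n) → ℝ} {β : ℝ} (h : Contracts σ p hVu q W k β)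
    (hs : ∀ S ∈ (T.eraseVert V hVu).verts, Sim (q.secMap σ S) (q'.secMap σ S)) :
    ∃ p' k' β', Contracts σ p' hVu q' W k' β' ∧
      ∀ S ∈ T.verts, Sim (p.secMap σ S) (p'.secMap σ S) := by
  have hP' := NestedTree.inEdges_eraseVert_parent h.mem hVu h.edge
  have hBV : ∀ {B}, B ∈ (T.eraseVert V hVu).inEdges W → B ≠ V := by
    rintro B hB rfl
    rcases (NestedTree.mem_inEdges.1 hB).1 with h1 | h1
    · simp at h1
    · have := T.two_le_card _ h.mem
      omega
  have hpos : ∀ B ∈ T.inEdges V, 0 < q'.mass σ B := fun B hB =>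
    mass_pos h.parent_mem' (h.mem_inEdges_right hB)
  obtain ⟨cW, cV, hcW, hcV, hsW, hsV, hall⟩ := h.merge.exists_sim (isCactusMap_secMap h.parent_mem)
    (isCactusMap_secMap h.mem) (hP' ▸ isCactusMap_secMap h.parent_mem') h.edge
    (NestedTree.inEdges_nonempty h.mem) (NestedTree.disjoint_inEdges_erase h.edge)
    (fun B hB => mass_pos h.mem hB) hpos (hP' ▸ isCactusMap_secMap h.parent_mem')
    (hs W h.parent_mem')
  obtain ⟨yW, a, hyW⟩ := exists_sec_map_eq_rotMap σ hcW (NestedTree.two_le_card_inEdges h.parent_mem)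
  obtain ⟨yV, b, hyV⟩ := exists_sec_map_eq_rotMap σ hcV (NestedTree.two_le_card_inEdges h.mem)
  obtain ⟨k', β', hmerge⟩ := hall a b
  rw [← hyW, ← hyV] at hmerge
  have hE : ∀ S ∈ T.verts, S ≠ V → S ≠ W → (T.eraseVert V hVu).inEdges S = T.inEdges S :=
    fun S hS hSV hSW => NestedTree.inEdges_eraseVert_of_notMem h.mem hVu hS hSV fun h' =>
      hSW (NestedTree.parent_unique hS h.parent_mem h' h.edge)
  have hx : ∀ S : T.verts, ∃ x : UnbasedCactus (T.inEdges S),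
      (∀ h' : S.1 ∈ (T.eraseVert V hVu).verts, S.1 ≠ W → HEq x (q'.1 ⟨S.1, h'⟩)) ∧
      (S.1 = W → HEq x yW) ∧ (S.1 = V → HEq x yV) := by
    rintro ⟨S, hS⟩
    by_cases h1 : S = W
    · subst h1
      exact ⟨yW, fun _ h => absurd rfl h, fun _ => HEq.rfl, fun h' => absurd h' h.ne⟩
    by_cases h2 : S = V
    · subst h2
      exact ⟨yV, fun h' => absurd rfl (Finset.ne_of_mem_erase h'), fun h' => absurd h' h1,
        fun _ => HEq.rfl⟩
    have hS' : S ∈ (T.eraseVert V hVu).verts := Finset.mem_erase.2 ⟨h2, hS⟩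
    obtain ⟨x, hx⟩ := heq_cast (hE S hS h2 h1) (q'.1 ⟨S, hS'⟩)
    exact ⟨x, fun _ _ => hx.symm, fun h' => absurd h' h1, fun h' => absurd h' h2⟩
  choose x hx1 hx2 hx3 using hx
  let P' := (T.eraseVert V hVu).inEdges W
  -- The decorations `p'` do not exist yet, so the masses of `q'` are used. They agree with those of
  -- `p'` by `hmass` below, as masses only depend on the tree and the vanishing of coordinates.
  let s : ℝ := -((∑ B ∈ P', q'.mass σ B * k' B - (∑ B ∈ T.inEdges V, q'.mass σ B) * β') /
      ∑ B ∈ P', q'.mass σ B)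
  have hWP' : W ∉ P' := fun h => (NestedTree.ssubset_of_mem_inEdges h).ne rfl
  obtain ⟨p', hp1, hp2⟩ := exists_eq (T := T) x (fun B => if B = V then cis β' else
    q'.coord B * cis (-(if B ∈ P' then k' B else if B = W then s else 0))) fun B => by
      split_ifs
      · exact (norm_cis β').le
      all_goals
        rw [norm_mul, norm_cis, mul_one]
        exact norm_coord_le q' B
  have hp3 : ∀ B ≠ V, q'.coord B = p'.coord B * cis (if B ∈ P' then k' B else
      if B = W then s else 0) := by
    intro B hB
    rw [hp2, if_neg hB]
    split_ifs with h <;> first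
      | rw [mul_assoc, ← cis_add, neg_add_cancel, cis_zero, mul_one]
      | (rw [zero_mul]
         exact coord_eq_zero fun h' => h ⟨Finset.mem_of_mem_erase h'.1, h'.2⟩)
  have hmass : ∀ B ∈ P', p'.mass σ B = q'.mass σ B := by
    intro B hB
    have hBW := NestedTree.ssubset_of_mem_inEdges hB
    have hV : ∀ S ⊆ B, S ≠ V := by
      rintro S hS rfl
      exact (NestedTree.mem_inEdges.1 h.edge).2.2 B (by
        rcases (NestedTree.mem_inEdges.1 hB).1 with h1 | h1
        · exact Finset.mem_of_mem_erase h1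
        · have := T.two_le_card _ h.mem
          have := Finset.card_le_card hS
          omega) (Finset.ssubset_iff_subset_ne.2 ⟨hS, (hBV hB).symm⟩) hBW
    refine mass_congr (fun S hS hST => (hE S hST (hV S hS) ?_).symm) fun S hS => ?_
    · rintro rfl
      exact hBW.2 hS
    · rw [hp3 S (hV S hS), mul_eq_zero, or_iff_left (cis_ne_zero _)]
  have hmassV : ∀ B ∈ T.inEdges V, p'.mass σ B = q'.mass σ B := fun B hB =>
    hmass B (h.mem_inEdges_right hB)
  have hW : p'.secMap σ W = (σ.sec _ yW).map := by
    rw [secMap, dif_pos h.parent_mem, hp1, eq_of_heq (hx2 ⟨W, h.parent_mem⟩ rfl)]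
  have hV : p'.secMap σ V = (σ.sec _ yV).map := by
    rw [secMap, dif_pos h.mem, hp1, eq_of_heq (hx3 ⟨V, h.mem⟩ rfl)]
  have hheq : ∀ S (h : S ∈ T.verts) (h' : S ∈ (T.eraseVert V hVu).verts), S ≠ W →
      HEq (p'.1 ⟨S, h⟩) (q'.1 ⟨S, h'⟩) := fun S h h' hSW => by
    rw [hp1]
    exact hx1 ⟨S, h⟩ h' hSW
  refine ⟨p', k', β', ⟨h.mem, h.parent_mem, h.edge, hheq, ?_, ?_, fun B hB => ?_, ?_,
    fun B h1 h2 h3 => ?_⟩, fun S hS => ?_⟩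
  · obtain ⟨φW, φV, g1, g2, g3⟩ := hmerge
    refine ⟨φW, φV, by rwa [hW], by rwa [hV], fun u => ?_⟩
    rw [hW, Finset.sum_congr rfl hmassV, g3]
    exact Finset.sum_congr rfl fun B hB => by rw [hmassV B hB]
  · rw [hp2, if_pos ⟨h.mem, hVu⟩, if_pos rfl]
  · rw [hp3 B (hBV hB), if_pos hB]
  · rw [hp3 W h.ne, if_neg hWP', if_pos rfl]
    congr 3
    rw [Finset.sum_congr rfl hmassV, Finset.sum_congr (rfl : P' = P') hmass,
      Finset.sum_congr (rfl : P' = P') fun B hB => by rw [hmass B hB]]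
  · rw [hp3 B h1, if_neg h3, if_neg h2, cis_zero, mul_one]
  · by_cases h1 : S = W
    · subst h1
      rw [hW, hyW]
      exact hsW.rotMap_right a
    by_cases h2 : S = V
    · subst h2
      rw [hV, hyV]
      exact hsV.rotMap_right b
    have hS' : S ∈ (T.eraseVert V hVu).verts := Finset.mem_erase.2 ⟨h2, hS⟩
    have hE' := (hE S hS h2 h1).symm
    rw [secMap_congr hS hS' hE' (h.heq S hS hS' h1), secMap_congr hS hS' hE' (hheq S hS hS' h1)]
    exact hs S hS'

end Stratum

end NestedCacti

namespace NestedCacti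

variable {n : ℕ} {σ : Sections n}

/-! ### Radial parameters of nested cacti -/

namespace Stratum

/-- The radial parameter of `V`: it is one for sets which are not vertices of the tree. -/
def radius {T : NestedTree n} (p : Stratum T) (V : Finset (Fin n)) : ℝ :=
  if V ∈ T.verts then ‖p.coord V‖ else 1

variable {T T' : NestedTree n} {p : Stratum T} {q : Stratum T'} {S V U B : Finset (Fin n)}

theorem radius_eq_zero_iff : p.radius V = 0 ↔ V ∈ T.verts ∧ p.coord V = 0 := by
  rw [radius]
  split_ifs with h <;> simp [h]

theorem continuous_coord (V : Finset (Fin n)) : Continuous fun p : Stratum T => p.coord V := by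
  by_cases h : V ∈ T.verts ∧ V ≠ Finset.univ
  · simp only [coord, dif_pos h]
    exact continuous_subtype_val.comp ((continuous_apply _).comp continuous_snd)
  · simp only [coord, dif_neg h]
    exact continuous_const

theorem continuous_radius (V : Finset (Fin n)) : Continuous fun p : Stratum T => p.radius V := by
  simp only [radius]
  split_ifs
  · exact (continuous_coord V).norm
  · exact continuous_const

/-- The removed vertex had radius one, which is the value assigned to sets that are not vertices. -/
theorem radius_eq_of_step {p q : Σ T : NestedTree n, Stratum T} (h : Step σ p q)
    (V : Finset (Fin n)) : p.2.radius V = q.2.radius V := by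
  obtain ⟨S₀, U, h1, -, h3, h4, -, -, -, -, h5, -⟩ := h
  simp only [radius, h4, Finset.mem_erase]
  by_cases hV : V = S₀
  · rw [if_pos (hV ▸ h1), if_neg fun h' => h'.1 hV, hV, h3]
  · by_cases hT : V ∈ p.1.verts
    · rw [if_pos hT, if_pos ⟨hV, hT⟩, h5 V hT hV]
    · rw [if_neg hT, if_neg fun h' => hT h'.2]

theorem parent_mem_subtree (hS : S ∈ T.verts) (hU : U ∈ T.verts) (hU0 : p.coord U = 0)
    (hB : B ∈ T.inEdges S) (hB0 : p.coord B ≠ 0) (h : B ∈ p.subtree U) : S ∈ p.subtree U := by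
  obtain ⟨hBT, hBU, hbet⟩ := h
  have hBS := NestedTree.mem_inEdges.1 hB
  have hBU' : B ⊂ U := Finset.ssubset_iff_subset_ne.2 ⟨hBU, fun h' => hB0 (h' ▸ hU0)⟩
  refine ⟨hS, ?_, fun X hX h1 h2 => hbet X hX (hBS.2.1.1.trans h1) h2⟩
  rcases NestedTree.subset_total hS hU (NestedTree.nonempty_of_mem_verts hBT) hBS.2.1.1 hBU with h | h
  · exact h
  · by_contra hne
    exact hBS.2.2 U hU hBU' ⟨h, hne⟩

/-- For the root of the affected subtree this is part of the identification. Any other vertex of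
zero coordinate lies outside that subtree, and so do all vertices contributing to its composite: an
edge that enters the subtree has zero coordinate and carries a trivial insertion. -/
theorem gamma_eq_of_step {p q : Σ T : NestedTree n, Stratum T} (h : Step σ p q)
    (hU : U ∈ p.1.verts) (hU0 : p.2.coord U = 0) :
    ∃ a : ℝ, rotMap a (p.2.gamma σ U) = q.2.gamma σ U := by
  obtain ⟨T, p⟩ := p
  obtain ⟨T', q⟩ := q
  have hrad := radius_eq_of_step h
  obtain ⟨V, U₀, hV, hVu, hV1, hT', hU₀, hU₀0, hsub, hout, -, a, ha⟩ := h
  obtain rfl : T' = T.eraseVert V hVu := NestedTree.ext hT'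
  by_cases hUU : U = U₀
  · exact ⟨a, hUU ▸ ha⟩
  simp only at *
  have hV0 : p.coord V ≠ 0 := by
    rw [← norm_ne_zero_iff, hV1]
    exact one_ne_zero
  have key : ∀ S ∈ T.verts, S ∉ p.subtree U₀ → p.gamma σ S = q.gamma σ S := by
    intro S hS hnot
    induction hk : S.card using Nat.strong_induction_on generalizing S with
    | _ N ih =>
      subst hk
      have hSV : S ≠ V := fun h => hnot (h ▸ hsub)
      have hS' : S ∈ (T.eraseVert V hVu).verts := Finset.mem_erase.2 ⟨hSV, hS⟩
      have hE : T.inEdges S = (T.eraseVert V hVu).inEdges S :=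
        (NestedTree.inEdges_eraseVert_of_notMem hV hVu hS hSV fun h' =>
          hnot (parent_mem_subtree hS hU₀ hU₀0 h' hV0 hsub)).symm
      refine gamma_congr hS hS' hE (secMap_congr hS hS' hE (hout S hS hS' hnot).1) fun B hB => ?_
      by_cases hB0 : p.coord B = 0
      · have hB0' : q.coord B = 0 := by
          by_contra hne
          have hBT := (mem_verts_of_coord_ne_zero hne).1
          have := (radius_eq_zero_iff (p := q)).1 ((hrad B).symm.trans
            ((radius_eq_zero_iff (p := p)).2 ⟨Finset.mem_of_mem_erase hBT, hB0⟩))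
          exact hne this.2
        rw [input, input, if_pos hB0, if_pos hB0']
      · have hBT := (mem_verts_of_coord_ne_zero hB0).1
        have hBn : B ∉ p.subtree U₀ := fun h' =>
          hnot (parent_mem_subtree hS hU₀ hU₀0 hB hB0 h')
        have hBV : B ≠ V := fun h => hBn (h ▸ hsub)
        have hc := (hout B hBT (Finset.mem_erase.2 ⟨hBV, hBT⟩) hBn).2
        rw [input, input, ← hc, if_neg hB0, if_neg hB0,
          ih B.card (Finset.card_lt_card (NestedTree.ssubset_of_mem_inEdges hB)) B hBT hBn rfl]
  obtain ⟨Q, -, -, hQ⟩ := (exists_isCactusMap_gamma σ p hU).1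
  refine ⟨0, (rotMap_zero hQ).trans (key U hU fun h' => ?_)⟩
  exact h'.2.2 U hU subset_rfl (Finset.ssubset_iff_subset_ne.2 ⟨h'.2.1, hUU⟩) hU0

end Stratum

namespace Space

/-- The radial parameter of `V`, as a function on the space of nested cacti. -/
def radius (σ : Sections n) (V : Finset (Fin n)) : Space σ → ℝ :=
  Quot.lift (fun p => p.2.radius V) fun _ _ h => Stratum.radius_eq_of_step h V

theorem radius_mk {T : NestedTree n} (p : Stratum T) (V : Finset (Fin n)) :
    radius σ V (mk σ T p) = p.radius V := rfl

theorem continuous_radius (V : Finset (Fin n)) : Continuous (radius σ V) :=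
  continuous_quot_lift _ (continuous_sigma fun _ => Stratum.continuous_radius V)

theorem continuous_mk (T : NestedTree n) : Continuous (mk σ T) :=
  continuous_quot_mk.comp continuous_sigmaMk

theorem exists_mk (q : Space σ) : ∃ (T : NestedTree n) (p : Stratum T), q = mk σ T p := by
  obtain ⟨⟨T, p⟩, rfl⟩ := Quot.exists_rep q
  exact ⟨T, p, rfl⟩

/-- Induction over the generated equivalence. Equality of all radii is carried along, so that `U`
remains a vertex of zero coordinate in every intermediate representative. -/
theorem exists_rotMap_gamma {T T' : NestedTree n} {p : Stratum T} {q : Stratum T'}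
    (h : mk σ T p = mk σ T' q) {U : Finset (Fin n)} (hU : U ∈ T.verts) (hU0 : p.coord U = 0) :
    ∃ a : ℝ, rotMap a (p.gamma σ U) = q.gamma σ U := by
  suffices H : ∀ x y : Σ T : NestedTree n, Stratum T, Relation.EqvGen (Step σ) x y →
      (∀ V, x.2.radius V = y.2.radius V) ∧ ∀ U, x.2.radius U = 0 →
        ∃ a : ℝ, rotMap a (x.2.gamma σ U) = y.2.gamma σ U from
    (H ⟨T, p⟩ ⟨T', q⟩ (Quot.eqvGen_exact h)).2 U (Stratum.radius_eq_zero_iff.2 ⟨hU, hU0⟩)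
  intro x y hxy
  induction hxy with
  | rel x y h =>
    refine ⟨Stratum.radius_eq_of_step h, fun U hU => ?_⟩
    obtain ⟨h1, h2⟩ := Stratum.radius_eq_zero_iff.1 hU
    exact Stratum.gamma_eq_of_step h h1 h2
  | refl x =>
    refine ⟨fun _ => rfl, fun U hU => ?_⟩
    obtain ⟨Q, -, -, hQ⟩ := (Stratum.exists_isCactusMap_gamma σ x.2
      (Stratum.radius_eq_zero_iff.1 hU).1).1
    exact ⟨0, rotMap_zero hQ⟩
  | symm x y _ ih =>
    refine ⟨fun V => (ih.1 V).symm, fun U hU => ?_⟩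
    rw [← ih.1 U] at hU
    obtain ⟨a, ha⟩ := ih.2 U hU
    obtain ⟨Q, -, -, hQ⟩ := (Stratum.exists_isCactusMap_gamma σ x.2
      (Stratum.radius_eq_zero_iff.1 hU).1).1
    exact ⟨-a, by rw [← ha, rotMap_rotMap, neg_add_cancel, rotMap_zero hQ]⟩
  | trans x y z _ _ ih1 ih2 =>
    refine ⟨fun V => (ih1.1 V).trans (ih2.1 V), fun U hU => ?_⟩
    obtain ⟨a, ha⟩ := ih1.2 U hU
    obtain ⟨b, hb⟩ := ih2.2 U (ih1.1 U ▸ hU)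
    exact ⟨b + a, by rw [← rotMap_rotMap, ha, hb]⟩

end Space

/-! ### Recovering the decorations from the composites -/

namespace Stratum

variable {T : NestedTree n} {p q : Stratum T} {S B C : Finset (Fin n)}

theorem input_eq_zero (hS : S ∈ T.verts) (hB : B ∈ T.inEdges S) (hC : ¬ (C.Nonempty ∧ C ⊆ B))
    (x : ℝ) : p.input σ B x C = 0 := by
  obtain ⟨Q, -, h2, h3⟩ := (exists_isCactusMap_gamma σ p hS).2 B hB
  exact h3.eq_zero (fun h => hC (h2 C h)) x

theorem sum_input (hS : S ∈ T.verts) (hB : B ∈ T.inEdges S) (x : ℝ) :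
    ∑ C, p.input σ B x C = p.mass σ B * x := by
  obtain ⟨Q, -, -, h3⟩ := (exists_isCactusMap_gamma σ p hS).2 B hB
  rw [mass, h3.sum_univ, h3.sum_univ, mul_one]

theorem gamma_apply_of_subset (hS : S ∈ T.verts) (hB : B ∈ T.inEdges S)
    (hCB : C ⊆ B) (t : ℝ) :
    p.gamma σ S (weightedParam (T.inEdges S) (p.mass σ) (p.secMap σ S) t) C =
      p.input σ B (p.secMap σ S t B) C := by
  rw [gamma_apply hS]
  refine Finset.sum_eq_single_of_mem B hB fun B' hB' hne => input_eq_zero hS hB' ?_ _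
  rintro ⟨⟨i, hi⟩, hCB'⟩
  exact Finset.disjoint_left.1 (NestedTree.disjoint_of_mem_inEdges hB hB' hne.symm) (hCB hi)
    (hCB' hi)

theorem sum_gamma_subset (hS : S ∈ T.verts) (hB : B ∈ T.inEdges S) (t : ℝ) :
    ∑ C with C.Nonempty ∧ C ⊆ B,
      p.gamma σ S (weightedParam (T.inEdges S) (p.mass σ) (p.secMap σ S) t) C =
      p.mass σ B * p.secMap σ S t B := by
  rw [← sum_input hS hB, Finset.sum_filter]
  refine Finset.sum_congr rfl fun C _ => ?_
  split_ifs with h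
  · exact gamma_apply_of_subset hS hB h.2 t
  · exact (input_eq_zero hS hB h _).symm

/-- Summing the composite over all labels inside `B` and dividing by the mass recovers the
coordinate `B` of the outer cactus (`sum_gamma_subset`). So a rotation between composites induces
one between the outer cacti, by `t₀`, and between the inputs, by the value of the outer map at `t₀`.
-/
theorem eq_of_rotMap_gamma (hS : S ∈ T.verts)
    (hm : ∀ B ∈ T.inEdges S, p.mass σ B = q.mass σ B) {a : ℝ}
    (h : rotMap a (p.gamma σ S) = q.gamma σ S) :
    p.1 ⟨S, hS⟩ = q.1 ⟨S, hS⟩ ∧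
      ∀ B ∈ T.inEdges S, ∃ b : ℝ, rotMap b (p.input σ B) = q.input σ B := by
  set c := p.secMap σ S with hcdef
  set c' := q.secMap σ S with hcdef'
  have hc : IsCactusMap (T.inEdges S) c := isCactusMap_secMap hS
  have hc' : IsCactusMap (T.inEdges S) c' := isCactusMap_secMap hS
  have hne := NestedTree.inEdges_nonempty hS
  obtain ⟨t₀, ht₀⟩ := weightedParam_secMap_surjective (p := p) (σ := σ) hS a
  choose τ hτ using fun t => weightedParam_secMap_surjective (p := p) (σ := σ) hS
    (weightedParam (T.inEdges S) (q.mass σ) c' t + a)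
  have hB : ∀ t, ∀ B ∈ T.inEdges S, c' t B = c (τ t) B - c t₀ B := by
    intro t B hB
    have h1 := sum_gamma_subset (σ := σ) (p := q) hS hB t
    have h2 := sum_gamma_subset (σ := σ) (p := p) hS hB (τ t)
    have h3 := sum_gamma_subset (σ := σ) (p := p) hS hB t₀
    rw [hτ] at h2
    rw [ht₀] at h3
    simp only [← h, rotMap, Finset.sum_sub_distrib] at h1
    rw [← hcdef] at h2 h3
    rw [← hcdef', h2, h3, ← mul_sub, hm B hB] at h1
    exact mul_left_cancel₀ (mass_pos hS hB).ne' h1.symm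
  have hτ' : ∀ t, τ t = t + t₀ := by
    intro t
    have h1 := hc'.sum t
    rw [Finset.sum_congr rfl (hB t), Finset.sum_sub_distrib, hc.sum, hc.sum, ← mul_sub] at h1
    have := mul_left_cancel₀ (by simpa using hne.ne_empty) h1
    linarith
  refine ⟨?_, fun B hBS => ⟨c t₀ B, ?_⟩⟩
  · have e : c' = rotMap t₀ c := by
      funext t B
      by_cases h' : B ∈ T.inEdges S
      · rw [hB t B h', hτ', rotMap]
      · rw [hc'.eq_zero h', (hc.rotMap t₀).eq_zero h']
    rw [hcdef, hcdef', secMap, secMap, dif_pos hS, dif_pos hS] at e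
    have := Cactus.equiv_of_map_eq e
    rwa [σ.mk_sec, σ.mk_sec] at this
  · funext x C
    by_cases hC : C.Nonempty ∧ C ⊆ B
    · obtain ⟨t, rfl⟩ := surjective_of_add_one (hc'.cont B) (hc'.add_one B hBS) x
      have h1 := gamma_apply_of_subset (σ := σ) (p := q) hS hBS hC.2 t
      have h2 := gamma_apply_of_subset (σ := σ) (p := p) hS hBS hC.2 (τ t)
      have h3 := gamma_apply_of_subset (σ := σ) (p := p) hS hBS hC.2 t₀
      rw [hτ] at h2
      rw [ht₀] at h3
      rw [← h, rotMap] at h1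
      rw [← hcdef] at h2 h3
      rw [← h1, h2, h3]
      simp only [rotMap, hB t B hBS, sub_add_cancel]
    · rw [input_eq_zero hS hBS hC, rotMap, input_eq_zero hS hBS hC, input_eq_zero hS hBS hC,
        sub_zero]

/-- The cacti which decorate a tree are determined by the nested cactus. -/
theorem eq_of_mk_eq (h : Space.mk σ T p = Space.mk σ T q) : p.1 = q.1 := by
  have hrad : ∀ V, p.radius V = q.radius V := fun V => by
    rw [← Space.radius_mk (σ := σ), h, Space.radius_mk]
  have h0 : ∀ V, p.coord V = 0 ↔ q.coord V = 0 := by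
    intro V
    by_cases hV : V ∈ T.verts
    · have := hrad V
      rw [radius, radius, if_pos hV, if_pos hV] at this
      rw [← norm_eq_zero, this, norm_eq_zero]
    · rw [coord_eq_zero fun h => hV h.1, coord_eq_zero fun h => hV h.1]
  have hm : ∀ B, p.mass σ B = q.mass σ B := fun B =>
    mass_congr (fun _ _ _ => rfl) fun S _ => h0 S
  -- Descent from the root. At zero coordinate the composite is an invariant of the nested cactus;
  -- otherwise it is recovered from the composite at the parent.
  have key : ∀ S ∈ T.verts, ∃ a : ℝ, rotMap a (p.gamma σ S) = q.gamma σ S := by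
    intro S hS
    induction hk : n - S.card using Nat.strong_induction_on generalizing S with
    | _ N ih =>
      subst hk
      by_cases hS0 : p.coord S = 0
      · exact Space.exists_rotMap_gamma h hS hS0
      obtain ⟨W, hW, hSW⟩ := NestedTree.exists_parent hS (mem_verts_of_coord_ne_zero hS0).2
      have hlt := Finset.card_lt_card (NestedTree.ssubset_of_mem_inEdges hSW)
      have hWn : W.card ≤ n := by simpa using Finset.card_le_univ W
      obtain ⟨a, ha⟩ := ih (n - W.card) (by omega) W hW rfl
      obtain ⟨b, hb⟩ := (eq_of_rotMap_gamma hW (fun B _ => hm B) ha).2 S hSW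
      obtain ⟨Q, hQ⟩ := exists_isCactusMap_gamma_of_coord (σ := σ) (mt (h0 S).2 hS0)
      rw [input, input, if_neg hS0, if_neg (mt (h0 S).2 hS0), rotMap_rotMap] at hb
      exact ⟨_, (rotMap_rotMap _ _ _).symm.trans ((congrArg _ hb).trans ((rotMap_rotMap
        (-(Complex.arg (q.coord S) / (2 * Real.pi))) _ _).trans
          (by rw [neg_add_cancel, rotMap_zero hQ])))⟩
  funext ⟨S, hS⟩
  obtain ⟨a, ha⟩ := key S hS
  exact (eq_of_rotMap_gamma hS (fun B _ => hm B) ha).1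

/-! ### Representatives without radial parameters equal to one -/

/-- Edges of unit length are contracted until none is left. By `Contracts.exists_sim` each
contraction can be undone for all decorations of the same type, and the last clause accumulates
these lifts. -/
theorem exists_reduced (σ : Sections n) {T : NestedTree n} (p : Stratum T) :
    ∃ (T' : NestedTree n) (p' : Stratum T'), Space.mk σ T p = Space.mk σ T' p' ∧
      (∀ V, ‖p'.coord V‖ < 1) ∧
      ∀ q' : Stratum T', (∀ S ∈ T'.verts, Sim (p'.secMap σ S) (q'.secMap σ S)) →
        ∃ q : Stratum T, Space.mk σ T q = Space.mk σ T' q' ∧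
          ∀ S ∈ T.verts, Sim (p.secMap σ S) (q.secMap σ S) := by
  induction hk : T.verts.card generalizing T with
  | zero => exact absurd T.root_mem (by simp [Finset.card_eq_zero.1 hk])
  | succ N ih =>
    by_cases hall : ∀ V, ‖p.coord V‖ < 1
    · exact ⟨T, p, rfl, hall, fun q' h => ⟨q', rfl, h⟩⟩
    push Not at hall
    obtain ⟨V, hV⟩ := hall
    have hV1 : ‖p.coord V‖ = 1 := le_antisymm (norm_coord_le p V) hV
    have hV0 : p.coord V ≠ 0 := by
      rw [← norm_ne_zero_iff, hV1]
      exact one_ne_zero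
    obtain ⟨hVT, hVu⟩ := mem_verts_of_coord_ne_zero hV0
    obtain ⟨q, W, k, β, hq⟩ := exists_contracts σ p hVu hV1
    obtain ⟨T', p', h1, h2, h3⟩ := ih q (by
      rw [NestedTree.eraseVert_verts, Finset.card_erase_of_mem hVT, hk, Nat.add_sub_cancel])
    refine ⟨T', p', (Quot.sound hq.step).trans h1, h2, fun q' hq' => ?_⟩
    obtain ⟨r, hr1, hr2⟩ := h3 q' hq'
    obtain ⟨r', k', β', hr', hs⟩ := hq.exists_sim hr2
    exact ⟨r', (Quot.sound hr'.step).trans hr1, hs⟩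

end Stratum

end NestedCacti

namespace NestedCacti

variable {n : ℕ} {σ : Sections n}

/-! ### Closed strata -/

section Strata

variable {S : NestedTree n} {q : Space σ}

/-- Sets outside the tree have radius one, so a vanishing radius forces `V` to be a vertex in every
representative. In particular any representative can serve as witness. -/
theorem mem_closedStratum_iff : q ∈ closedStratum σ S ↔ ∀ V ∈ S.verts, q.radius σ V = 0 := by
  constructor
  · rintro ⟨T, p, rfl, hS, h0⟩ V hV
    rw [Space.radius_mk, Stratum.radius_eq_zero_iff]
    exact ⟨hS hV, h0 V hV⟩
  · intro h
    obtain ⟨T, p, rfl⟩ := Space.exists_mk q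
    have h' : ∀ V ∈ S.verts, V ∈ T.verts ∧ p.coord V = 0 := fun V hV =>
      Stratum.radius_eq_zero_iff.1 (h V hV)
    exact ⟨T, p, rfl, fun V hV => (h' V hV).1, fun V hV => (h' V hV).2⟩

theorem isClosed_closedStratum : IsClosed (closedStratum σ S) := by
  have : closedStratum σ S = ⋂ V ∈ S.verts, (Space.radius σ V) ⁻¹' {0} := by
    ext q
    simp [mem_closedStratum_iff]
  rw [this]
  exact isClosed_biInter fun V _ => isClosed_singleton.preimage (Space.continuous_radius V)

theorem openStratum_subset : openStratum σ S ⊆ closedStratum σ S := by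
  rintro q ⟨T, p, rfl, hS, h⟩
  exact ⟨T, p, rfl, hS, fun V hV => (h V (hS hV)).2 hV⟩

theorem closedStratum_eq_closure : closedStratum σ S = closure (openStratum σ S) := by
  refine Subset.antisymm ?_ (closure_minimal openStratum_subset isClosed_closedStratum)
  rintro q ⟨T, p, rfl, hS, h⟩
  -- Zero coordinates at vertices outside `S` are made positive. Clamping to `[0, 1]` keeps the path
  -- in the disc for every real `ε` and gives back `p` at `ε = 0`.
  let z : ℝ → T.NonRoot → ℂ := fun ε V =>
    if p.coord V = 0 ∧ V.1 ∉ S.verts then ((max 0 (min ε 1) : ℝ) : ℂ) else p.2 V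
  have hcoord : ∀ V : T.NonRoot, p.coord V = p.2 V := fun V => dif_pos V.2
  have hz : ∀ ε V, ‖z ε V‖ ≤ 1 := by
    intro ε V
    simp only [z]
    split_ifs
    · rw [Complex.norm_real, Real.norm_of_nonneg (le_max_left _ _)]
      exact max_le zero_le_one (min_le_right _ _)
    · rw [← hcoord]
      exact Stratum.norm_coord_le p V
  let f : ℝ → Stratum T := fun ε => ⟨p.1, fun V => ⟨z ε V, mem_closedBall_zero_iff.2 (hz ε V)⟩⟩
  have hf : Continuous f := by
    refine continuous_const.prodMk (continuous_pi fun V => Continuous.subtype_mk ?_ _)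
    simp only [z]
    split_ifs
    · exact Complex.continuous_ofReal.comp (by fun_prop)
    · exact continuous_const
  have hf0 : f 0 = p := by
    refine Prod.ext rfl (funext fun V => Subtype.ext ?_)
    change z 0 V = p.2 V
    simp only [z]
    split_ifs with h'
    · rw [← hcoord, h'.1]
      simp
    · rfl
  have htend : Filter.Tendsto (fun ε => Space.mk σ T (f ε)) (nhdsWithin 0 (Ioi 0))
      (nhds (Space.mk σ T p)) := by
    have := ((Space.continuous_mk (σ := σ) T).comp hf).tendsto 0
    simp only [Function.comp, hf0] at this
    exact this.mono_left nhdsWithin_le_nhds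
  refine mem_closure_of_tendsto htend (Filter.eventually_of_mem self_mem_nhdsWithin fun ε hε => ?_)
  refine ⟨T, f ε, rfl, hS, fun V hV => ?_⟩
  by_cases hVu : V = Finset.univ
  · subst hVu
    exact iff_of_true (Stratum.coord_eq_zero fun h' => h'.2 rfl) S.root_mem
  have e : (f ε).coord V = z ε ⟨V, hV, hVu⟩ := dif_pos ⟨hV, hVu⟩
  have e' : p.coord V = p.2 ⟨V, hV, hVu⟩ := dif_pos ⟨hV, hVu⟩
  rw [e]
  simp only [z]
  have hpos : 0 < max 0 (min ε 1) := lt_max_of_lt_right (lt_min hε one_pos)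
  split_ifs with h'
  · refine iff_of_false ?_ h'.2
    exact_mod_cast hpos.ne'
  · rw [← e']
    refine ⟨fun h0 => ?_, h V⟩
    by_contra hVS
    exact h' ⟨h0, hVS⟩

end Strata

/-! ### Cells and simplices -/

namespace Cell

variable {τ τ' ρ : Cell n} {q : Space σ} {V : Finset (Fin n)}

/-- The disc coordinate of a vertex. -/
def discCoord (τ : Cell n) (e : τ.Coords) (V : Finset (Fin n)) : ℂ :=
  if h : V ∈ τ.tree.verts ∧ V ≠ Finset.univ then e.2 ⟨V, h⟩ else 0

/-- The barycenter has zero disc coordinates, so along a segment they are just scaled by `s`. -/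
theorem discCoord_lineMap (e : τ.Coords) (s : ℝ) :
    τ.discCoord ((1 - s) • τ.bary + s • e) V = s * τ.discCoord e V := by
  simp only [discCoord]
  split_ifs <;> simp [bary]

theorem discCoord_bary : τ.discCoord τ.bary V = 0 := by
  simp [discCoord, bary]

theorem HasCoords.radius_eq {e : τ.Coords} (h : τ.HasCoords σ e q) (V : Finset (Fin n)) :
    q.radius σ V = if V ∈ τ.tree.verts then ‖τ.discCoord e V‖ else 1 := by
  obtain ⟨p, rfl, -, h2⟩ := h
  have : p.coord V = τ.discCoord e V := by
    simp only [Stratum.coord, discCoord, h2]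
  rw [Space.radius_mk, Stratum.radius, this]

theorem HasCoords.radius_eq_zero_iff {e : τ.Coords} (h : τ.HasCoords σ e q) :
    q.radius σ V = 0 ↔ V ∈ τ.tree.verts ∧ τ.discCoord e V = 0 := by
  rw [h.radius_eq]
  split_ifs with hV <;> simp [hV]

/-- The last entry of the list is the smallest cell. Its barycenter has zero radius at all vertices
of its tree, and coning preserves zeros. -/
theorem radius_eq_zero_of_mem_simplex {J : Set ℝ} {c : List (Cell n)} (hq : q ∈ simplex σ J c)
    (hc : c.getLast? = some τ) (hV : V ∈ τ.tree.verts) : q.radius σ V = 0 := by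
  induction c generalizing q with
  | nil => simp at hc
  | cons τ' c ih =>
    cases c with
    | nil =>
      obtain rfl : τ' = τ := by simpa using hc
      have hq : τ'.HasCoords σ τ'.bary q := hq
      exact hq.radius_eq_zero_iff.2 ⟨hV, discCoord_bary⟩
    | cons ρ c =>
      obtain ⟨e, -, ⟨z, hz, hez⟩, s, -, hs⟩ := hq
      rw [List.getLast?_cons_cons] at hc
      obtain ⟨h1, h2⟩ := hez.radius_eq_zero_iff.1 (ih hz hc)
      exact hs.radius_eq_zero_iff.2 ⟨h1, by rw [discCoord_lineMap, h2, mul_zero]⟩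

theorem mem_tree_of_mem_simplex {c : List (Cell n)} (hq : q ∈ simplex σ (Ioo 0 1) c)
    (hc : c.getLast? = some τ) (hV : q.radius σ V = 0) : V ∈ τ.tree.verts := by
  induction c generalizing q with
  | nil => simp at hc
  | cons τ' c ih =>
    cases c with
    | nil =>
      obtain rfl : τ' = τ := by simpa using hc
      have hq : τ'.HasCoords σ τ'.bary q := hq
      exact (hq.radius_eq_zero_iff.1 hV).1
    | cons ρ c =>
      obtain ⟨e, -, ⟨z, hz, hez⟩, s, hs0, hs⟩ := hq
      rw [List.getLast?_cons_cons] at hc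
      obtain ⟨h1, h2⟩ := hs.radius_eq_zero_iff.1 hV
      rw [discCoord_lineMap, mul_eq_zero, Complex.ofReal_eq_zero] at h2
      -- In the interior `s` is not zero, so a zero of the scaled coordinate was already one before
      -- coning.
      exact ih hz hc (hez.radius_eq_zero_iff.2 ⟨h1, h2.resolve_left hs0.1.ne'⟩)

theorem simplex_mono {J J' : Set ℝ} (h : J ⊆ J') (c : List (Cell n)) :
    simplex σ J c ⊆ simplex σ J' c := by
  induction c with
  | nil => exact subset_rfl
  | cons τ' c ih =>
    cases c with
    | nil => exact subset_rfl
    | cons ρ c =>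
      rintro q ⟨e, he, ⟨z, hz, hez⟩, s, hs0, hs⟩
      exact ⟨e, he, ⟨z, ih hz, hez⟩, s, h hs0, hs⟩

theorem openDualCell_subset : τ.openDualCell σ ⊆ τ.dualCell σ := by
  intro q hq
  simp only [openDualCell, dualCell, mem_iUnion] at hq ⊢
  obtain ⟨c, hc, hq⟩ := hq
  exact ⟨c, hc, simplex_mono Ioo_subset_Icc_self c hq⟩

theorem radius_eq_zero_of_mem_dualCell (hq : q ∈ τ.dualCell σ) (hV : V ∈ τ.tree.verts) :
    q.radius σ V = 0 := by
  simp only [dualCell, mem_iUnion] at hq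
  obtain ⟨c, hc, hq⟩ := hq
  exact radius_eq_zero_of_mem_simplex hq hc.2 hV

theorem mem_tree_of_mem_openDualCell (hq : q ∈ τ.openDualCell σ) (hV : q.radius σ V = 0) :
    V ∈ τ.tree.verts := by
  simp only [openDualCell, mem_iUnion] at hq
  obtain ⟨c, hc, hq⟩ := hq
  exact mem_tree_of_mem_simplex hq hc.2 hV

end Cell

/-! ### Rays from the barycenter -/

namespace CyclicWord

variable {A : Type} [DecidableEq A] {P : Finset A} (X : CyclicWord P)

theorem bary_mem_openModel : X.bary ∈ X.openModel := by
  have hpos : ∀ i, 0 < (Finset.univ.filter fun j => X.letter j = X.letter i).card := fun i =>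
    Finset.card_pos.2 ⟨i, by simp⟩
  refine ⟨fun i => by
    have : (0 : ℝ) < (Finset.univ.filter fun j => X.letter j = X.letter i).card := by
      exact_mod_cast hpos i
    simpa [bary] using this, fun B hB => ?_⟩
  obtain ⟨i, rfl⟩ := (X.mem_iff B).1 hB
  have : ((Finset.univ.filter fun j => X.letter j = X.letter i).card : ℝ) ≠ 0 := by
    exact_mod_cast (hpos i).ne'
  rw [Finset.sum_congr rfl fun j hj => by
    rw [bary, (Finset.mem_filter.1 hj).2], Finset.sum_const, nsmul_eq_mul,
    mul_one_div, div_self this]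

theorem le_one_of_mem_closedModel {l : Fin X.len → ℝ} (hl : l ∈ X.closedModel) (i : Fin X.len) :
    l i ≤ 1 := by
  rw [← hl.2 (X.letter i) ((X.mem_iff _).2 ⟨i, rfl⟩)]
  exact Finset.single_le_sum (f := l) (fun j _ => hl.1 j) (Finset.mem_filter.2 ⟨Finset.mem_univ i, rfl⟩)

end CyclicWord

namespace Cell

variable (τ : Cell n)

theorem bary_mem_openModel : τ.bary ∈ τ.openModel :=
  ⟨fun S => (τ.word S).bary_mem_openModel, fun S => by simp [bary]⟩

theorem openModel_subset_closedModel : τ.openModel ⊆ τ.closedModel := fun _ h =>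
  ⟨fun S => (τ.word S).openModel_subset_closedModel (h.1 S), fun S => (h.2 S).le⟩

/-- A point of the open model different from the barycenter lies on a segment from the barycenter
to a boundary point. -/
theorem exists_boundary {e₀ : τ.Coords} (h : e₀ ∈ τ.openModel) (hne : e₀ ≠ τ.bary) :
    ∃ e ∈ τ.closedModel, e ∉ τ.openModel ∧ ∃ s ∈ Ioo (0 : ℝ) 1,
      e₀ = (1 - s) • τ.bary + s • e := by
  classical
  set v := e₀ - τ.bary with hv
  let f : ℝ → τ.Coords := fun t => τ.bary + t • v
  have hf : Continuous f := by fun_prop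
  have hf1 : f 1 = e₀ := by simp [f, v]
  have hclosed : IsClosed τ.closedModel := by
    have : τ.closedModel = {e | (∀ S : τ.tree.verts, (∀ i, 0 ≤ e.1 S i) ∧ ∀ B ∈ τ.tree.inEdges S.1,
        ∑ i with (τ.word S).letter i = B, e.1 S i = 1) ∧ ∀ S, ‖e.2 S‖ ≤ 1} := rfl
    rw [this]
    simp only [Set.ofPred_and, Set.ofPred_forall]
    refine IsClosed.inter (isClosed_iInter fun S => IsClosed.inter (isClosed_iInter fun i => ?_)
      (isClosed_iInter fun B => isClosed_iInter fun _ => ?_)) (isClosed_iInter fun S => ?_)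
    · exact isClosed_le continuous_const (by fun_prop)
    · exact isClosed_eq (continuous_finsetSum _ fun i _ => by fun_prop) continuous_const
    · exact isClosed_le (by fun_prop) continuous_const
  have hbound : ∀ e ∈ τ.closedModel, ‖e‖ ≤ 1 := by
    intro e he
    refine (Prod.norm_def e).trans_le (max_le ?_ ?_)
    · refine (pi_norm_le_iff_of_nonneg zero_le_one).2 fun S =>
        (pi_norm_le_iff_of_nonneg zero_le_one).2 fun i => ?_
      rw [Real.norm_of_nonneg ((he.1 S).1 i)]
      exact (τ.word S).le_one_of_mem_closedModel (he.1 S) i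
    · exact (pi_norm_le_iff_of_nonneg zero_le_one).2 he.2
  have hvpos : 0 < ‖v‖ := norm_pos_iff.2 (sub_ne_zero.2 hne)
  -- The ray from the barycenter through `e₀` is followed to its last time in the closed model. This
  -- exists because the model is closed and bounded; the parameter on the segment is the inverse of
  -- that time.
  let K : Set ℝ := f ⁻¹' τ.closedModel ∩ Ici 1
  have hK1 : (1 : ℝ) ∈ K := by
    refine ⟨?_, mem_Ici.2 le_rfl⟩
    rw [mem_preimage, hf1]
    exact τ.openModel_subset_closedModel h
  have hKsub : K ⊆ Icc 1 (2 / ‖v‖) := by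
    rintro t ⟨ht, ht1⟩
    refine ⟨ht1, ?_⟩
    rw [le_div_iff₀ hvpos]
    have h1 : ‖t • v‖ = t * ‖v‖ := by
      rw [norm_smul, Real.norm_of_nonneg (zero_le_one.trans ht1)]
    have h2 : t • v = f t - τ.bary := by simp [f]
    rw [← h1, h2]
    have h3 := hbound _ ht
    have h4 := hbound _ (τ.openModel_subset_closedModel τ.bary_mem_openModel)
    have h5 := norm_sub_le (f t) τ.bary
    linarith
  have hKc : IsCompact K :=
    isCompact_Icc.of_isClosed_subset ((hclosed.preimage hf).inter isClosed_Ici) hKsub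
  obtain ⟨t, ⟨ht, ht1⟩, hmax⟩ := hKc.exists_isGreatest ⟨1, hK1⟩
  have hnot : f t ∉ τ.openModel := by
    intro hopen
    -- The strict inequalities persist slightly beyond an open point, and the affine conditions on
    -- the sums hold along the whole line, so the ray could be continued.
    have hev : ∀ᶠ t' in nhds t, (∀ S i, 0 < (f t').1 S i) ∧ ∀ S, ‖(f t').2 S‖ < 1 := by
      refine Filter.Eventually.and (Filter.eventually_all.2 fun S => Filter.eventually_all.2
        fun i => ?_) (Filter.eventually_all.2 fun S => ?_)
      · exact (isOpen_lt continuous_const (by fun_prop)).mem_nhds ((hopen.1 S).1 i)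
      · exact (isOpen_lt (by fun_prop) continuous_const).mem_nhds (hopen.2 S)
    obtain ⟨t', ⟨h1, h2⟩, htt'⟩ := ((hev.filter_mono nhdsWithin_le_nhds).and
      (self_mem_nhdsWithin (a := t) (s := Ioi t))).exists
    have htt' : t < t' := htt'
    refine absurd (hmax ⟨⟨fun S => ⟨fun i => (h1 S i).le, fun B hB => ?_⟩, fun S => (h2 S).le⟩,
      (show (1 : ℝ) ≤ t from ht1).trans htt'.le⟩) (not_le.2 htt')
    have e1 : ∀ i, (f t').1 S i = τ.bary.1 S i + t' * (e₀.1 S i - τ.bary.1 S i) := fun i => rfl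
    simp only [e1]
    rw [Finset.sum_add_distrib, ← Finset.mul_sum, Finset.sum_sub_distrib, (h.1 S).2 B hB,
      (τ.bary_mem_openModel.1 S).2 B hB]
    ring
  have ht1' : 1 < t := lt_of_le_of_ne ht1 fun h1 => hnot (by rw [← h1, hf1]; exact h)
  have ht0 : t ≠ 0 := (one_pos.trans ht1').ne'
  refine ⟨f t, ht, hnot, t⁻¹, ⟨inv_pos.2 (one_pos.trans ht1'), inv_lt_one_of_one_lt₀ ht1'⟩, ?_⟩
  simp only [f, smul_add, smul_smul, inv_mul_cancel₀ ht0, one_smul, hv, sub_smul]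
  abel

end Cell

/-! ### The open dual cells cover the space of nested cacti -/

namespace CyclicWord

variable {A : Type} [DecidableEq A] {P : Finset A} {X : CyclicWord P}

theorem Realizes.ncard_out_le {l : Fin X.len → ℝ} {x : UnbasedCactus P} (h : X.Realizes l x)
    (hl : l ∈ X.closedModel) :
    x.out.doublePoints.ncard ≤ (Finset.univ.filter fun i => 0 < l i).card := by
  rw [← x.out_eq] at h
  exact h.ncard_le hl

theorem Realizes.ncard_out_eq {l : Fin X.len → ℝ} {x : UnbasedCactus P} (h : X.Realizes l x)
    (hl : l ∈ X.openModel) : x.out.doublePoints.ncard = X.len := by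
  rw [← x.out_eq] at h
  exact h.ncard_eq hl

end CyclicWord

namespace Cell

variable {τ τ' : Cell n} {q : Space σ}

/-- The complexity of a cell: the number of vertices of the tree, and the total length of the
words, ordered lexicographically. -/
def complexity (τ : Cell n) : ℕ ×ₗ ℕ := toLex (τ.tree.verts.card, ∑ S, (τ.word S).len)

theorem HasCoords.radius_lt_one_iff {e : τ.Coords} (h : τ.HasCoords σ e q) (he : e ∈ τ.openModel)
    {V : Finset (Fin n)} : q.radius σ V < 1 ↔ V ∈ τ.tree.verts := by
  rw [h.radius_eq]
  split_ifs with hV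
  · simp only [hV, iff_true, discCoord]
    split_ifs with hV'
    · exact he.2 _
    · simp
  · simp [hV]

/-- Both components are invariants of the point: the vertices are the sets of radius less than one,
and the word lengths are the numbers of double points of the decorating cacti. -/
theorem complexity_eq_of_mem (hq : q ∈ τ.openCell σ) (hq' : q ∈ τ'.openCell σ) :
    τ.complexity = τ'.complexity := by
  obtain ⟨T, X⟩ := τ
  obtain ⟨T', X'⟩ := τ'
  obtain ⟨e, he, h⟩ := hq
  obtain ⟨e', he', h'⟩ := hq'
  obtain rfl : T = T' := NestedTree.ext (Finset.ext fun V =>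
    (h.radius_lt_one_iff he).symm.trans (h'.radius_lt_one_iff he'))
  obtain ⟨p, hp, h1, -⟩ := h
  obtain ⟨p', hp', h1', -⟩ := h'
  have hpp : p.1 = p'.1 := Stratum.eq_of_mk_eq (hp.symm.trans hp')
  refine congrArg (fun m => toLex (T.verts.card, m)) (Finset.sum_congr rfl fun S _ => ?_)
  rw [← (h1 S).ncard_out_eq (he.1 S), ← (h1' S).ncard_out_eq (he'.1 S), hpp]

/-- Either a disc coordinate has norm one, and that vertex is missing from the smaller tree, or the
trees agree and some arc has length zero, so that there are fewer double points than letters. -/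
theorem complexity_lt_of_mem {e : τ.Coords} (he : e ∈ τ.closedModel) (hne : e ∉ τ.openModel)
    (h : τ.HasCoords σ e q) (hq : q ∈ τ'.openCell σ) : τ'.complexity < τ.complexity := by
  obtain ⟨T, X⟩ := τ
  obtain ⟨T', X'⟩ := τ'
  obtain ⟨e', he', h'⟩ := hq
  have hsub : T'.verts ⊆ T.verts := fun V hV => by
    have := (h'.radius_lt_one_iff he').2 hV
    rw [h.radius_eq] at this
    by_contra hV'
    rw [if_neg hV'] at this
    exact lt_irrefl _ this
  refine Prod.Lex.toLex_lt_toLex.2 ?_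
  by_cases hT : T'.verts = T.verts
  · refine Or.inr ⟨congrArg Finset.card hT, ?_⟩
    obtain rfl : T = T' := NestedTree.ext hT.symm
    have hrad := fun V => (h'.radius_lt_one_iff he' (V := V)).2
    simp only [h.radius_eq] at hrad
    obtain ⟨p, hp, h1, -⟩ := h
    obtain ⟨p', hp', h1', -⟩ := h'
    have hpp : p.1 = p'.1 := Stratum.eq_of_mk_eq (hp.symm.trans hp')
    have hle : ∀ S, (X' S).len ≤ (Finset.univ.filter fun i => 0 < e.1 S i).card := fun S => by
      rw [← (h1' S).ncard_out_eq (he'.1 S), ← hpp]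
      exact (h1 S).ncard_out_le (he.1 S)
    have hdisc : ∀ S, ‖e.2 S‖ < 1 := fun S => by
      have := hrad S S.2.1
      rw [if_pos S.2.1, discCoord, dif_pos S.2] at this
      exact this
    obtain ⟨S, i, hi⟩ : ∃ S i, ¬ 0 < e.1 S i := by
      by_contra hno
      push Not at hno
      exact hne ⟨fun S => ⟨hno S, (he.1 S).2⟩, hdisc⟩
    refine Finset.sum_lt_sum (fun S _ => (hle S).trans ?_) ⟨S, Finset.mem_univ S, (hle S).trans_lt ?_⟩
    · simpa using Finset.card_filter_le (Finset.univ : Finset (Fin (X S).len)) fun i => 0 < e.1 S i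
    · have : (Finset.univ.filter fun i => 0 < e.1 S i).card < Finset.univ.card :=
        Finset.card_lt_card (Finset.filter_ssubset.2 ⟨i, Finset.mem_univ i, hi⟩)
      simpa using this
  · exact Or.inl (Finset.card_lt_card (Finset.ssubset_iff_subset_ne.2 ⟨hsub, hT⟩))

theorem exists_hasCoords (σ : Sections n) {e : τ.Coords} (he : e ∈ τ.closedModel) :
    ∃ q : Space σ, τ.HasCoords σ e q := by
  choose x hx using fun S => (τ.word S).exists_realizes (he.1 S)
    (NestedTree.two_le_card_inEdges S.2)
  exact ⟨_, ⟨x, fun S => ⟨e.2 S, mem_closedBall_zero_iff.2 (he.2 S)⟩⟩, rfl, hx, fun S => rfl⟩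

theorem realizes_of_sim {T : NestedTree n} {p q : Stratum T} {S : Finset (Fin n)} (hS : S ∈ T.verts)
    {X : CyclicWord (T.inEdges S)} {l : Fin X.len → ℝ} (h : X.Realizes l (p.1 ⟨S, hS⟩))
    (hl : l ∈ X.closedModel) (hs : Sim (p.secMap σ S) (q.secMap σ S)) :
    ∃ l' ∈ X.closedModel, X.Realizes l' (q.1 ⟨S, hS⟩) := by
  rw [← σ.mk_sec _ (p.1 ⟨S, hS⟩)] at h
  rw [← σ.mk_sec _ (q.1 ⟨S, hS⟩)]
  rw [Stratum.secMap, Stratum.secMap, dif_pos hS, dif_pos hS] at hs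
  exact h.of_sim hl (NestedTree.two_le_card_inEdges hS) hs

theorem sim_of_realizes {T : NestedTree n} {p q : Stratum T} {S : Finset (Fin n)} (hS : S ∈ T.verts)
    {X : CyclicWord (T.inEdges S)} {l l' : Fin X.len → ℝ} (h : X.Realizes l (p.1 ⟨S, hS⟩))
    (h' : X.Realizes l' (q.1 ⟨S, hS⟩)) (hl : l ∈ X.openModel) (hl' : l' ∈ X.openModel) :
    Sim (p.secMap σ S) (q.secMap σ S) := by
  rw [← σ.mk_sec _ (p.1 ⟨S, hS⟩)] at h
  rw [← σ.mk_sec _ (q.1 ⟨S, hS⟩)] at h'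
  rw [Stratum.secMap, Stratum.secMap, dif_pos hS, dif_pos hS]
  exact h.sim h' hl hl'

/-- Every point of the boundary of a cell lies in an open cell which is a proper face. -/
theorem exists_isProperFace {e : τ.Coords} (he : e ∈ τ.closedModel) (hne : e ∉ τ.openModel)
    (h : τ.HasCoords σ e q) : ∃ τ' : Cell n, q ∈ τ'.openCell σ ∧ IsProperFace σ τ' τ := by
  obtain ⟨p, rfl, hp1, hp2⟩ := id h
  obtain ⟨T', p', hpp', hlt, hext⟩ := Stratum.exists_reduced σ p
  choose X l hl hX using fun S => CyclicWord.exists_mem_openModel (p'.1 S)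
    (NestedTree.two_le_card_inEdges S.2)
  have hmem : Space.mk σ τ.tree p ∈ (⟨T', X⟩ : Cell n).openCell σ := by
    refine ⟨(l, fun S => p'.2 S), ⟨hl, fun S => ?_⟩, p', hpp', hX, fun S => rfl⟩
    have := hlt S
    rwa [Stratum.coord, dif_pos S.2] at this
  refine ⟨⟨T', X⟩, hmem, fun w hw => ⟨?_, fun hw' => ?_⟩⟩
  · obtain ⟨e', he', q', rfl, hq1, -⟩ := hw
    -- Every point of the new open cell has the type of `p'`, so it lifts to decorations over the
    -- original tree of the type of `p`, and these stay in the closed cell.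
    obtain ⟨r, hr, hs⟩ := hext q' fun S hS =>
      sim_of_realizes hS (hX ⟨S, hS⟩) (hq1 ⟨S, hS⟩) (hl ⟨S, hS⟩) (he'.1 ⟨S, hS⟩)
    choose m hm hmr using fun S : τ.tree.verts => realizes_of_sim S.2 (hp1 S) (he.1 S) (hs S S.2)
    exact ⟨(m, fun S => r.2 S), ⟨hm, fun S => mem_closedBall_zero_iff.1 (r.2 S).2⟩, r, hr.symm, hmr,
      fun S => rfl⟩
  -- A common point of the two open cells would force equal complexities.
  · exact (complexity_lt_of_mem he hne h hmem).ne (complexity_eq_of_mem hw hw')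

theorem exists_mem_openCell (q : Space σ) : ∃ τ : Cell n, q ∈ τ.openCell σ := by
  obtain ⟨T, p, rfl⟩ := Space.exists_mk q
  obtain ⟨T', p', hpp', hlt, -⟩ := Stratum.exists_reduced σ p
  choose X l hl hX using fun S => CyclicWord.exists_mem_openModel (p'.1 S)
    (NestedTree.two_le_card_inEdges S.2)
  refine ⟨⟨T', X⟩, (l, fun S => p'.2 S), ⟨hl, fun S => ?_⟩, p', hpp', hX, fun S => rfl⟩
  have := hlt S
  rwa [Stratum.coord, dif_pos S.2] at this

/-- Radial projection from the barycenter reaches a proper face of smaller complexity, where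
induction provides a simplex; the point lies in the interior of the cone over it. The barycenter
itself is the start of the recursion. -/
theorem exists_simplex_of_mem_openCell (hq : q ∈ τ.openCell σ) :
    ∃ (c : List (Cell n)) (τ₀ : Cell n), IsChainFrom σ τ₀ (τ :: c) ∧
      q ∈ simplex σ (Ioo 0 1) (τ :: c) := by
  induction hk : τ.complexity using WellFoundedLT.induction generalizing τ q with
  | _ k ih =>
    subst hk
    obtain ⟨e₀, he₀, h₀⟩ := hq
    by_cases hb : e₀ = τ.bary
    · subst hb
      exact ⟨[], τ, ⟨List.isChain_singleton τ, rfl⟩, h₀⟩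
    obtain ⟨e, he, hne, s, hs, rfl⟩ := τ.exists_boundary he₀ hb
    obtain ⟨z, hz⟩ := exists_hasCoords σ he
    obtain ⟨τ', hz', hface⟩ := exists_isProperFace he hne hz
    obtain ⟨c, τ₀, hc, hzc⟩ := ih _ (complexity_lt_of_mem he hne hz hz') hz' rfl
    refine ⟨τ' :: c, τ₀, ⟨List.IsChain.cons_cons hface hc.1, ?_⟩, e, he, ⟨z, hzc, hz⟩, s, hs, h₀⟩
    rw [List.getLast?_cons_cons]
    exact hc.2

theorem exists_mem_openDualCell (q : Space σ) : ∃ τ : Cell n, q ∈ τ.openDualCell σ := by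
  obtain ⟨τ, hq⟩ := exists_mem_openCell q
  obtain ⟨c, τ₀, hc, hqc⟩ := exists_simplex_of_mem_openCell hq
  exact ⟨τ₀, mem_iUnion₂.2 ⟨_, hc, hqc⟩⟩

end Cell

end NestedCacti

end

theorem mainTheorem10 {n : ℕ} (σ : NestedCacti.Sections n) (S : NestedCacti.NestedTree n) :
    NestedCacti.closedStratum σ S =
        (⋃ τ ∈ {τ : NestedCacti.Cell n | S.verts ⊆ τ.tree.verts}, τ.dualCell σ) ∧
      NestedCacti.IsDualSubcomplex σ (NestedCacti.closedStratum σ S) ∧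
      NestedCacti.closedStratum σ S = closure (NestedCacti.openStratum σ S) := by
  open NestedCacti NestedCacti.Cell in
  refine ⟨?_, ⟨isClosed_closedStratum, fun q _ => ?_, fun τ ⟨q, hq, hqS⟩ => ?_⟩,
    closedStratum_eq_closure⟩
  · ext q
    rw [mem_closedStratum_iff]
    constructor
    · intro h
      obtain ⟨τ, hτ⟩ := exists_mem_openDualCell q
      exact mem_iUnion₂.2 ⟨τ, fun V hV => mem_tree_of_mem_openDualCell hτ (h V hV),
        openDualCell_subset hτ⟩
    · intro h V hV
      obtain ⟨τ, hτ, hq⟩ := mem_iUnion₂.1 h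
      exact radius_eq_zero_of_mem_dualCell hq (hτ hV)
  · exact mem_iUnion.2 (exists_mem_openDualCell q)
  -- One point of the open dual cell in the stratum forces `S` into the tree of `τ`, and then the
  -- whole dual cell has vanishing radii at `S`.
  · have hsub : τ.dualCell σ ⊆ closedStratum σ S := fun r hr => mem_closedStratum_iff.2 fun V hV =>
      radius_eq_zero_of_mem_dualCell hr
        (mem_tree_of_mem_openDualCell hq (mem_closedStratum_iff.1 hqS V hV))
    exact ⟨openDualCell_subset.trans hsub, hsub⟩
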